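/- Let $\xi_1,\xi_2,\dots$ be an i.i.d. sample from a distribution $\Pi$, let $f(x,\xi)$ be a real loss function, $x\in\mathbb{R}^d$, and let $F(x)=\mathbb{E}_{\xi\sim\Pi}f(x,\xi)$ (assumed to be finite) have the minimizer $x^*$. Let $1/2<\alpha<1$, $\eta>0$, $C>0$, let $x_0\in\mathbb{R}^d$ be a fixed initial point and, with $\nabla f$ the gradient in the first argument, $$x_i=x_{i-1}-\eta\, i^{-\alpha}\,\nabla f(x_{i-1},\xi_i),\qquad i\ge 1 .$$ Write $\bar x_n=n^{-1}\sum_{i=1}^n x_i$, $\delta_n=x_n-x^*$, $\epsilon_n=\nabla F(x_{n-1})-\nabla f(x_{n-1},\xi_n)$, and $\mathbb{E}_{n-1}$ for the conditional expectation given $\xi_1,\dots,\xi_{n-1}$; $\|\cdot\|_2$ is the Euclidean norm of vectors and the operator norm of matrices. Assume: 1. $F$ is continuously differentiable; there is $\mu>0$ with $F(x_2)\ge F(x_1)+\langle\nabla F(x_1),x_2-x_1\rangle+\frac{\mu}{2}\|x_1-x_2\|_2^2$ for all $x_1,x_2$; $\nabla F$ is Lipschitz continuous; $A=\nabla^2F(x^*)$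 exists, and $\|\nabla F(x)-A(x-x^*)\|_2=O(\|x-x^*\|_2^2)$ as $x\to x^*$. 2. (a) $f(\cdot,\xi)$ is continuously differentiable for every $\xi$, and every point of $\mathbb{R}^d$ has a neighbourhood $U$ such that the family $\{\nabla f(x,\xi)\}_{x\in U}$, $\xi\sim\Pi$, is uniformly integrable; $S=\mathbb{E}\big(\nabla f(x^*,\xi)\nabla f(x^*,\xi)^T\big)$ is finite. (b) There is a constant $C_1$ with $\|\mathbb{E}_{n-1}\epsilon_n\epsilon_n^T-S\|_2\le C_1(\|\delta_{n-1}\|_2+\|\delta_{n-1}\|_2^2)$ almost surely for all $n\ge1$. (c) There is a constant $C_2$ with $\mathbb{E}_{n-1}\|\epsilon_n\|_2^4\le C_2(1+\|\delta_{n-1}\|_2^4)$ almost surely for all $n\ge1$. Put $a_1=1$ and $a_k=\lfloor C k^{2/(1-\alpha)}\rfloor$ for $k\ge2$; for $i\ge1$ let $t_i$ be the largest of the numbers $a_m$ $(m\ge1)$ with $a_m\le i$ (if $(a_m)$ is strictly increasing, this is the $a_m$ with $a_m\le i<a_{m+1}$), and let $l_i=i-t_i+1$. Let $$\hat\Sigma_n=\frac{\sum_{i=1}^n\big(\sum_{k=t_i}^i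 x_k-l_i\bar x_n\big)\big(\sum_{k=t_i}^i x_k-l_i\bar x_n\big)^T}{\sum_{i=1}^n l_i},\qquad \Sigma=A^{-1}SA^{-1}.$$ Then $\mathbb{E}\|\hat\Sigma_n-\Sigma\|_2<\infty$ for every $n\ge1$, and there is a constant $K$, not depending on $n$, such that for all sufficiently large $n$ $$\mathbb{E}\|\hat\Sigma_n-\Sigma\|_2\le K\,n^{-(1-\alpha)/4}.$$ -/

import Mathlib

open MeasureTheory ProbabilityTheory Filter Asymptotics
open scoped Topology Gradient

noncomputable section

namespace OnlineSGD

/-- The parameter space `ℝᵈ` with the Euclidean norm. Real `d × d` matrices are represented by the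
(continuous) linear maps `Vec d →L[ℝ] Vec d`, whose norm is the operator norm `‖·‖₂`. -/
abbrev Vec (d : ℕ) : Type := EuclideanSpace ℝ (Fin d)

/-- The outer product `u uᵀ`, as the linear map `v ↦ ⟨u, v⟩ u`. -/
def outer {d : ℕ} (u : Vec d) : Vec d →L[ℝ] Vec d := InnerProductSpace.rankOne ℝ u u

section Estimator

variable {d : ℕ}

/-- The average `x̄ₙ = n⁻¹ ∑_{i=1}^n xᵢ`. -/
def average (x : ℕ → Vec d) (n : ℕ) : Vec d := (n : ℝ)⁻¹ • ∑ i ∈ Finset.Icc 1 n, x i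

/-- `tᵢ`, the starting index of the motivating batch that contains `i`: the largest `a_m`, `m ≥ 1`,
with `a_m ≤ i`. For a strictly increasing sequence with `a₁ = 1` and for `i ≥ 1`, this is the `a_m`
with `a_m ≤ i < a_{m+1}`. -/
def batchStart (a : ℕ → ℕ) (i : ℕ) : ℕ := sSup {j | ∃ m, 1 ≤ m ∧ a m = j ∧ j ≤ i}

/-- `lᵢ = i - tᵢ + 1`, the number of elements of the batch `Bᵢ = {x_{tᵢ}, …, xᵢ}`
(there is no truncation, as `tᵢ ≤ i`). -/
def batchLength (a : ℕ → ℕ) (i : ℕ) : ℕ := i - batchStart a i + 1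

/-- The centred batch sum `∑_{k=tᵢ}^i x_k - lᵢ x̄ₙ`. -/
def centredBatchSum (a : ℕ → ℕ) (x : ℕ → Vec d) (n i : ℕ) : Vec d :=
  (∑ k ∈ Finset.Icc (batchStart a i) i, x k) - (batchLength a i : ℝ) • average x n

/-- The recursive estimator
`Σ̂ₙ = (∑ᵢ lᵢ)⁻¹ ∑ᵢ (∑_{k=tᵢ}^i x_k - lᵢ x̄ₙ) (∑_{k=tᵢ}^i x_k - lᵢ x̄ₙ)ᵀ`, `i = 1, …, n`. -/
def covEstimator (a : ℕ → ℕ) (x : ℕ → Vec d) (n : ℕ) : Vec d →L[ℝ] Vec d :=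
  (∑ i ∈ Finset.Icc 1 n, (batchLength a i : ℝ))⁻¹ •
    ∑ i ∈ Finset.Icc 1 n, outer (centredBatchSum a x n i)

/-- The sequence `a₁ = 1`, `a_k = ⌊C k^{2/(1-α)}⌋` for `k ≥ 2`. -/
def batchSeq (C α : ℝ) (k : ℕ) : ℕ :=
  if k ≤ 1 then 1 else ⌊C * (k : ℝ) ^ (2 / (1 - α))⌋₊

end Estimator

section Model

variable {d : ℕ} {Ω Ξ : Type*} [MeasurableSpace Ω] [MeasurableSpace Ξ]

/-- The objective `F(x) = E_{ξ ∼ Π} f(x, ξ)`. -/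
def objective (f : Vec d → Ξ → ℝ) (Pi : Measure Ξ) (x : Vec d) : ℝ := ∫ z, f x z ∂Pi

/-- `∇f(x, z)`, the gradient of the loss with respect to its first argument. -/
def lossGrad (f : Vec d → Ξ → ℝ) (x : Vec d) (z : Ξ) : Vec d := ∇ (fun y => f y z) x

/-- The step size `ηᵢ = η i^{-α}`. -/
def stepSize (η α : ℝ) (i : ℕ) : ℝ := η * (i : ℝ) ^ (-α)

/-- The SGD iterates `xᵢ = xᵢ₋₁ - ηᵢ ∇f(xᵢ₋₁, ξᵢ)`, `i ≥ 1`, for a realization `z` of the sample,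
with the deterministic initial point `x₀`. -/
def sgd (f : Vec d → Ξ → ℝ) (η α : ℝ) (x₀ : Vec d) (z : ℕ → Ξ) : ℕ → Vec d
  | 0 => x₀
  | n + 1 => sgd f η α x₀ z n - stepSize η α (n + 1) • lossGrad f (sgd f η α x₀ z n) (z (n + 1))

/-- `ξ₁, ξ₂, …` is an i.i.d. sample from the distribution `Π` (the entry of index `0` is not
used). -/
structure IsIIDSample (ξ : ℕ → Ω → Ξ) (Pi : Measure Ξ) (P : Measure Ω) : Prop where
  measurable : ∀ i, 1 ≤ i → Measurable (ξ i)
  law : ∀ i, 1 ≤ i → P.map (ξ i) = Pi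
  indep : iIndepFun (fun i => ξ (i + 1)) P

/-- The `σ`-algebra `ℱₙ` generated by `ξ₁, …, ξₙ`. -/
abbrev past (ξ : ℕ → Ω → Ξ) (n : ℕ) : MeasurableSpace Ω :=
  ⨆ i ∈ Finset.Icc 1 n, MeasurableSpace.comap (ξ i) inferInstance

/-- The gradient difference `εₙ = ∇F(xₙ₋₁) - ∇f(xₙ₋₁, ξₙ)`, used for `n ≥ 1`. -/
def gradNoise (f : Vec d → Ξ → ℝ) (Pi : Measure Ξ) (η α : ℝ) (x₀ : Vec d) (ξ : ℕ → Ω → Ξ)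
    (n : ℕ) (ω : Ω) : Vec d :=
  ∇ (objective f Pi) (sgd f η α x₀ (fun i => ξ i ω) (n - 1)) -
    lossGrad f (sgd f η α x₀ (fun i => ξ i ω) (n - 1)) (ξ n ω)

/-- The Hessian `∇²F(x)`, as the derivative of the gradient. -/
def hessian (F : Vec d → ℝ) (x : Vec d) : Vec d →L[ℝ] Vec d := fderiv ℝ (∇ F) x

/-- `S = E([∇f(x*, ξ)] [∇f(x*, ξ)]ᵀ)`. -/
def gradCov (f : Vec d → Ξ → ℝ) (Pi : Measure Ξ) (xstar : Vec d) : Vec d →L[ℝ] Vec d :=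
  ∫ z, outer (lossGrad f xstar z) ∂Pi

/-- The sandwich covariance `Σ = A⁻¹ S A⁻¹` with `A = ∇²F(x*)`. -/
def sandwich (f : Vec d → Ξ → ℝ) (Pi : Measure Ξ) (xstar : Vec d) : Vec d →L[ℝ] Vec d :=
  (hessian (objective f Pi) xstar).inverse ∘L gradCov f Pi xstar ∘L
    (hessian (objective f Pi) xstar).inverse

/-- Regularity of the objective function `F` with minimizer `x*`: it is continuously differentiable
and strongly convex, its gradient is Lipschitz, and the gradient has a first-order Taylor expansion
at `x*`, with the Hessian as linear part and a remainder of second order. -/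
structure RegularObjective (F : Vec d → ℝ) (xstar : Vec d) : Prop where
  contDiff : ContDiff ℝ 1 F
  isMin : ∀ x, F xstar ≤ F x
  strongConvex : ∃ μ : ℝ, 0 < μ ∧ ∀ x₁ x₂ : Vec d,
    F x₂ ≥ F x₁ + inner ℝ (∇ F x₁) (x₂ - x₁) + μ / 2 * ‖x₁ - x₂‖ ^ 2
  lipschitz : ∃ L : ℝ, 0 < L ∧ ∀ x₁ x₂ : Vec d, ‖∇ F x₁ - ∇ F x₂‖ ≤ L * ‖x₁ - x₂‖
  hessian_exists : DifferentiableAt ℝ (∇ F) xstar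
  taylor : (fun x => ∇ F x - hessian F xstar (x - xstar)) =O[𝓝 xstar]
    (fun x => ‖x - xstar‖ ^ 2)

/-- Regularity of the loss: `f(x, ·)` is measurable and integrable (so that `F` is defined),
`f(·, z)` is continuously differentiable, `∇f(x, ξ)` is uniformly integrable as `x` ranges over a
neighbourhood of any given point, and `∇f(x*, ξ)` has a second moment (so that `S` is defined). -/
structure RegularLoss (f : Vec d → Ξ → ℝ) (Pi : Measure Ξ) (xstar : Vec d) : Prop where
  measurable : ∀ x, Measurable (f x)
  integrable : ∀ x, Integrable (f x) Pi
  contDiff : ∀ z, ContDiff ℝ 1 (fun x => f x z)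
  unifIntegrable : ∀ x : Vec d, ∃ U : Set (Vec d), U ∈ 𝓝 x ∧
    UniformIntegrable (fun (y : U) (z : Ξ) => lossGrad f (y : Vec d) z) 1 Pi
  secondMoment : MemLp (lossGrad f xstar) 2 Pi

/-- Conditional moments of the gradient difference, `δₙ = xₙ - x*`:
`‖Eₙ₋₁ εₙ εₙᵀ - S‖₂ ≤ C (‖δₙ₋₁‖ + ‖δₙ₋₁‖²)` and `Eₙ₋₁ ‖εₙ‖⁴ ≤ C (1 + ‖δₙ₋₁‖⁴)`, where
`Eₙ₋₁` is the conditional expectation given `ℱₙ₋₁`. The integrability of `‖εₙ‖⁴` gives both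
conditional expectations their meaning. -/
structure NoiseMoments (f : Vec d → Ξ → ℝ) (Pi : Measure Ξ) (xstar : Vec d) (η α : ℝ)
    (x₀ : Vec d) (ξ : ℕ → Ω → Ξ) (P : Measure Ω) : Prop where
  integrable : ∀ n, 1 ≤ n → Integrable (fun ω => ‖gradNoise f Pi η α x₀ ξ n ω‖ ^ 4) P
  covariance : ∃ C : ℝ, ∀ n, 1 ≤ n → ∀ᵐ ω ∂P,
    ‖(P[fun ω' => outer (gradNoise f Pi η α x₀ ξ n ω') | past ξ (n - 1)]) ω
        - gradCov f Pi xstar‖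
      ≤ C * (‖sgd f η α x₀ (fun i => ξ i ω) (n - 1) - xstar‖
        + ‖sgd f η α x₀ (fun i => ξ i ω) (n - 1) - xstar‖ ^ 2)
  fourth : ∃ C : ℝ, ∀ n, 1 ≤ n → ∀ᵐ ω ∂P,
    (P[fun ω' => ‖gradNoise f Pi η α x₀ ξ n ω'‖ ^ 4 | past ξ (n - 1)]) ω
      ≤ C * (1 + ‖sgd f η α x₀ (fun i => ξ i ω) (n - 1) - xstar‖ ^ 4)

end Model

end OnlineSGD

end

noncomputable section

set_option linter.unusedSectionVars false

namespace OnlineSGD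

/-! Write δ_k = x_k - x*, A for the Hessian at x*, and r_k for the Taylor remainder of ∇F at x_k.
Solving the SGD recursion for the linear part gives A δ_k = ε_{k+1} - r_k + η⁻¹ (k+1)^α (δ_k -
δ_{k+1}). Sum this over a batch and sum by parts: the batch sum of the errors is A⁻¹ times the batch
sum of the noise, plus terms controlled by moments of δ (`exists_rms_linearization`). The moments
come from strong convexity: the noiseless step is a contraction and the term linear in the noise has
mean zero, so E‖δ_k‖⁴ satisfies a perturbed contraction and is O(k^{-2α})
(`exists_fourth_moment_le`).

Centring at the sample mean instead of x* costs l_i ‖x̄_n - x*‖, and x̄_n - x* is O(n^{-1/2}) in L².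
As l_i = O(i^{(1+α)/2}), each centred batch sum is A⁻¹ times a noise sum, up to O(n^{α/2}) in L²
(`exists_rms_residual`), whereas the noise sum has size √l_i = O(n^{(1+α)/4}).

Fix an entry of the numerator of the estimator and subtract l_i times the same entry of A⁻¹SA⁻¹ from
each summand. What remains splits into three sums over i ≤ n (`exists_mean_entry_le`). The products
of noise sums minus their conditional covariances have conditional mean zero given the past of the
batch. They are therefore orthogonal across batches, and their sum is O(n^{(5+3α)/4}) in L²
(`rms_sum_winMart`). The conditional covariances differ from S by O(k^{-α/2}), which contributes
O(n^{3/2}). The products with a residual contribute n · n^{(1+α)/4} · n^{α/2} = n^{(5+3α)/4}, and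
the squared residuals n^{1+α}. All are O(n^{(5+3α)/4}) in mean.

Few batches start before n, so most batch lengths are large and their total is at least c
n^{(3+α)/2} (`exists_le_sum_batchLength`). The quotient of the two powers is n^{-(1-α)/4}. -/

theorem integral_add_add {Ω : Type*} [MeasurableSpace Ω] {P : Measure Ω} {f g h : Ω → ℝ}
    (hf : Integrable f P) (hg : Integrable g P) (hh : Integrable h P) :
    ∫ ω, (f ω + g ω + h ω) ∂P = ∫ ω, f ω ∂P + ∫ ω, g ω ∂P + ∫ ω, h ω ∂P := by
  have h1 : Integrable (fun ω => f ω + g ω) P := hf.add hg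
  rw [integral_add h1 hh, integral_add hf hg]

/-! ### Calculus of L² bounds. -/

section RootMeanSquare

variable {Ω E F : Type*} [MeasurableSpace Ω] {P : Measure Ω} [NormedAddCommGroup E]
  [NormedAddCommGroup F]

/-- `X` is square integrable with root mean square at most `s`. -/
structure RMSLE (P : Measure Ω) (X : Ω → E) (s : ℝ) : Prop where
  memLp : MemLp X 2 P
  nonneg : 0 ≤ s
  integral_sq_le : ∫ ω, ‖X ω‖ ^ 2 ∂P ≤ s ^ 2

namespace RMSLE

variable {X Y : Ω → E} {s t : ℝ}

theorem integrable_sq (h : RMSLE P X s) : Integrable (fun ω => ‖X ω‖ ^ 2) P := by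
  simpa using h.memLp.integrable_norm_pow (p := 2) (by norm_num)

theorem mono (h : RMSLE P X s) (hst : s ≤ t) : RMSLE P X t :=
  ⟨h.memLp, h.nonneg.trans hst, h.integral_sq_le.trans (pow_le_pow_left₀ h.nonneg hst 2)⟩

theorem integrable_norm_mul {Y : Ω → F} (hX : RMSLE P X s) (hY : RMSLE P Y t) :
    Integrable (fun ω => ‖X ω‖ * ‖Y ω‖) P :=
  hX.memLp.norm.integrable_mul hY.memLp.norm

theorem integral_norm_mul_le {Y : Ω → F} (hX : RMSLE P X s) (hY : RMSLE P Y t) :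
    ∫ ω, ‖X ω‖ * ‖Y ω‖ ∂P ≤ s * t := by
  -- Cauchy–Schwarz through the weighted arithmetic-geometric mean inequality. The weights are
  -- quotients of the two bounds, which may vanish, so both are enlarged by e and e tends to 0.
  have key : ∀ e : ℝ, 0 < e → ∫ ω, ‖X ω‖ * ‖Y ω‖ ∂P ≤ (s + e) * (t + e) := by
    intro e he
    have hs : 0 < s + e := by linarith [hX.nonneg]
    have ht : 0 < t + e := by linarith [hY.nonneg]
    have h1 : ∀ ω, ‖X ω‖ * ‖Y ω‖ ≤ (t + e) / (2 * (s + e)) * ‖X ω‖ ^ 2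
        + (s + e) / (2 * (t + e)) * ‖Y ω‖ ^ 2 := by
      intro ω
      have h2 : (t + e) / (2 * (s + e)) * ‖X ω‖ ^ 2 + (s + e) / (2 * (t + e)) * ‖Y ω‖ ^ 2
          - ‖X ω‖ * ‖Y ω‖
          = ((t + e) * ‖X ω‖ - (s + e) * ‖Y ω‖) ^ 2 / (2 * (s + e) * (t + e)) := by
        field_simp
        ring
      have h3 : 0 ≤ ((t + e) * ‖X ω‖ - (s + e) * ‖Y ω‖) ^ 2 / (2 * (s + e) * (t + e)) := by
        positivity
      linarith
    calc ∫ ω, ‖X ω‖ * ‖Y ω‖ ∂P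
        ≤ ∫ ω, ((t + e) / (2 * (s + e)) * ‖X ω‖ ^ 2
          + (s + e) / (2 * (t + e)) * ‖Y ω‖ ^ 2) ∂P :=
          integral_mono (hX.integrable_norm_mul hY)
            ((hX.integrable_sq.const_mul _).add (hY.integrable_sq.const_mul _)) h1
      _ = (t + e) / (2 * (s + e)) * ∫ ω, ‖X ω‖ ^ 2 ∂P
          + (s + e) / (2 * (t + e)) * ∫ ω, ‖Y ω‖ ^ 2 ∂P := by
          rw [integral_add (hX.integrable_sq.const_mul _) (hY.integrable_sq.const_mul _),
            integral_const_mul, integral_const_mul]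
      _ ≤ (t + e) / (2 * (s + e)) * (s + e) ^ 2 + (s + e) / (2 * (t + e)) * (t + e) ^ 2 := by
          have := (hX.mono (t := s + e) (by linarith)).integral_sq_le
          have := (hY.mono (t := t + e) (by linarith)).integral_sq_le
          gcongr
      _ = (s + e) * (t + e) := by
          field_simp
          ring
  have hlim : Tendsto (fun e : ℝ => (s + e) * (t + e)) (𝓝[>] 0) (𝓝 ((s + 0) * (t + 0))) := by
    apply Tendsto.mono_left _ nhdsWithin_le_nhds
    exact Continuous.tendsto (by fun_prop) 0
  have := ge_of_tendsto hlim (eventually_mem_nhdsWithin.mono fun e he => key e he)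
  simpa using this

theorem add (hX : RMSLE P X s) (hY : RMSLE P Y t) : RMSLE P (fun ω => X ω + Y ω) (s + t) := by
  refine ⟨hX.memLp.add hY.memLp, add_nonneg hX.nonneg hY.nonneg, ?_⟩
  have hint : Integrable (fun ω => ‖X ω‖ ^ 2 + 2 * (‖X ω‖ * ‖Y ω‖) + ‖Y ω‖ ^ 2) P :=
    (hX.integrable_sq.add ((hX.integrable_norm_mul hY).const_mul 2)).add hY.integrable_sq
  calc ∫ ω, ‖X ω + Y ω‖ ^ 2 ∂P
      ≤ ∫ ω, (‖X ω‖ ^ 2 + 2 * (‖X ω‖ * ‖Y ω‖) + ‖Y ω‖ ^ 2) ∂P := by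
        refine integral_mono_of_nonneg (ae_of_all _ fun ω => by positivity) hint
          (ae_of_all _ fun ω => ?_)
        have := pow_le_pow_left₀ (norm_nonneg _) (norm_add_le (X ω) (Y ω)) 2
        calc _ ≤ _ := this
          _ = _ := by ring
    _ = ∫ ω, ‖X ω‖ ^ 2 ∂P + 2 * ∫ ω, ‖X ω‖ * ‖Y ω‖ ∂P + ∫ ω, ‖Y ω‖ ^ 2 ∂P := by
        rw [integral_add_add hX.integrable_sq ((hX.integrable_norm_mul hY).const_mul 2)
          hY.integrable_sq, integral_const_mul]
    _ ≤ s ^ 2 + 2 * (s * t) + t ^ 2 := by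
        gcongr
        · exact hX.integral_sq_le
        · exact hX.integral_norm_mul_le hY
        · exact hY.integral_sq_le
    _ = (s + t) ^ 2 := by ring

theorem zero : RMSLE P (fun _ : Ω => (0 : E)) 0 :=
  ⟨MemLp.zero, le_rfl, by simp⟩

theorem of_norm_le {Y : Ω → F} {c : ℝ} (hX : RMSLE P X s) (hc : 0 ≤ c)
    (hY : AEStronglyMeasurable Y P) (h : ∀ᵐ ω ∂P, ‖Y ω‖ ≤ c * ‖X ω‖) : RMSLE P Y (c * s) := by
  refine ⟨hX.memLp.of_le_mul hY h, mul_nonneg hc hX.nonneg, ?_⟩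
  calc ∫ ω, ‖Y ω‖ ^ 2 ∂P ≤ ∫ ω, c ^ 2 * ‖X ω‖ ^ 2 ∂P := by
        refine integral_mono_of_nonneg (ae_of_all _ fun ω => by positivity)
          (hX.integrable_sq.const_mul _) ?_
        filter_upwards [h] with ω hω
        rw [← mul_pow]
        exact pow_le_pow_left₀ (norm_nonneg _) hω 2
    _ = c ^ 2 * ∫ ω, ‖X ω‖ ^ 2 ∂P := integral_const_mul _ _
    _ ≤ c ^ 2 * s ^ 2 := by gcongr; exact hX.integral_sq_le
    _ = (c * s) ^ 2 := by ring

theorem neg (hX : RMSLE P X s) : RMSLE P (fun ω => -X ω) s := by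
  have := hX.of_norm_le (Y := fun ω => -X ω) (c := 1) zero_le_one hX.memLp.neg.1
    (ae_of_all _ fun ω => by simp)
  simpa using this

theorem sub (hX : RMSLE P X s) (hY : RMSLE P Y t) : RMSLE P (fun ω => X ω - Y ω) (s + t) := by
  simpa [sub_eq_add_neg] using hX.add hY.neg

theorem const_smul [NormedSpace ℝ E] (hX : RMSLE P X s) (c : ℝ) :
    RMSLE P (fun ω => c • X ω) (|c| * s) :=
  hX.of_norm_le (abs_nonneg c) (hX.memLp.1.const_smul c)
    (ae_of_all _ fun ω => by rw [norm_smul, Real.norm_eq_abs])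

theorem clm [NormedSpace ℝ E] [NormedSpace ℝ F] (hX : RMSLE P X s) (T : E →L[ℝ] F) :
    RMSLE P (fun ω => T (X ω)) (‖T‖ * s) :=
  hX.of_norm_le (norm_nonneg T) (T.continuous.comp_aestronglyMeasurable hX.memLp.1)
    (ae_of_all _ fun _ => T.le_opNorm _)

theorem sum {ι : Type*} {X : ι → Ω → E} {s : ι → ℝ} (T : Finset ι)
    (h : ∀ i ∈ T, RMSLE P (X i) (s i)) :
    RMSLE P (fun ω => ∑ i ∈ T, X i ω) (∑ i ∈ T, s i) := by
  classical
  induction T using Finset.induction_on with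
  | empty => simpa using zero
  | insert a T ha ih =>
    simp only [Finset.sum_insert ha]
    exact (h a (Finset.mem_insert_self _ _)).add
      (ih fun i hi => h i (Finset.mem_insert_of_mem hi))

theorem integral_norm_le [IsProbabilityMeasure P] (h : RMSLE P X s) :
    ∫ ω, ‖X ω‖ ∂P ≤ s := by
  have h1 : RMSLE P (fun _ : Ω => (1 : ℝ)) 1 := ⟨memLp_const _, zero_le_one, by simp⟩
  simpa using h.integral_norm_mul_le h1

theorem inner_left [InnerProductSpace ℝ E] (hX : RMSLE P X s) (a : E) :
    RMSLE P (fun ω => inner ℝ a (X ω)) (‖a‖ * s) :=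
  hX.of_norm_le (norm_nonneg a)
    ((innerSL ℝ a).continuous.comp_aestronglyMeasurable hX.memLp.1)
    (ae_of_all _ fun _ => norm_inner_le_norm _ _)

end RMSLE

end RootMeanSquare

/-! ### Window sums of scalar martingale differences. -/

section MartingaleDifference

theorem MemLp.mul_four {Ω : Type*} {m0 : MeasurableSpace Ω} {P : Measure Ω}
    {X Y : Ω → ℝ} (hX : MemLp X 4 P) (hY : MemLp Y 4 P) :
    MemLp (fun ω => X ω * Y ω) 2 P := by
  have : ENNReal.HolderTriple 4 4 2 := ⟨by
    rw [← two_mul, show (4 : ENNReal) = 2 * 2 by norm_num, ENNReal.mul_inv (by simp) (by simp),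
      ← mul_assoc, ENNReal.mul_inv_cancel (by simp) (by simp), one_mul]⟩
  exact hY.mul hX

theorem MemLp.integrable_pow_four {Ω : Type*} {m0 : MeasurableSpace Ω} {P : Measure Ω}
    {X : Ω → ℝ} (hX : MemLp X 4 P) :
    Integrable (fun ω => X ω ^ 4) P := by
  have := hX.integrable_norm_pow (p := 4) (by norm_num)
  refine this.congr (ae_of_all _ fun ω => ?_)
  simp [Real.norm_eq_abs, Even.pow_abs (show Even 4 by decide)]

theorem integral_mul_eq_zero_of_condExp {Ω : Type*} {m m0 : MeasurableSpace Ω} {P : Measure Ω}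
    [IsProbabilityMeasure P] (hm : m ≤ m0) {X Y : Ω → ℝ}
    (hY : StronglyMeasurable[m] Y) (hY2 : MemLp Y 2 P) (hX2 : MemLp X 2 P)
    (h : P[X | m] =ᵐ[P] 0) : ∫ ω, Y ω * X ω ∂P = 0 := by
  have h1 := condExp_mul_of_stronglyMeasurable_left hY (hY2.integrable_mul hX2)
    (hX2.integrable (by norm_num))
  have h2 : ∫ ω, (P[Y * X | m]) ω ∂P = ∫ ω, (Y * X) ω ∂P := integral_condExp hm
  have h3 : P[Y * X | m] =ᵐ[P] 0 := by
    filter_upwards [h1, h] with ω h1 h2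
    rw [h1, Pi.mul_apply, h2, Pi.zero_apply, mul_zero]
  rw [integral_congr_ae h3] at h2
  simpa using h2.symm

variable {Ω : Type*} [m0 : MeasurableSpace Ω] {P : Measure Ω} [IsProbabilityMeasure P]

/-- A sequence of martingale differences with fourth moments bounded by `M`. -/
structure MartDiff (P : Measure Ω) (ℱ : Filtration ℕ m0) (M : ℝ) (p : ℕ → Ω → ℝ) : Prop where
  meas : ∀ k, StronglyMeasurable[ℱ (k + 1)] (p k)
  memLp : ∀ k, MemLp (p k) 4 P
  condExp : ∀ k, P[p k | ℱ k] =ᵐ[P] 0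
  fourth : ∀ k, ∫ ω, p k ω ^ 4 ∂P ≤ M

/-- The sum of the differences over the window `[s, i)`. -/
def winSum (p : ℕ → Ω → ℝ) (s i : ℕ) (ω : Ω) : ℝ := ∑ k ∈ Finset.Ico s i, p k ω

variable {ℱ : Filtration ℕ m0} {M : ℝ} {p q : ℕ → Ω → ℝ}

namespace MartDiff

theorem winSum_meas (hp : MartDiff P ℱ M p) (s i : ℕ) :
    StronglyMeasurable[ℱ i] (winSum p s i) := by
  refine Finset.stronglyMeasurable_fun_sum _ fun k hk => (hp.meas k).mono (ℱ.mono ?_)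
  have := (Finset.mem_Ico.1 hk).2
  omega

theorem winSum_memLp (hp : MartDiff P ℱ M p) (s i : ℕ) : MemLp (winSum p s i) 4 P :=
  memLp_finsetSum _ fun k _ => hp.memLp k

theorem memLp_two (hp : MartDiff P ℱ M p) (k : ℕ) : MemLp (p k) 2 P :=
  (hp.memLp k).mono_exponent (by norm_num)

theorem winSum_succ {s i : ℕ} (h : s ≤ i) (ω : Ω) :
    winSum p s (i + 1) ω = winSum p s i ω + p i ω := Finset.sum_Ico_succ_top h _

theorem condExp_winSum_mul (hp : MartDiff P ℱ M p) (hq : MartDiff P ℱ M q) (s i : ℕ) :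
    P[fun ω => winSum q s i ω * p i ω | ℱ i] =ᵐ[P] 0 := by
  have h1 := condExp_mul_of_stronglyMeasurable_left (hq.winSum_meas s i)
    ((MemLp.mul_four (hq.winSum_memLp s i) (hp.memLp i)).integrable (by norm_num))
    ((hp.memLp_two i).integrable (by norm_num))
  refine h1.trans ?_
  filter_upwards [hp.condExp i] with ω h
  rw [Pi.mul_apply, h, Pi.zero_apply, mul_zero]

/-- The term v³p is kept exact because it integrates to zero for a martingale. The terms 6v²p² and
4vp³ are absorbed by Young's inequality; the weight 1/n is what a quadratic growth in n can afford.
-/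
theorem fourth_moment_add {v p : ℝ} {n : ℝ} (hn : 0 < n) :
    (v + p) ^ 4 ≤ (1 + 1 / n) * v ^ 4 + 4 * (v ^ 2 * (v * p)) + (16 * n + 3) * p ^ 4 := by
  have h1 : 8 * (v ^ 2 * p ^ 2) ≤ 1 / n * v ^ 4 + 16 * n * p ^ 4 := by
    have : 1 / n * v ^ 4 + 16 * n * p ^ 4 - 8 * (v ^ 2 * p ^ 2)
        = (v ^ 2 - 4 * n * p ^ 2) ^ 2 / n := by
      field_simp
      ring
    have h2 : 0 ≤ (v ^ 2 - 4 * n * p ^ 2) ^ 2 / n := by positivity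
    linarith
  nlinarith [sq_nonneg (p * (v - p))]

/-- Burkholder-type bound by induction on the window length n: the step needs (1 + 1/n) · 16n² + 16n
+ 3 ≤ 16(n+1)². -/
theorem fourth_moment_winSum (hp : MartDiff P ℱ M p) (s n : ℕ) :
    ∫ ω, winSum p s (s + n) ω ^ 4 ∂P ≤ 16 * M * (n : ℝ) ^ 2 := by
  have hM : 0 ≤ M := (integral_nonneg fun ω => by positivity).trans (hp.fourth 0)
  induction n with
  | zero => simp [winSum]
  | succ n ih =>
    rcases Nat.eq_zero_or_pos n with rfl | hn
    · simp only [zero_add]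
      have : ∀ ω, winSum p s (s + 1) ω = p s ω := fun ω => by simp [winSum]
      simp only [this]
      have := hp.fourth s
      push_cast
      linarith
    · have hn' : (0 : ℝ) < n := by exact_mod_cast hn
      have hv := hp.winSum_memLp s (s + n)
      have hvi := MemLp.integrable_pow_four hv
      have hpi := MemLp.integrable_pow_four (hp.memLp (s + n))
      have hv2 : MemLp (fun ω => winSum p s (s + n) ω ^ 2) 2 P := by
        simpa only [sq] using MemLp.mul_four hv hv
      have hvp := MemLp.mul_four hv (hp.memLp (s + n))
      have hcross : Integrable (fun ω => winSum p s (s + n) ω ^ 2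
          * (winSum p s (s + n) ω * p (s + n) ω)) P := hv2.integrable_mul hvp
      have h0 : ∫ ω, winSum p s (s + n) ω ^ 2 * (winSum p s (s + n) ω * p (s + n) ω) ∂P = 0 :=
        integral_mul_eq_zero_of_condExp (ℱ.le (s + n)) ((hp.winSum_meas s (s + n)).pow 2) hv2 hvp
          (hp.condExp_winSum_mul hp s (s + n))
      calc ∫ ω, winSum p s (s + (n + 1)) ω ^ 4 ∂P
          ≤ ∫ ω, ((1 + 1 / (n : ℝ)) * winSum p s (s + n) ω ^ 4
            + 4 * (winSum p s (s + n) ω ^ 2 * (winSum p s (s + n) ω * p (s + n) ω))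
            + (16 * n + 3) * p (s + n) ω ^ 4) ∂P := by
            refine integral_mono_of_nonneg (ae_of_all _ fun ω => by positivity)
              (((hvi.const_mul _).add (hcross.const_mul _)).add (hpi.const_mul _))
              (ae_of_all _ fun ω => ?_)
            simp only
            rw [← add_assoc, winSum_succ (by omega)]
            exact fourth_moment_add hn'
        _ = (1 + 1 / (n : ℝ)) * ∫ ω, winSum p s (s + n) ω ^ 4 ∂P
            + (16 * n + 3) * ∫ ω, p (s + n) ω ^ 4 ∂P := by
            rw [integral_add_add (hvi.const_mul _) (hcross.const_mul _) (hpi.const_mul _),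
              integral_const_mul, integral_const_mul, integral_const_mul, h0]
            ring
        _ ≤ (1 + 1 / (n : ℝ)) * (16 * M * (n : ℝ) ^ 2) + (16 * n + 3) * M := by
            gcongr
            exact hp.fourth _
        _ ≤ 16 * M * ((n + 1 : ℕ) : ℝ) ^ 2 := by
            have : (1 + 1 / (n : ℝ)) * (16 * M * (n : ℝ) ^ 2)
                = 16 * M * (n : ℝ) ^ 2 + 16 * M * n := by
              field_simp
            rw [this]
            push_cast
            nlinarith

theorem rms_mul {X Y : Ω → ℝ} {K : ℝ} (hX : MemLp X 4 P) (hY : MemLp Y 4 P) (hK : 0 ≤ K)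
    (hXK : ∫ ω, X ω ^ 4 ∂P ≤ K ^ 2) (hYK : ∫ ω, Y ω ^ 4 ∂P ≤ K ^ 2) :
    RMSLE P (fun ω => X ω * Y ω) K := by
  refine ⟨MemLp.mul_four hX hY, hK, ?_⟩
  have hXi := MemLp.integrable_pow_four hX
  have hYi := MemLp.integrable_pow_four hY
  calc ∫ ω, ‖X ω * Y ω‖ ^ 2 ∂P ≤ ∫ ω, (1 / 2 * X ω ^ 4 + 1 / 2 * Y ω ^ 4) ∂P := by
        refine integral_mono_of_nonneg (ae_of_all _ fun ω => by positivity)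
          ((hXi.const_mul _).add (hYi.const_mul _)) (ae_of_all _ fun ω => ?_)
        simp only [Real.norm_eq_abs, sq_abs]
        nlinarith [sq_nonneg (X ω ^ 2 - Y ω ^ 2)]
    _ = 1 / 2 * ∫ ω, X ω ^ 4 ∂P + 1 / 2 * ∫ ω, Y ω ^ 4 ∂P := by
        rw [integral_add (hXi.const_mul _) (hYi.const_mul _), integral_const_mul,
          integral_const_mul]
    _ ≤ K ^ 2 := by linarith

theorem rms_winSum_mul (hp : MartDiff P ℱ M p) (hq : MartDiff P ℱ M q) (hM : 1 ≤ M) {s i : ℕ}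
    (h : s ≤ i) :
    RMSLE P (fun ω => winSum p s i ω * winSum q s i ω) (4 * M * ((i : ℝ) - s)) := by
  obtain ⟨n, rfl⟩ := Nat.exists_eq_add_of_le h
  -- As M ≥ 1, √M may be replaced by M, which avoids square roots in the constants.
  have hb : 16 * M * (n : ℝ) ^ 2 ≤ (4 * M * (n : ℝ)) ^ 2 := by
    have : M * (n : ℝ) ^ 2 ≤ M ^ 2 * (n : ℝ) ^ 2 := by
      gcongr
      nlinarith
    nlinarith
  have : ((s + n : ℕ) : ℝ) - s = n := by push_cast; ring
  rw [this]
  exact rms_mul (hp.winSum_memLp _ _) (hq.winSum_memLp _ _) (by positivity)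
    ((hp.fourth_moment_winSum s n).trans hb) ((hq.fourth_moment_winSum s n).trans hb)

theorem rms_winSum (hp : MartDiff P ℱ M p) (hM : 1 ≤ M) {s i : ℕ} (h : s ≤ i) :
    RMSLE P (winSum p s i) (2 * M * √((i : ℝ) - s)) := by
  have h2 : (0 : ℝ) ≤ (i : ℝ) - s := by
    have : (s : ℝ) ≤ i := by exact_mod_cast h
    linarith
  have h1 := (hp.rms_winSum_mul hp hM h).integral_norm_le
  refine ⟨(hp.winSum_memLp s i).mono_exponent (by norm_num), by positivity, ?_⟩
  calc ∫ ω, ‖winSum p s i ω‖ ^ 2 ∂P = ∫ ω, ‖winSum p s i ω * winSum p s i ω‖ ∂P := by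
        simp [sq]
    _ ≤ 4 * M * ((i : ℝ) - s) := h1
    _ ≤ (2 * M * √((i : ℝ) - s)) ^ 2 := by
        rw [mul_pow, Real.sq_sqrt h2]
        gcongr
        nlinarith

/-- The conditional covariance of the differences of index `k`. -/
def condCov (P : Measure Ω) (ℱ : Filtration ℕ m0) (p q : ℕ → Ω → ℝ) (k : ℕ) : Ω → ℝ :=
  P[fun ω => p k ω * q k ω | ℱ k]

/-- The martingale part of the product of two window sums. -/
def winMart (P : Measure Ω) (ℱ : Filtration ℕ m0) (p q : ℕ → Ω → ℝ) (s i : ℕ) (ω : Ω) : ℝ :=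
  winSum p s i ω * winSum q s i ω - ∑ k ∈ Finset.Ico s i, condCov P ℱ p q k ω

theorem condCov_memLp (hp : MartDiff P ℱ M p) (hq : MartDiff P ℱ M q) (k : ℕ) :
    MemLp (condCov P ℱ p q k) 2 P :=
  (MemLp.mul_four (hp.memLp k) (hq.memLp k)).condExp (by norm_num)

theorem condExp_sub_condCov (hp : MartDiff P ℱ M p) (hq : MartDiff P ℱ M q) (k : ℕ) :
    P[fun ω => p k ω * q k ω - condCov P ℱ p q k ω | ℱ k] =ᵐ[P] 0 := by
  have hi : Integrable (fun ω => p k ω * q k ω) P :=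
    (MemLp.mul_four (hp.memLp k) (hq.memLp k)).integrable (by norm_num)
  have h1 := condExp_sub hi (integrable_condExp (m := ℱ k) (f := fun ω => p k ω * q k ω)
    (μ := P)) (ℱ k)
  refine h1.trans ?_
  rw [condExp_of_stronglyMeasurable (ℱ.le k) stronglyMeasurable_condExp integrable_condExp,
    sub_self]

/-- Conditional expectation contracts L²: the conditional covariance is orthogonal to its difference
from the product p_k q_k. -/
theorem rms_condCov (hp : MartDiff P ℱ M p) (hq : MartDiff P ℱ M q) (hM : 1 ≤ M) (k : ℕ) :
    RMSLE P (condCov P ℱ p q k) M := by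
  have hD := condCov_memLp hp hq k
  have hMM : M ≤ M ^ 2 := by nlinarith
  have hpq := rms_mul (hp.memLp k) (hq.memLp k) (by linarith : (0 : ℝ) ≤ M)
    ((hp.fourth k).trans hMM) ((hq.fourth k).trans hMM)
  have h0 : ∫ ω, condCov P ℱ p q k ω * (p k ω * q k ω - condCov P ℱ p q k ω) ∂P = 0 :=
    integral_mul_eq_zero_of_condExp (ℱ.le k) stronglyMeasurable_condExp hD
      (hpq.memLp.sub hD) (condExp_sub_condCov hp hq k)
  have hDi : Integrable (fun ω => condCov P ℱ p q k ω ^ 2) P := hD.integrable_sq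
  have hci : Integrable (fun ω => condCov P ℱ p q k ω
      * (p k ω * q k ω - condCov P ℱ p q k ω)) P := hD.integrable_mul (hpq.memLp.sub hD)
  refine ⟨hD, by linarith, le_trans ?_ hpq.integral_sq_le⟩
  have h2 : ∫ ω, (‖condCov P ℱ p q k ω‖ ^ 2
      + 2 * (condCov P ℱ p q k ω * (p k ω * q k ω - condCov P ℱ p q k ω))) ∂P
      ≤ ∫ ω, ‖p k ω * q k ω‖ ^ 2 ∂P := by
    refine integral_mono ?_ hpq.integrable_sq fun ω => ?_
    · simp only [Real.norm_eq_abs, sq_abs]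
      exact hDi.add (hci.const_mul 2)
    · simp only [Real.norm_eq_abs, sq_abs]
      nlinarith [sq_nonneg (p k ω * q k ω - condCov P ℱ p q k ω)]
  rw [integral_add (by simpa using hDi) (hci.const_mul 2), integral_const_mul, h0] at h2
  linarith

theorem rms_winMart (hp : MartDiff P ℱ M p) (hq : MartDiff P ℱ M q) (hM : 1 ≤ M) {s i : ℕ}
    (h : s ≤ i) : RMSLE P (winMart P ℱ p q s i) (5 * M * ((i : ℝ) - s)) := by
  have h1 := (rms_winSum_mul hp hq hM h).sub
    (RMSLE.sum (Finset.Ico s i) fun k _ => rms_condCov hp hq hM k)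
  refine h1.mono (le_of_eq ?_)
  rw [Finset.sum_const, Nat.card_Ico, nsmul_eq_mul, Nat.cast_sub h]
  ring

theorem winMart_meas (hp : MartDiff P ℱ M p) (hq : MartDiff P ℱ M q) (s i : ℕ) :
    StronglyMeasurable[ℱ i] (winMart P ℱ p q s i) := by
  refine ((hp.winSum_meas s i).mul (hq.winSum_meas s i)).sub ?_
  refine Finset.stronglyMeasurable_fun_sum _ fun k hk => stronglyMeasurable_condExp.mono (ℱ.mono ?_)
  exact (Finset.mem_Ico.1 hk).2.le

/-- Lengthening the window by one index adds a centred product p_i q_i and two cross terms, each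
with conditional mean zero given `ℱ i`. Hence the compensated product is orthogonal to everything
known at the start s of the window. -/
theorem integral_mul_winMart (hp : MartDiff P ℱ M p) (hq : MartDiff P ℱ M q) (hM : 1 ≤ M)
    {s i : ℕ} (h : s ≤ i) {Y : Ω → ℝ} (hY : StronglyMeasurable[ℱ s] Y) (hY2 : MemLp Y 2 P) :
    ∫ ω, Y ω * winMart P ℱ p q s i ω ∂P = 0 := by
  induction i, h using Nat.le_induction with
  | base => simp [winMart, winSum]
  | succ i h ih =>
    have hYi : StronglyMeasurable[ℱ i] Y := hY.mono (ℱ.mono h)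
    have hD := condCov_memLp hp hq i
    have hpq : MemLp (fun ω => p i ω * q i ω - condCov P ℱ p q i ω) 2 P :=
      (MemLp.mul_four (hp.memLp i) (hq.memLp i)).sub hD
    have hqp := MemLp.mul_four (hq.winSum_memLp s i) (hp.memLp i)
    have hpq' := MemLp.mul_four (hp.winSum_memLp s i) (hq.memLp i)
    have hZ := (rms_winMart hp hq hM h).memLp
    have h1 : ∀ ω, Y ω * winMart P ℱ p q s (i + 1) ω = Y ω * winMart P ℱ p q s i ω
        + Y ω * (p i ω * q i ω - condCov P ℱ p q i ω) + Y ω * (winSum q s i ω * p i ω)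
        + Y ω * (winSum p s i ω * q i ω) := by
      intro ω
      rw [winMart, winMart, winSum_succ h, winSum_succ h, Finset.sum_Ico_succ_top h]
      ring
    have i1 : Integrable (fun ω => Y ω * winMart P ℱ p q s i ω) P := hY2.integrable_mul hZ
    have i2 : Integrable (fun ω => Y ω * (p i ω * q i ω - condCov P ℱ p q i ω)) P :=
      hY2.integrable_mul hpq
    have i3 : Integrable (fun ω => Y ω * (winSum q s i ω * p i ω)) P := hY2.integrable_mul hqp
    have i4 : Integrable (fun ω => Y ω * (winSum p s i ω * q i ω)) P := hY2.integrable_mul hpq'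
    have e2 : ∫ ω, Y ω * (p i ω * q i ω - condCov P ℱ p q i ω) ∂P = 0 :=
      integral_mul_eq_zero_of_condExp (ℱ.le i) hYi hY2 hpq (condExp_sub_condCov hp hq i)
    have e3 : ∫ ω, Y ω * (winSum q s i ω * p i ω) ∂P = 0 :=
      integral_mul_eq_zero_of_condExp (ℱ.le i) hYi hY2 hqp (hp.condExp_winSum_mul hq s i)
    have e4 : ∫ ω, Y ω * (winSum p s i ω * q i ω) ∂P = 0 :=
      integral_mul_eq_zero_of_condExp (ℱ.le i) hYi hY2 hpq' (hq.condExp_winSum_mul hp s i)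
    simp only [h1]
    have i12 : Integrable (fun ω => Y ω * winMart P ℱ p q s i ω
        + Y ω * (p i ω * q i ω - condCov P ℱ p q i ω)) P := i1.add i2
    rw [integral_add_add i12 i3 i4, integral_add i1 i2, ih, e2, e3, e4]
    norm_num

/-- If two windows have different starts, the one that ends first is already determined when the
other starts, and the pair is orthogonal. Only pairs with a common start survive, and Cauchy–Schwarz
bounds these. -/
theorem integral_sq_sum_winMart_le (hp : MartDiff P ℱ M p) (hq : MartDiff P ℱ M q) (hM : 1 ≤ M)
    {s : ℕ → ℕ} {T : Finset ℕ} (hs : ∀ i ∈ T, s i ≤ i)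
    (hsep : ∀ i ∈ T, ∀ j ∈ T, i < j → s i ≠ s j → i ≤ s j) :
    ∫ ω, (∑ i ∈ T, winMart P ℱ p q (s i) i ω) ^ 2 ∂P
      ≤ (5 * M) ^ 2 * ∑ i ∈ T, ∑ j ∈ T with s j = s i, ((i : ℝ) - s i) * ((j : ℝ) - s j) := by
  have hZ : ∀ i ∈ T, RMSLE P (winMart P ℱ p q (s i) i) (5 * M * ((i : ℝ) - s i)) :=
    fun i hi => rms_winMart hp hq hM (hs i hi)
  have hint : ∀ i ∈ T, ∀ j ∈ T, Integrable
      (fun ω => winMart P ℱ p q (s i) i ω * winMart P ℱ p q (s j) j ω) P :=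
    fun i hi j hj => (hZ i hi).memLp.integrable_mul (hZ j hj).memLp
  have h0 : ∀ i ∈ T, ∀ j ∈ T, i < j → s i ≠ s j →
      ∫ ω, winMart P ℱ p q (s i) i ω * winMart P ℱ p q (s j) j ω ∂P = 0 := by
    intro i hi j hj hij hne
    exact integral_mul_winMart hp hq hM (hs j hj)
      ((winMart_meas hp hq (s i) i).mono (ℱ.mono (hsep i hi j hj hij hne))) (hZ i hi).memLp
  have h0' : ∀ i ∈ T, ∀ j ∈ T, s j ≠ s i →
      ∫ ω, winMart P ℱ p q (s i) i ω * winMart P ℱ p q (s j) j ω ∂P = 0 := by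
    intro i hi j hj hne
    rcases lt_trichotomy i j with hij | rfl | hij
    · exact h0 i hi j hj hij hne.symm
    · exact absurd rfl hne
    · simp only [mul_comm (winMart P ℱ p q (s i) i _)]
      exact h0 j hj i hi hij hne
  have hexp : ∀ ω, (∑ i ∈ T, winMart P ℱ p q (s i) i ω) ^ 2
      = ∑ i ∈ T, ∑ j ∈ T, winMart P ℱ p q (s i) i ω * winMart P ℱ p q (s j) j ω := by
    intro ω
    rw [sq, Finset.sum_mul_sum]
  simp only [hexp]
  rw [integral_finsetSum _ fun i hi => integrable_finsetSum _ fun j hj => hint i hi j hj,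
    Finset.mul_sum]
  refine Finset.sum_le_sum fun i hi => ?_
  rw [integral_finsetSum _ fun j hj => hint i hi j hj, Finset.sum_filter, Finset.mul_sum]
  refine Finset.sum_le_sum fun j hj => ?_
  split_ifs with hc
  · have h1 := (hZ i hi).integral_norm_mul_le (hZ j hj)
    calc ∫ ω, winMart P ℱ p q (s i) i ω * winMart P ℱ p q (s j) j ω ∂P
        ≤ ∫ ω, ‖winMart P ℱ p q (s i) i ω‖ * ‖winMart P ℱ p q (s j) j ω‖ ∂P := by
          refine integral_mono (hint i hi j hj) ((hZ i hi).integrable_norm_mul (hZ j hj))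
            fun ω => ?_
          simp only [← norm_mul]
          exact Real.le_norm_self _
      _ ≤ _ := h1
      _ = _ := by ring
  · rw [h0' i hi j hj hc, mul_zero]

end MartDiff

end MartingaleDifference

/-! ### Differentiation under the expectation. -/

theorem inner_gradient_eq {d : ℕ} (g : Vec d → ℝ) (x v : Vec d) :
    inner ℝ (∇ g x) v = fderiv ℝ g x v := by
  simp [gradient]

theorem continuous_gradient {d : ℕ} {g : Vec d → ℝ} (hg : ContDiff ℝ 1 g) : Continuous (∇ g) :=
  (InnerProductSpace.toDual ℝ (Vec d)).symm.continuous.comp (hg.continuous_fderiv one_ne_zero)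

section Interchange

variable {d : ℕ} {Ξ : Type*} [MeasurableSpace Ξ] {Pi : Measure Ξ} {f : Vec d → Ξ → ℝ}
  {xstar : Vec d}

/-- Measurability in z is assumed for the loss only; each directional derivative inherits it as a
pointwise limit of difference quotients. -/
theorem RegularLoss.measurable_lossGrad (hf : RegularLoss f Pi xstar) (x : Vec d) :
    Measurable (lossGrad f x) := by
  have h1 : ∀ v : Vec d, Measurable fun z => inner ℝ v (lossGrad f x z) := by
    intro v
    have hlim : ∀ z, Tendsto (fun n : ℕ => (n : ℝ) • (f (x + (n : ℝ)⁻¹ • v) z - f x z)) atTop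
        (𝓝 (inner ℝ v (lossGrad f x z))) := by
      intro z
      have h2 : HasFDerivAt (fun y => f y z) (fderiv ℝ (fun y => f y z) x) x :=
        ((hf.contDiff z).differentiable one_ne_zero x).hasFDerivAt
      rw [real_inner_comm, lossGrad, inner_gradient_eq]
      refine h2.lim v ?_
      simpa using tendsto_natCast_atTop_atTop (R := ℝ)
    refine measurable_of_tendsto_metrizable (fun n => ?_) (tendsto_pi_nhds.2 hlim)
    exact ((hf.measurable _).sub (hf.measurable _)).const_smul (n : ℝ)
  have h3 : lossGrad f x = fun z => ∑ i, inner ℝ (EuclideanSpace.basisFun (Fin d) ℝ i)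
      (lossGrad f x z) • EuclideanSpace.basisFun (Fin d) ℝ i := by
    ext1 z
    exact ((EuclideanSpace.basisFun (Fin d) ℝ).sum_repr' _).symm
  rw [h3]
  exact Finset.measurable_fun_sum _ fun i _ => (h1 _).smul_const _

theorem RegularLoss.continuous_lossGrad (hf : RegularLoss f Pi xstar) (z : Ξ) :
    Continuous fun x => lossGrad f x z := continuous_gradient (hf.contDiff z)

theorem RegularLoss.measurable_uncurry (hf : RegularLoss f Pi xstar) :
    Measurable (Function.uncurry (lossGrad f)) :=
  measurable_uncurry_of_continuous_of_measurable hf.continuous_lossGrad hf.measurable_lossGrad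

theorem RegularLoss.integrable_lossGrad (hf : RegularLoss f Pi xstar) (x : Vec d) :
    Integrable (lossGrad f x) Pi := by
  obtain ⟨U, hU, hui⟩ := hf.unifIntegrable x
  exact memLp_one_iff_integrable.1 (hui.memLp ⟨x, mem_of_mem_nhds hU⟩)

variable [IsProbabilityMeasure Pi]

/-- The mean of the gradient of the loss is a continuous function of the parameter. -/
theorem RegularLoss.continuous_integral (hf : RegularLoss f Pi xstar) :
    Continuous fun x => ∫ z, lossGrad f x z ∂Pi := by
  rw [continuous_iff_continuousAt]
  intro x
  obtain ⟨U, hU, hui⟩ := hf.unifIntegrable x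
  refine tendsto_of_seq_tendsto fun y hy => ?_
  classical
  -- The sequence lies in U only eventually. The early terms outside U are replaced by x, so that
  -- uniform integrability over U applies to all terms and Vitali's theorem yields L¹ convergence.
  let y' : ℕ → U := fun n => if h : y n ∈ U then ⟨y n, h⟩ else ⟨x, mem_of_mem_nhds hU⟩
  have hev : ∀ᶠ n in atTop, (y' n : Vec d) = y n := by
    filter_upwards [hy.eventually hU] with n hn
    have hn' : y n ∈ U := hn
    simp [y', hn']
  have hy' : Tendsto (fun n => (y' n : Vec d)) atTop (𝓝 x) := hy.congr' (hev.mono fun n h => h.symm)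
  have hL : Tendsto (fun n => eLpNorm (lossGrad f (y' n) - lossGrad f x) 1 Pi) atTop (𝓝 0) := by
    refine tendsto_Lp_finite_of_tendsto_ae le_rfl (by simp)
      (fun n => (hf.measurable_lossGrad _).aestronglyMeasurable)
      (memLp_one_iff_integrable.2 (hf.integrable_lossGrad x)) ?_
      (ae_of_all _ fun z => ((hf.continuous_lossGrad z).tendsto x).comp hy')
    intro ε hε
    obtain ⟨δ, hδ, H⟩ := hui.2.1 hε
    exact ⟨δ, hδ, fun n => H (y' n)⟩
  refine (tendsto_integral_of_L1' _ (hf.measurable_lossGrad x).aestronglyMeasurable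
    (.of_forall fun n => hf.integrable_lossGrad (y' n)) hL).congr' ?_
  filter_upwards [hev] with n hn
  simp only [hn, Function.comp_apply]

theorem RegularLoss.sub_eq_integral (hf : RegularLoss f Pi xstar) (x v : Vec d) (s : ℝ) (z : Ξ) :
    f (x + s • v) z - f x z = ∫ τ in (0 : ℝ)..s, inner ℝ v (lossGrad f (x + τ • v) z) := by
  have hd : ∀ τ : ℝ, HasDerivAt (fun τ : ℝ => f (x + τ • v) z)
      (inner ℝ v (lossGrad f (x + τ • v) z)) τ := by
    intro τ
    have h2 : HasFDerivAt (fun y => f y z) (fderiv ℝ (fun y => f y z) (x + τ • v))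
        (x + τ • v) := ((hf.contDiff z).differentiable one_ne_zero _).hasFDerivAt
    have h3 : HasDerivAt (fun τ : ℝ => x + τ • v) v τ := by
      simpa using ((hasDerivAt_id τ).smul_const v).const_add x
    rw [real_inner_comm, lossGrad, inner_gradient_eq]
    exact h2.comp_hasDerivAt τ h3
  have hc : Continuous fun τ : ℝ => inner ℝ v (lossGrad f (x + τ • v) z) :=
    continuous_const.inner
      ((hf.continuous_lossGrad z).comp (by fun_prop : Continuous fun τ : ℝ => x + τ • v))
  rw [intervalIntegral.integral_eq_sub_of_hasDerivAt (fun τ _ => hd τ)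
    (hc.intervalIntegrable _ _)]
  simp

theorem RegularLoss.measurable_line (hf : RegularLoss f Pi xstar) (x v : Vec d) :
    Measurable (Function.uncurry fun (τ : ℝ) (z : Ξ) =>
      (inner ℝ v (lossGrad f (x + τ • v) z) : ℝ)) := by
  have h1 : Measurable fun q : ℝ × Ξ => ((x + q.1 • v, q.2) : Vec d × Ξ) := by fun_prop
  exact (hf.measurable_uncurry.comp h1).const_inner

/-- A bound on the L¹ norms along the segment suffices for Fubini; no pointwise dominating function
is needed. -/
theorem RegularLoss.integrable_line (hf : RegularLoss f Pi xstar) (x v : Vec d) {s B : ℝ}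
    (hB : ∀ τ ∈ Set.uIcc 0 s, ∫ z, ‖lossGrad f (x + τ • v) z‖ ∂Pi ≤ B) :
    Integrable (Function.uncurry fun (τ : ℝ) (z : Ξ) =>
      (inner ℝ v (lossGrad f (x + τ • v) z) : ℝ)) ((volume.restrict (Set.uIoc 0 s)).prod Pi) := by
  have hmeas := hf.measurable_line x v
  have hi : ∀ τ : ℝ, Integrable (fun z => (inner ℝ v (lossGrad f (x + τ • v) z) : ℝ)) Pi :=
    fun τ => (hf.integrable_lossGrad _).const_inner v
  refine (integrable_prod_iff hmeas.aestronglyMeasurable).2 ⟨ae_of_all _ hi, ?_⟩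
  have hm : AEStronglyMeasurable (fun τ : ℝ => ∫ z, ‖(inner ℝ v (lossGrad f (x + τ • v) z) : ℝ)‖ ∂Pi)
      (volume.restrict (Set.uIoc 0 s)) :=
    (hmeas.norm.stronglyMeasurable.integral_prod_right').aestronglyMeasurable
  have : IsFiniteMeasure (volume.restrict (Set.uIoc 0 s)) := ⟨by simp [Set.uIoc]⟩
  refine Integrable.mono' (g := fun _ => ‖v‖ * B) (integrable_const _) hm ?_
  filter_upwards [ae_restrict_mem measurableSet_uIoc] with τ hτ
  rw [Real.norm_of_nonneg (integral_nonneg fun z => norm_nonneg _)]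
  calc ∫ z, ‖(inner ℝ v (lossGrad f (x + τ • v) z) : ℝ)‖ ∂Pi
      ≤ ∫ z, ‖v‖ * ‖lossGrad f (x + τ • v) z‖ ∂Pi :=
        integral_mono (hi τ).norm ((hf.integrable_lossGrad _).norm.const_mul _)
          fun z => norm_inner_le_norm _ _
    _ = ‖v‖ * ∫ z, ‖lossGrad f (x + τ • v) z‖ ∂Pi := integral_const_mul _ _
    _ ≤ ‖v‖ * B := by
        gcongr
        exact hB _ (Set.uIoc_subset_uIcc hτ)

theorem RegularLoss.objective_sub_eq (hf : RegularLoss f Pi xstar) (x v : Vec d) {s B : ℝ}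
    (hB : ∀ τ ∈ Set.uIcc 0 s, ∫ z, ‖lossGrad f (x + τ • v) z‖ ∂Pi ≤ B) :
    objective f Pi (x + s • v) - objective f Pi x
      = ∫ τ in (0 : ℝ)..s, inner ℝ v (∫ z, lossGrad f (x + τ • v) z ∂Pi) := by
  rw [objective, objective, ← integral_sub (hf.integrable _) (hf.integrable _)]
  simp only [hf.sub_eq_integral, intervalIntegral.intervalIntegral_eq_integral_uIoc]
  rw [integral_smul, ← integral_integral_swap (hf.integrable_line x v hB)]
  simp only [integral_inner (hf.integrable_lossGrad _)]

/-- Differentiation under the expectation. -/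
theorem RegularLoss.gradient_objective (hf : RegularLoss f Pi xstar)
    (hF : ContDiff ℝ 1 (objective f Pi)) (x : Vec d) :
    ∇ (objective f Pi) x = ∫ z, lossGrad f x z ∂Pi := by
  refine ext_inner_left ℝ fun v => ?_
  rw [real_inner_comm, inner_gradient_eq]
  set φ : ℝ → ℝ := fun s => inner ℝ v (∫ z, lossGrad f (x + s • v) z ∂Pi) with hφ
  have hφc : Continuous φ :=
    continuous_const.inner
      (hf.continuous_integral.comp (by fun_prop : Continuous fun s : ℝ => x + s • v))
  obtain ⟨U, hU, hui⟩ := hf.unifIntegrable x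
  obtain ⟨B, hB⟩ := hui.2.2
  have hB' : ∀ y ∈ U, ∫ z, ‖lossGrad f y z‖ ∂Pi ≤ B := by
    intro y hy
    have h1 := hB ⟨y, hy⟩
    rw [eLpNorm_one_eq_lintegral_enorm] at h1
    rw [integral_norm_eq_lintegral_enorm (hf.measurable_lossGrad y).aestronglyMeasurable]
    exact ENNReal.toReal_le_coe_of_le_coe h1
  obtain ⟨r, hr, hball⟩ := Metric.mem_nhds_iff.1 hU
  have hsmall : ∀ᶠ s : ℝ in 𝓝 0, ∀ τ ∈ Set.uIcc 0 s, x + τ • v ∈ U := by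
    have h1 : Tendsto (fun s : ℝ => |s| * ‖v‖) (𝓝 0) (𝓝 0) := by
      have : Continuous fun s : ℝ => |s| * ‖v‖ := by fun_prop
      simpa using this.tendsto 0
    filter_upwards [h1.eventually (gt_mem_nhds hr)] with s hs τ hτ
    refine hball ?_
    rw [Metric.mem_ball, dist_eq_norm, add_sub_cancel_left, norm_smul, Real.norm_eq_abs]
    refine lt_of_le_of_lt (mul_le_mul_of_nonneg_right ?_ (norm_nonneg _)) hs
    have := Set.abs_sub_left_of_mem_uIcc hτ
    simpa using this
  -- The function s ↦ F(x + s v) is differentiated at 0 in two ways: by the chain rule, and from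
  -- this representation by the fundamental theorem of calculus with a continuous integrand.
  have hrep : ∀ᶠ s : ℝ in 𝓝 0,
      objective f Pi (x + s • v) = objective f Pi x + ∫ τ in (0 : ℝ)..s, φ τ := by
    filter_upwards [hsmall] with s hs
    have h4 := hf.objective_sub_eq x v (s := s) fun τ hτ => hB' _ (hs τ hτ)
    simp only [hφ]
    linarith
  have hd1 : HasDerivAt (fun s : ℝ => objective f Pi (x + s • v))
      (fderiv ℝ (objective f Pi) x v) 0 := by
    have h2 : HasFDerivAt (objective f Pi) (fderiv ℝ (objective f Pi) x) (x + (0 : ℝ) • v) := by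
      simpa using (hF.differentiable one_ne_zero x).hasFDerivAt
    have h3 : HasDerivAt (fun τ : ℝ => x + τ • v) v 0 := by
      simpa using ((hasDerivAt_id (0 : ℝ)).smul_const v).const_add x
    exact h2.comp_hasDerivAt 0 h3
  have hd2 : HasDerivAt (fun s : ℝ => objective f Pi (x + s • v)) (φ 0) 0 := by
    refine HasDerivAt.congr_of_eventuallyEq ?_ hrep
    exact (intervalIntegral.integral_hasDerivAt_right (by simp)
      (hφc.stronglyMeasurable.stronglyMeasurableAtFilter) hφc.continuousAt).const_add _
  rw [hd1.unique hd2]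
  simp [hφ]

end Interchange

/-! ### Filtration of the sample and conditional mean zero of the noise. -/

section Adapted

variable {Ω Ω' Ξ : Type*} [MeasurableSpace Ω] [MeasurableSpace Ω'] [MeasurableSpace Ξ]
  {P : Measure Ω} [IsProbabilityMeasure P]

/-- A function of two independent variables has conditional mean zero given the first variable, if
its mean over the second one vanishes identically. -/
theorem condExp_eq_zero_of_indepFun {X : Ω → Ω'} {ζ : Ω → Ξ} (hX : Measurable X)
    (hζ : Measurable ζ) (hind : X ⟂ᵢ[P] ζ) {H : Ω' → Ξ → ℝ}
    (hH : Measurable (Function.uncurry H)) (hint : Integrable (fun ω => H (X ω) (ζ ω)) P)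
    (h0 : ∀ x, ∫ z, H x z ∂(P.map ζ) = 0) :
    P[fun ω => H (X ω) (ζ ω) | MeasurableSpace.comap X inferInstance] =ᵐ[P] 0 := by
  have hmap := (indepFun_iff_map_prod_eq_prod_map_map hX.aemeasurable hζ.aemeasurable).1 hind
  have hXζ : Measurable fun ω => (X ω, ζ ω) := hX.prodMk hζ
  have : IsProbabilityMeasure (P.map X) := Measure.isProbabilityMeasure_map hX.aemeasurable
  have : IsProbabilityMeasure (P.map ζ) := Measure.isProbabilityMeasure_map hζ.aemeasurable
  have hintp : Integrable (Function.uncurry H) ((P.map X).prod (P.map ζ)) := by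
    rw [← hmap, integrable_map_measure hH.aestronglyMeasurable hXζ.aemeasurable]
    exact hint
  refine (ae_eq_condExp_of_forall_setIntegral_eq hX.comap_le hint
    (fun s _ _ => integrableOn_zero) ?_ aestronglyMeasurable_zero).symm
  rintro _ ⟨t, ht, rfl⟩ -
  -- By independence the joint law is a product, so the integral over an event of the first variable
  -- is iterated with the vanishing mean inside.
  have h1 : ∫ ω in X ⁻¹' t, H (X ω) (ζ ω) ∂P
      = ∫ q in t ×ˢ Set.univ, Function.uncurry H q ∂((P.map X).prod (P.map ζ)) := by
    rw [← hmap, setIntegral_map (ht.prod MeasurableSet.univ) hH.aestronglyMeasurable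
      hXζ.aemeasurable]
    congr 2
    ext ω
    simp
  rw [h1, setIntegral_prod _ hintp.integrableOn]
  simp [Function.uncurry, h0]

variable {ξ : ℕ → Ω → Ξ} {Pi : Measure Ξ}

theorem IsIIDSample.past_le (hξ : IsIIDSample ξ Pi P) (n : ℕ) : past ξ n ≤ ‹MeasurableSpace Ω› :=
  iSup₂_le fun i hi => (hξ.measurable i (Finset.mem_Icc.1 hi).1).comap_le

/-- The filtration generated by the sample. -/
def IsIIDSample.filtration (hξ : IsIIDSample ξ Pi P) : Filtration ℕ ‹MeasurableSpace Ω› where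
  seq := past ξ
  mono' := fun _ _ hij => biSup_mono fun _ hk =>
    Finset.mem_Icc.2 ⟨(Finset.mem_Icc.1 hk).1, (Finset.mem_Icc.1 hk).2.trans hij⟩
  le' := hξ.past_le

theorem measurable_past {k n : ℕ} (hk : 1 ≤ k) (hkn : k ≤ n) : Measurable[past ξ n] (ξ k) := by
  rw [measurable_iff_comap_le]
  exact le_iSup₂ (f := fun i (_ : i ∈ Finset.Icc 1 n) =>
    MeasurableSpace.comap (ξ i) inferInstance) k (Finset.mem_Icc.2 ⟨hk, hkn⟩)

theorem IsIIDSample.indep_past (hξ : IsIIDSample ξ Pi P) (n : ℕ) :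
    Indep (past ξ n) (MeasurableSpace.comap (ξ (n + 1)) inferInstance) P := by
  -- The independent family is i ↦ ξ (i + 1): the variables ξ 1, …, ξ n have indices below n, and ξ
  -- (n + 1) has index n.
  have h1 := indep_iSup_of_disjoint
    (fun i => (hξ.measurable (i + 1) (by omega)).comap_le)
    ((iIndepFun_iff_iIndep _ _ _).1 hξ.indep)
    (S := Set.Iio n) (T := {n}) (by simp)
  refine indep_of_indep_of_le_left (indep_of_indep_of_le_right h1 ?_) ?_
  · simp
  · refine iSup₂_le fun i hi => ?_
    obtain ⟨hi1, hi2⟩ := Finset.mem_Icc.1 hi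
    obtain ⟨j, rfl⟩ := Nat.exists_eq_add_of_le' hi1
    exact le_iSup₂ (f := fun j (_ : j ∈ Set.Iio n) =>
      MeasurableSpace.comap (ξ (j + 1)) inferInstance) j (by simp only [Set.mem_Iio]; omega)

variable {d : ℕ} {f : Vec d → Ξ → ℝ} {xstar x₀ : Vec d} {η α : ℝ}

theorem RegularLoss.measurable_sgd (hf : RegularLoss f Pi xstar) (n : ℕ) :
    Measurable[past ξ n] fun ω => sgd f η α x₀ (fun i => ξ i ω) n := by
  induction n with
  | zero => exact measurable_const
  | succ n ih =>
    have hle : past ξ n ≤ past ξ (n + 1) := biSup_mono fun _ hk =>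
      Finset.mem_Icc.2 ⟨(Finset.mem_Icc.1 hk).1, (Finset.mem_Icc.1 hk).2.trans n.le_succ⟩
    have h1 := ih.mono hle le_rfl
    have h2 : Measurable[past ξ (n + 1)] (ξ (n + 1)) := measurable_past (by omega) le_rfl
    have h3 := hf.measurable_uncurry.comp (h1.prodMk h2)
    exact h1.sub (h3.const_smul (stepSize η α (n + 1)))

theorem gradNoise_succ (n : ℕ) (ω : Ω) : gradNoise f Pi η α x₀ ξ (n + 1) ω
    = ∇ (objective f Pi) (sgd f η α x₀ (fun i => ξ i ω) n)
      - lossGrad f (sgd f η α x₀ (fun i => ξ i ω) n) (ξ (n + 1) ω) := rfl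

theorem RegularLoss.measurable_gradNoise (hf : RegularLoss f Pi xstar)
    (hF : ContDiff ℝ 1 (objective f Pi)) (n : ℕ) :
    Measurable[past ξ (n + 1)] (gradNoise f Pi η α x₀ ξ (n + 1)) := by
  have hle : past ξ n ≤ past ξ (n + 1) := biSup_mono fun _ hk =>
    Finset.mem_Icc.2 ⟨(Finset.mem_Icc.1 hk).1, (Finset.mem_Icc.1 hk).2.trans n.le_succ⟩
  have h1 := (hf.measurable_sgd (ξ := ξ) (η := η) (α := α) (x₀ := x₀) n).mono hle le_rfl
  have h2 : Measurable[past ξ (n + 1)] (ξ (n + 1)) := measurable_past (by omega) le_rfl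
  exact ((continuous_gradient hF).measurable.comp h1).sub
    (hf.measurable_uncurry.comp (h1.prodMk h2))

theorem RegularLoss.measurable_inner_sub {Ω' Ξ : Type*} [MeasurableSpace Ω'] [MeasurableSpace Ξ]
    {Pi : Measure Ξ} {d : ℕ} {f : Vec d → Ξ → ℝ} {xstar : Vec d} (hf : RegularLoss f Pi xstar)
    (hF : ContDiff ℝ 1 (objective f Pi)) {X : Ω' → Vec d} (hX : Measurable X) (w : Vec d) :
    Measurable (Function.uncurry fun ω z =>
      (inner ℝ w (∇ (objective f Pi) (X ω) - lossGrad f (X ω) z) : ℝ)) := by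
  have h1 : Measurable fun q : Ω' × Ξ => X q.1 := hX.comp measurable_fst
  have h2 := hf.measurable_uncurry.comp (h1.prodMk measurable_snd)
  exact (((continuous_gradient hF).measurable.comp h1).sub h2).const_inner

theorem RegularLoss.condExp_inner_gradNoise [IsProbabilityMeasure Pi]
    (hf : RegularLoss f Pi xstar) (hF : ContDiff ℝ 1 (objective f Pi))
    (hξ : IsIIDSample ξ Pi P) (n : ℕ) (w : Vec d)
    (hint : Integrable (fun ω => inner ℝ w (gradNoise f Pi η α x₀ ξ (n + 1) ω)) P) :
    P[fun ω => inner ℝ w (gradNoise f Pi η α x₀ ξ (n + 1) ω) | past ξ n] =ᵐ[P] 0 := by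
  have hsgd := hf.measurable_sgd (ξ := ξ) (η := η) (α := α) (x₀ := x₀) n
  -- The first of the two independent variables is the identity of Ω, with `past ξ n` as the
  -- σ-algebra of its target. The iterate is then a function of it, and no factorization through ξ
  -- 1, …, ξ n is required.
  have hid : @Measurable Ω Ω _ (past ξ n) id := measurable_id'' (hξ.past_le n)
  have hind : @IndepFun Ω Ω Ξ _ (past ξ n) _ id (ξ (n + 1)) P := by
    refine (@IndepFun_iff_Indep Ω Ω Ξ _ (past ξ n) _ id (ξ (n + 1)) P).2 ?_
    rw [@MeasurableSpace.comap_id Ω (past ξ n)]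
    exact hξ.indep_past n
  have hmeas : @Measurable (Ω × Ξ) ℝ (@Prod.instMeasurableSpace Ω Ξ (past ξ n) _) _
      (Function.uncurry fun ω z => inner ℝ w
        (∇ (objective f Pi) (sgd f η α x₀ (fun i => ξ i ω) n)
          - lossGrad f (sgd f η α x₀ (fun i => ξ i ω) n) z)) := by
    exact @RegularLoss.measurable_inner_sub Ω Ξ (past ξ n) _ Pi d f xstar hf hF _ hsgd w
  have h0 : ∀ ω, ∫ z, inner ℝ w (∇ (objective f Pi) (sgd f η α x₀ (fun i => ξ i ω) n)
      - lossGrad f (sgd f η α x₀ (fun i => ξ i ω) n) z) ∂(P.map (ξ (n + 1))) = 0 := by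
    intro ω
    have hi : Integrable (fun z => ∇ (objective f Pi) (sgd f η α x₀ (fun i => ξ i ω) n)
      - lossGrad f (sgd f η α x₀ (fun i => ξ i ω) n) z) Pi :=
      (integrable_const _).sub (hf.integrable_lossGrad _)
    rw [hξ.law (n + 1) (by omega), integral_inner hi, integral_sub (integrable_const _)
      (hf.integrable_lossGrad _), ← hf.gradient_objective hF]
    simp
  have key := @condExp_eq_zero_of_indepFun Ω Ω Ξ _ (past ξ n) _ P _ id (ξ (n + 1))
    hid (hξ.measurable (n + 1) (by omega)) hind _ hmeas hint h0
  rw [@MeasurableSpace.comap_id Ω (past ξ n)] at key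
  exact key

end Adapted

/-- The derivative of a gradient field is symmetric. -/
theorem inner_fderiv_gradient_comm {E : Type*} [NormedAddCommGroup E] [InnerProductSpace ℝ E]
    [CompleteSpace E] {F : E → ℝ} (hF : ContDiff ℝ 1 F) {A : E →L[ℝ] E} {x : E}
    (hA : HasFDerivAt (∇ F) A x) (v w : E) : inner ℝ (A v) w = inner ℝ v (A w) := by
  have h0 : (fun y => innerSL ℝ (∇ F y)) = fderiv ℝ F := by
    ext y v
    simp [gradient]
  have h1 : ∀ᶠ y in 𝓝 x, HasFDerivAt F (innerSL ℝ (∇ F y)) y := by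
    refine .of_forall fun y => ?_
    rw [congrFun h0 y]
    exact (hF.differentiable one_ne_zero y).hasFDerivAt
  have h2 := (innerSL (E := E) ℝ).hasFDerivAt.comp x hA
  have h3 : inner ℝ (A v) w = inner ℝ (A w) v :=
    second_derivative_symmetric_of_eventually h1 h2 v w
  rw [h3, real_inner_comm]

/-! ### Strong convexity, Taylor expansion and the Hessian at the minimizer. -/

section Objective

variable {d : ℕ} {F : Vec d → ℝ} {xstar : Vec d}

namespace RegularObjective

theorem gradient_eq_zero (hF : RegularObjective F xstar) : ∇ F xstar = 0 := by
  have h : IsLocalMin F xstar := Filter.Eventually.of_forall hF.isMin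
  rw [gradient, h.fderiv_eq_zero, map_zero]

/-- The gradient is strongly monotone with respect to the minimizer. -/
theorem exists_monotone (hF : RegularObjective F xstar) :
    ∃ μ : ℝ, 0 < μ ∧ ∀ x, μ * ‖x - xstar‖ ^ 2 ≤ inner ℝ (∇ F x) (x - xstar) := by
  obtain ⟨μ, hμ, h⟩ := hF.strongConvex
  refine ⟨μ, hμ, fun x => ?_⟩
  -- The strong convexity inequalities from x to x* and from x* to x are added; the function values
  -- cancel and the two halves of μ combine.
  have h1 := h x xstar
  have h2 := h xstar x
  rw [hF.gradient_eq_zero, inner_zero_left, norm_sub_rev] at h2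
  have h3 : inner ℝ (∇ F x) (xstar - x) = -inner ℝ (∇ F x) (x - xstar) := by
    rw [← inner_neg_right, neg_sub]
  rw [h3] at h1
  linarith

theorem exists_growth (hF : RegularObjective F xstar) :
    ∃ L : ℝ, 0 < L ∧ ∀ x, ‖∇ F x‖ ≤ L * ‖x - xstar‖ := by
  obtain ⟨L, hL, h⟩ := hF.lipschitz
  refine ⟨L, hL, fun x => ?_⟩
  simpa [hF.gradient_eq_zero] using h x xstar

/-- The Taylor remainder of the gradient is globally at most quadratic. -/
theorem exists_remainder (hF : RegularObjective F xstar) :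
    ∃ R : ℝ, 0 ≤ R ∧ ∀ x, ‖∇ F x - hessian F xstar (x - xstar)‖ ≤ R * ‖x - xstar‖ ^ 2 := by
  obtain ⟨L, hL, hg⟩ := hF.exists_growth
  obtain ⟨R, hR⟩ := hF.taylor.bound
  obtain ⟨r, hr, hball⟩ := Metric.eventually_nhds_iff.1 hR
  -- Inside the ball of radius r the local expansion applies. Outside it the remainder grows at most
  -- linearly, and ‖x - x*‖ ≥ r turns a linear bound into a quadratic one at the price of 1/r.
  refine ⟨max |R| ((L + ‖hessian F xstar‖) / r), le_max_of_le_left (abs_nonneg _), fun x => ?_⟩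
  by_cases hx : dist x xstar < r
  · have h1 := hball hx
    rw [Real.norm_of_nonneg (by positivity : 0 ≤ ‖x - xstar‖ ^ 2)] at h1
    refine h1.trans ?_
    gcongr
    exact (le_abs_self R).trans (le_max_left _ _)
  · rw [not_lt, dist_eq_norm] at hx
    calc ‖∇ F x - hessian F xstar (x - xstar)‖
        ≤ ‖∇ F x‖ + ‖hessian F xstar (x - xstar)‖ := norm_sub_le _ _
      _ ≤ L * ‖x - xstar‖ + ‖hessian F xstar‖ * ‖x - xstar‖ :=
          add_le_add (hg x) (ContinuousLinearMap.le_opNorm _ _)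
      _ = (L + ‖hessian F xstar‖) / r * (r * ‖x - xstar‖) := by
          field_simp
      _ ≤ (L + ‖hessian F xstar‖) / r * (‖x - xstar‖ * ‖x - xstar‖) := by gcongr
      _ ≤ max |R| ((L + ‖hessian F xstar‖) / r) * ‖x - xstar‖ ^ 2 := by
          rw [sq]
          gcongr
          exact le_max_right _ _

theorem hasFDerivAt_gradient (hF : RegularObjective F xstar) :
    HasFDerivAt (∇ F) (hessian F xstar) xstar := hF.hessian_exists.hasFDerivAt

theorem hessian_symm (hF : RegularObjective F xstar) (v w : Vec d) :
    inner ℝ (hessian F xstar v) w = inner ℝ v (hessian F xstar w) := by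
  exact inner_fderiv_gradient_comm hF.contDiff hF.hasFDerivAt_gradient v w

/-- Strong monotonicity at the points x* + v/n, rescaled by n², passes to the limit of the
difference quotients of ∇F. -/
theorem hessian_coercive (hF : RegularObjective F xstar) :
    ∃ μ : ℝ, 0 < μ ∧ ∀ v, μ * ‖v‖ ^ 2 ≤ inner ℝ (hessian F xstar v) v := by
  obtain ⟨μ, hμ, h⟩ := hF.exists_monotone
  refine ⟨μ, hμ, fun v => ?_⟩
  have hlim := hF.hasFDerivAt_gradient.lim v (c := fun n : ℕ => (n : ℝ)) (l := atTop)
    (by simpa using tendsto_natCast_atTop_atTop (R := ℝ))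
  have hlim' := Filter.Tendsto.inner (𝕜 := ℝ) hlim (tendsto_const_nhds (x := v))
  refine ge_of_tendsto hlim' ?_
  filter_upwards [eventually_gt_atTop 0] with n hn
  have hn' : (0 : ℝ) < n := by exact_mod_cast hn
  have h1 := h (xstar + (n : ℝ)⁻¹ • v)
  rw [add_sub_cancel_left, norm_smul, inner_smul_right, norm_inv, Real.norm_of_nonneg hn'.le] at h1
  rw [hF.gradient_eq_zero, sub_zero, inner_smul_left]
  simp only [conj_trivial]
  have h2 : (n : ℝ) ^ 2 * (μ * ((n : ℝ)⁻¹ * ‖v‖) ^ 2) = μ * ‖v‖ ^ 2 := by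
    field_simp
  have h3 : (n : ℝ) ^ 2 * ((n : ℝ)⁻¹ * inner ℝ (∇ F (xstar + (n : ℝ)⁻¹ • v)) v)
      = n * inner ℝ (∇ F (xstar + (n : ℝ)⁻¹ • v)) v := by
    field_simp
  rw [← h2, ← h3]
  gcongr

/-- The Hessian at the minimizer is invertible. -/
theorem exists_hessian_equiv (hF : RegularObjective F xstar) :
    ∃ e : Vec d ≃L[ℝ] Vec d, (e : Vec d →L[ℝ] Vec d) = hessian F xstar := by
  obtain ⟨μ, hμ, h⟩ := hF.hessian_coercive
  have hinj : Function.Injective (hessian F xstar : Vec d →ₗ[ℝ] Vec d) := by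
    refine (injective_iff_map_eq_zero _).2 fun v hv => ?_
    have h1 := h v
    rw [show hessian F xstar v = 0 from hv, inner_zero_left] at h1
    have : ‖v‖ ^ 2 ≤ 0 := by
      by_contra hc
      nlinarith [mul_pos hμ (not_le.1 hc)]
    simpa using le_antisymm this (by positivity)
  refine ⟨(LinearEquiv.ofInjectiveEndo _ hinj).toContinuousLinearEquiv, ?_⟩
  ext1 v
  rfl

theorem hessian_inverse (hF : RegularObjective F xstar) (v : Vec d) :
    (hessian F xstar).inverse (hessian F xstar v) = v := by
  obtain ⟨e, he⟩ := hF.exists_hessian_equiv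
  rw [← he, ContinuousLinearMap.inverse_equiv]
  simp

theorem inner_hessian_inverse (hF : RegularObjective F xstar) (v w : Vec d) :
    inner ℝ v ((hessian F xstar).inverse w) = inner ℝ ((hessian F xstar).inverse v) w := by
  obtain ⟨e, he⟩ := hF.exists_hessian_equiv
  have hs := hF.hessian_symm
  rw [← he] at hs ⊢
  rw [ContinuousLinearMap.inverse_equiv]
  have := hs (e.symm v) (e.symm w)
  simpa using this

/-- The noiseless gradient step contracts for small h: monotonicity supplies the term -2μh, and the
growth bound costs only L²h². -/
theorem norm_step_sq_le {μ L : ℝ}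
    (hμ : ∀ x, μ * ‖x - xstar‖ ^ 2 ≤ inner ℝ (∇ F x) (x - xstar))
    (hL : ∀ x, ‖∇ F x‖ ≤ L * ‖x - xstar‖) {h : ℝ} (hh : 0 ≤ h) (x : Vec d) :
    ‖(x - xstar) - h • ∇ F x‖ ^ 2 ≤ (1 - 2 * μ * h + L ^ 2 * h ^ 2) * ‖x - xstar‖ ^ 2 := by
  rw [norm_sub_sq_real, inner_smul_right, norm_smul, Real.norm_of_nonneg hh, real_inner_comm]
  have h1 := hμ x
  have h2 : (h * ‖∇ F x‖) ^ 2 ≤ (h * (L * ‖x - xstar‖)) ^ 2 := by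
    have := hL x
    gcongr
  nlinarith [mul_le_mul_of_nonneg_left h1 hh]

end RegularObjective

/-- The term linear in e is kept exact because it vanishes in mean when e is the noise. Everything
else of mixed order is split between ‖u‖⁴, with the small weight κh, and ‖e‖⁴, with a weight of
order h³. -/
theorem norm_add_pow_four_le {E : Type*} [NormedAddCommGroup E] [InnerProductSpace ℝ E]
    (u e : E) {h κ : ℝ} (hh : 0 < h) (hκ : 0 < κ) :
    ‖u + h • e‖ ^ 4 ≤ (1 + κ * h) * ‖u‖ ^ 4 + 4 * h * (‖u‖ ^ 2 * inner ℝ u e)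
      + (16 / κ * h ^ 3 + 3 * h ^ 4) * ‖e‖ ^ 4 := by
  have h1 : ‖u + h • e‖ ^ 2 = ‖u‖ ^ 2 + 2 * h * inner ℝ u e + h ^ 2 * ‖e‖ ^ 2 := by
    rw [norm_add_sq_real, inner_smul_right, norm_smul, Real.norm_of_nonneg hh.le]
    ring
  have h2 : ‖u + h • e‖ ^ 4 = (‖u‖ ^ 2 + 2 * h * inner ℝ u e + h ^ 2 * ‖e‖ ^ 2) ^ 2 := by
    rw [← h1]
    ring
  have hc : |inner ℝ u e| ≤ ‖u‖ * ‖e‖ := abs_real_inner_le_norm u e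
  have hc2 : (inner ℝ u e : ℝ) ^ 2 ≤ (‖u‖ * ‖e‖) ^ 2 := sq_le_sq.2 (by
    rw [abs_of_nonneg (by positivity : 0 ≤ ‖u‖ * ‖e‖)]
    exact hc)
  have hc1 : inner ℝ u e ≤ ‖u‖ * ‖e‖ := (le_abs_self _).trans hc
  have h3 : 8 * h ^ 2 * (‖u‖ ^ 2 * ‖e‖ ^ 2) ≤ κ * h * ‖u‖ ^ 4 + 16 / κ * h ^ 3 * ‖e‖ ^ 4 := by
    have : κ * h * ‖u‖ ^ 4 + 16 / κ * h ^ 3 * ‖e‖ ^ 4 - 8 * h ^ 2 * (‖u‖ ^ 2 * ‖e‖ ^ 2)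
        = h * (κ * ‖u‖ ^ 2 - 4 * h * ‖e‖ ^ 2) ^ 2 / κ := by
      field_simp
      ring
    have : 0 ≤ h * (κ * ‖u‖ ^ 2 - 4 * h * ‖e‖ ^ 2) ^ 2 / κ := by positivity
    linarith
  have h4 : 4 * h ^ 2 * (inner ℝ u e : ℝ) ^ 2 ≤ 4 * h ^ 2 * (‖u‖ * ‖e‖) ^ 2 := by gcongr
  have h5 : 4 * h ^ 3 * ‖e‖ ^ 2 * inner ℝ u e ≤ 4 * h ^ 3 * ‖e‖ ^ 2 * (‖u‖ * ‖e‖) := by gcongr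
  have h6 : 4 * h ^ 3 * ‖e‖ ^ 2 * (‖u‖ * ‖e‖)
      ≤ 2 * h ^ 2 * (‖u‖ ^ 2 * ‖e‖ ^ 2) + 2 * h ^ 4 * ‖e‖ ^ 4 := by
    nlinarith [mul_nonneg (sq_nonneg h) (sq_nonneg (‖e‖ * (‖u‖ - h * ‖e‖)))]
  rw [h2]
  nlinarith

end Objective

/-! ### Recursions that contract slowly. -/

section Recursion

/-- A perturbed contraction with step weights `w` has order `w ^ 2` if the perturbation is of order
`w ^ 3` and `w` decreases slowly. -/
theorem exists_le_mul_sq_of_recursion {y w : ℕ → ℝ} {c B : ℝ} (hc : 0 < c) (hB : 0 ≤ B)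
    (hw : ∀ n, 0 < w n) (hw1 : ∀ᶠ n in atTop, w n * (1 - c / 4 * w n) ≤ w (n + 1))
    (hw2 : ∀ᶠ n in atTop, c * w n ≤ 1)
    (hy : ∀ᶠ n in atTop, y (n + 1) ≤ (1 - c * w n) * y n + B * w n ^ 3) :
    ∃ K : ℝ, 0 ≤ K ∧ ∀ n, y n ≤ K * w n ^ 2 := by
  obtain ⟨n₀, h₀⟩ := eventually_atTop.1 (hw1.and (hw2.and hy))
  -- The first summand makes the induction step close, as B ≤ Kc/2; the second covers the finitely
  -- many indices before the recursion holds.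
  set K : ℝ := 2 * B / c + ∑ k ∈ Finset.range (n₀ + 1), |y k| / w k ^ 2 with hK
  have hsum : ∀ n ≤ n₀, |y n| / w n ^ 2 ≤ ∑ k ∈ Finset.range (n₀ + 1), |y k| / w k ^ 2 :=
    fun n hn => Finset.single_le_sum (f := fun k => |y k| / w k ^ 2)
      (fun k _ => by positivity) (Finset.mem_range.2 (by omega))
  have hK0 : 0 ≤ ∑ k ∈ Finset.range (n₀ + 1), |y k| / w k ^ 2 :=
    Finset.sum_nonneg fun k _ => by positivity
  have hBK : 2 * B / c ≤ K := by linarith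
  have hKn : 0 ≤ K := le_trans (by positivity) hBK
  have hbase : ∀ n ≤ n₀, y n ≤ K * w n ^ 2 := by
    intro n hn
    have h1 : |y n| / w n ^ 2 ≤ K := (hsum n hn).trans (by
      rw [hK]
      have : 0 ≤ 2 * B / c := by positivity
      linarith)
    rw [div_le_iff₀ (by have := hw n; positivity)] at h1
    exact (le_abs_self _).trans h1
  refine ⟨K, hKn, fun n => ?_⟩
  rcases le_total n n₀ with hn | hn
  · exact hbase n hn
  · induction n, hn using Nat.le_induction with
    | base => exact hbase n₀ le_rfl
    | succ n hn ih =>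
      obtain ⟨h1, h2, h3⟩ := h₀ n hn
      have hwn := hw n
      have h4 : B ≤ K * c / 2 := by
        rw [div_le_iff₀ hc] at hBK
        linarith
      have h5 : 0 ≤ w n * (1 - c / 4 * w n) := by
        apply mul_nonneg hwn.le
        linarith [mul_pos hc hwn]
      calc y (n + 1) ≤ (1 - c * w n) * y n + B * w n ^ 3 := h3
        _ ≤ (1 - c * w n) * (K * w n ^ 2) + K * c / 2 * w n ^ 3 := by
            have : 0 ≤ 1 - c * w n := by linarith
            gcongr
        -- Half of the contraction pays for the perturbation. The other half pays for the decrease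
        -- of the weights, since (1 - cw/4)² ≥ 1 - cw/2.
        _ ≤ K * (w n * (1 - c / 4 * w n)) ^ 2 := by
            have : 0 ≤ K * w n ^ 2 * (c / 4 * w n) ^ 2 := by positivity
            nlinarith
        _ ≤ K * w (n + 1) ^ 2 := by gcongr

/-- The decay rate `(n + 1) ^ (-α)`. -/
def rate (α : ℝ) (n : ℕ) : ℝ := ((n : ℝ) + 1) ^ (-α)

theorem rate_pos (α : ℝ) (n : ℕ) : 0 < rate α n := by
  unfold rate
  positivity

theorem tendsto_rate {α : ℝ} (hα : 0 < α) : Tendsto (rate α) atTop (𝓝 0) :=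
  (tendsto_rpow_neg_atTop hα).comp
    (tendsto_atTop_add_const_right _ _ tendsto_natCast_atTop_atTop)

/-- The relative decrease of (n+1)^{-α} in one step is at most 1/(n+1), which is eventually below c
(n+1)^{-α} because α < 1. -/
theorem eventually_rate_succ {α c : ℝ} (hα : 0 < α) (hα' : α < 1) (hc : 0 < c) :
    ∀ᶠ n in atTop, rate α n * (1 - c * rate α n) ≤ rate α (n + 1) := by
  have h1 : ∀ᶠ n in atTop, rate (1 - α) n ≤ c :=
    (tendsto_rate (by linarith : 0 < 1 - α)).eventually (ge_mem_nhds hc)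
  filter_upwards [h1] with n hn
  have hN : (0 : ℝ) < (n : ℝ) + 1 := by positivity
  have hinv : ((n : ℝ) + 1)⁻¹ ≤ c * rate α n := by
    calc ((n : ℝ) + 1)⁻¹ = rate (1 - α) n * rate α n := by
          rw [rate, rate, ← Real.rpow_add hN, ← Real.rpow_neg_one]
          congr 1
          ring
      _ ≤ c * rate α n := by
          gcongr
          exact (rate_pos _ _).le
  have hq : 1 - ((n : ℝ) + 1)⁻¹ ≤ (1 + ((n : ℝ) + 1)⁻¹) ^ (-α) := by
    have hi : (0 : ℝ) < ((n : ℝ) + 1)⁻¹ := by positivity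
    calc 1 - ((n : ℝ) + 1)⁻¹ ≤ (1 + ((n : ℝ) + 1)⁻¹) ^ (-1 : ℝ) := by
          rw [Real.rpow_neg_one, ← one_div (1 + _), le_div_iff₀ (by positivity)]
          nlinarith
      _ ≤ (1 + ((n : ℝ) + 1)⁻¹) ^ (-α) :=
          Real.rpow_le_rpow_of_exponent_le (by linarith) (by linarith)
  have hsplit : rate α (n + 1) = rate α n * (1 + ((n : ℝ) + 1)⁻¹) ^ (-α) := by
    rw [rate, rate, ← Real.mul_rpow hN.le (by positivity)]
    congr 1
    push_cast
    field_simp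
  rw [hsplit]
  have := (rate_pos α n).le
  gcongr
  linarith

/-- To first order in h the left side is 1 - 3μh, which leaves room for all higher-order terms. In
the proof, h · k(h) is the right side minus the left side, and k(0) = 2μ. -/
theorem eventually_contraction {μ L C : ℝ} (hμ : 0 < μ) :
    ∀ᶠ h : ℝ in 𝓝[>] 0, (1 + μ * h) * (1 - 2 * μ * h + L ^ 2 * h ^ 2) ^ 2
      + (16 / μ * h ^ 3 + 3 * h ^ 4) * C ≤ 1 - μ * h := by
  set k : ℝ → ℝ := fun h => -μ + 2 * (2 * μ - L ^ 2 * h) - h * (2 * μ - L ^ 2 * h) ^ 2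
    - μ * (1 - 2 * μ * h + L ^ 2 * h ^ 2) ^ 2 - (16 / μ * h ^ 2 + 3 * h ^ 3) * C with hk
  have hc : Continuous k := by fun_prop
  have h0 : 0 < k 0 := by
    simp only [hk]
    ring_nf
    linarith
  have h1 : ∀ᶠ h in 𝓝[>] (0 : ℝ), 0 < k h :=
    nhdsWithin_le_nhds ((hc.tendsto 0).eventually (lt_mem_nhds h0))
  filter_upwards [h1, self_mem_nhdsWithin] with h hh hpos
  have h2 : 0 ≤ h * k h := (mul_pos hpos hh).le
  simp only [hk] at h2
  nlinarith

end Recursion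

/-! ### Moments of the iterates. -/

section Moments

variable {d : ℕ} {Ω Ξ : Type*} [m0 : MeasurableSpace Ω] [MeasurableSpace Ξ]
  {P : Measure Ω} [IsProbabilityMeasure P] {Pi : Measure Ξ} [IsProbabilityMeasure Pi]
  {f : Vec d → Ξ → ℝ} {ξ : ℕ → Ω → Ξ} {x₀ xstar : Vec d} {η α : ℝ}

theorem integral_mul_mul_eq_zero {m : MeasurableSpace Ω} (hm : m ≤ m0) {X Y p : Ω → ℝ}
    (hY : StronglyMeasurable[m] Y) (hX : StronglyMeasurable[m] X) (hY2 : MemLp Y 2 P)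
    (hX4 : MemLp X 4 P) (hp4 : MemLp p 4 P) (h : P[p | m] =ᵐ[P] 0) :
    ∫ ω, Y ω * (X ω * p ω) ∂P = 0 := by
  have hXp := MemLp.mul_four hX4 hp4
  refine integral_mul_eq_zero_of_condExp hm hY hY2 hXp ?_
  have h1 := condExp_mul_of_stronglyMeasurable_left hX (hXp.integrable (by norm_num))
    (hp4.integrable (by norm_num))
  refine h1.trans ?_
  filter_upwards [h] with ω h
  rw [Pi.mul_apply, h, Pi.zero_apply, mul_zero]

/-- The error `xₙ - x*` of the iterates. -/
def iterErr (f : Vec d → Ξ → ℝ) (η α : ℝ) (x₀ xstar : Vec d) (ξ : ℕ → Ω → Ξ) (n : ℕ) (ω : Ω) :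
    Vec d := sgd f η α x₀ (fun i => ξ i ω) n - xstar

theorem stepSize_succ (n : ℕ) : stepSize η α (n + 1) = η * rate α n := by
  simp [stepSize, rate]

theorem stepSize_pos (hη : 0 < η) (n : ℕ) : 0 < stepSize η α (n + 1) := by
  rw [stepSize_succ]
  exact mul_pos hη (rate_pos _ _)

theorem iterErr_succ (n : ℕ) (ω : Ω) : iterErr f η α x₀ xstar ξ (n + 1) ω
    = (iterErr f η α x₀ xstar ξ n ω
      - stepSize η α (n + 1) • ∇ (objective f Pi) (sgd f η α x₀ (fun i => ξ i ω) n))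
      + stepSize η α (n + 1) • gradNoise f Pi η α x₀ ξ (n + 1) ω := by
  rw [gradNoise_succ, iterErr, iterErr, sgd, smul_sub]
  abel

theorem measurable_iterErr (hf : RegularLoss f Pi xstar) (n : ℕ) :
    Measurable[past ξ n] (iterErr f η α x₀ xstar ξ n) :=
  (hf.measurable_sgd n).sub_const _

theorem memLp_gradNoise (hξ : IsIIDSample ξ Pi P)
    (hF : RegularObjective (objective f Pi) xstar) (hf : RegularLoss f Pi xstar)
    (hε : NoiseMoments f Pi xstar η α x₀ ξ P) (n : ℕ) :
    MemLp (gradNoise f Pi η α x₀ ξ (n + 1)) 4 P := by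
  have hm : Measurable (gradNoise f Pi η α x₀ ξ (n + 1)) :=
    (hf.measurable_gradNoise hF.contDiff n).mono (hξ.past_le _) le_rfl
  refine (integrable_norm_rpow_iff hm.aestronglyMeasurable (by norm_num) (by norm_num)).1 ?_
  simpa using hε.integrable (n + 1) (by omega)

theorem memLp_iterErr (hξ : IsIIDSample ξ Pi P)
    (hF : RegularObjective (objective f Pi) xstar) (hf : RegularLoss f Pi xstar)
    (hε : NoiseMoments f Pi xstar η α x₀ ξ P) (n : ℕ) :
    MemLp (iterErr f η α x₀ xstar ξ n) 4 P := by
  induction n with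
  | zero => exact memLp_const (x₀ - xstar)
  | succ n ih =>
    obtain ⟨L, hL, hg⟩ := hF.exists_growth
    have hm : Measurable fun ω => sgd f η α x₀ (fun i => ξ i ω) n :=
      (hf.measurable_sgd n).mono (hξ.past_le _) le_rfl
    have h1 : MemLp (fun ω => ∇ (objective f Pi) (sgd f η α x₀ (fun i => ξ i ω) n)) 4 P :=
      ih.of_le_mul ((continuous_gradient hF.contDiff).measurable.comp hm).aestronglyMeasurable
        (ae_of_all _ fun ω => hg _)
    have h2 := (ih.sub (h1.const_smul (stepSize η α (n + 1)))).add
      ((memLp_gradNoise hξ hF hf hε n).const_smul (stepSize η α (n + 1)))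
    refine (memLp_congr_ae (ae_of_all _ fun ω => ?_)).1 h2
    exact (iterErr_succ n ω).symm

theorem memLp_inner_gradNoise (hξ : IsIIDSample ξ Pi P)
    (hF : RegularObjective (objective f Pi) xstar) (hf : RegularLoss f Pi xstar)
    (hε : NoiseMoments f Pi xstar η α x₀ ξ P) (n : ℕ) (a : Vec d) :
    MemLp (fun ω => (inner ℝ a (gradNoise f Pi η α x₀ ξ (n + 1) ω) : ℝ)) 4 P :=
  (memLp_gradNoise hξ hF hf hε n).const_inner a

theorem condExp_inner_gradNoise (hξ : IsIIDSample ξ Pi P)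
    (hF : RegularObjective (objective f Pi) xstar) (hf : RegularLoss f Pi xstar)
    (hε : NoiseMoments f Pi xstar η α x₀ ξ P) (n : ℕ) (a : Vec d) :
    P[fun ω => inner ℝ a (gradNoise f Pi η α x₀ ξ (n + 1) ω) | past ξ n] =ᵐ[P] 0 :=
  hf.condExp_inner_gradNoise hF.contDiff hξ n a
    ((memLp_inner_gradNoise hξ hF hf hε n a).integrable (by norm_num))

theorem memLp_sq_norm {E : Type*} [NormedAddCommGroup E] {X : Ω → E} (hX : MemLp X 4 P) :
    MemLp (fun ω => ‖X ω‖ ^ 2) 2 P := by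
  simpa only [sq] using MemLp.mul_four hX.norm hX.norm

theorem integrable_inner_of_memLp {X Y : Ω → Vec d} (hX : MemLp X 4 P) (hY : MemLp Y 4 P) :
    Integrable (fun ω => ‖X ω‖ ^ 2 * inner ℝ (X ω) (Y ω)) P := by
  have h1 : Integrable (fun ω => ‖X ω‖ ^ 2 * (‖X ω‖ * ‖Y ω‖)) P :=
    (memLp_sq_norm hX).integrable_mul (MemLp.mul_four hX.norm hY.norm)
  refine h1.mono ((hX.1.norm.pow 2).mul (hX.1.inner hY.1)) (ae_of_all _ fun ω => ?_)
  rw [norm_mul, norm_mul, norm_mul, norm_norm, norm_norm]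
  gcongr
  exact norm_inner_le_norm _ _

/-- The inner product is expanded in an orthonormal basis, so that only scalar projections of the
noise need to be conditioned. -/
theorem integral_inner_gradNoise_eq_zero (hξ : IsIIDSample ξ Pi P)
    (hF : RegularObjective (objective f Pi) xstar) (hf : RegularLoss f Pi xstar)
    (hε : NoiseMoments f Pi xstar η α x₀ ξ P) (n : ℕ) {u : Ω → Vec d}
    (hu : Measurable[past ξ n] u) (hu4 : MemLp u 4 P) :
    ∫ ω, ‖u ω‖ ^ 2 * inner ℝ (u ω) (gradNoise f Pi η α x₀ ξ (n + 1) ω) ∂P = 0 := by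
  set b := EuclideanSpace.basisFun (Fin d) ℝ
  have h1 : ∀ ω, ‖u ω‖ ^ 2 * inner ℝ (u ω) (gradNoise f Pi η α x₀ ξ (n + 1) ω)
      = ∑ i, ‖u ω‖ ^ 2 * (inner ℝ (u ω) (b i)
        * inner ℝ (b i) (gradNoise f Pi η α x₀ ξ (n + 1) ω)) := by
    intro ω
    rw [← Finset.mul_sum, b.sum_inner_mul_inner]
  have hui : ∀ i, MemLp (fun ω => (inner ℝ (u ω) (b i) : ℝ)) 4 P := fun i => hu4.inner_const _
  simp only [h1]
  rw [integral_finsetSum]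
  · refine Finset.sum_eq_zero fun i _ => ?_
    exact integral_mul_mul_eq_zero (hξ.past_le n) (hu.stronglyMeasurable.norm.pow 2)
      (hu.stronglyMeasurable.inner stronglyMeasurable_const) (memLp_sq_norm hu4) (hui i)
      (memLp_inner_gradNoise hξ hF hf hε n (b i)) (condExp_inner_gradNoise hξ hF hf hε n (b i))
  · intro i _
    exact (memLp_sq_norm hu4).integrable_mul
      (MemLp.mul_four (hui i) (memLp_inner_gradNoise hξ hF hf hε n (b i)))

theorem integrable_norm_pow_four {E : Type*} [NormedAddCommGroup E] {X : Ω → E}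
    (hX : MemLp X 4 P) : Integrable (fun ω => ‖X ω‖ ^ 4) P :=
  hX.integrable_norm_pow (p := 4) (by norm_num)

theorem exists_gradNoise_fourth (hξ : IsIIDSample ξ Pi P)
    (hF : RegularObjective (objective f Pi) xstar) (hf : RegularLoss f Pi xstar)
    (hε : NoiseMoments f Pi xstar η α x₀ ξ P) : ∃ C : ℝ, 0 ≤ C ∧ ∀ n,
    ∫ ω, ‖gradNoise f Pi η α x₀ ξ (n + 1) ω‖ ^ 4 ∂P
      ≤ C * (1 + ∫ ω, ‖iterErr f η α x₀ xstar ξ n ω‖ ^ 4 ∂P) := by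
  obtain ⟨C, hC⟩ := hε.fourth
  refine ⟨|C|, abs_nonneg C, fun n => ?_⟩
  have hi := integrable_norm_pow_four (memLp_iterErr hξ hF hf hε n)
  rw [← integral_condExp (hξ.past_le n)]
  calc ∫ ω, (P[fun ω' => ‖gradNoise f Pi η α x₀ ξ (n + 1) ω'‖ ^ 4 | past ξ n]) ω ∂P
      ≤ ∫ ω, |C| * (1 + ‖iterErr f η α x₀ xstar ξ n ω‖ ^ 4) ∂P := by
        refine integral_mono_ae integrable_condExp
          (((integrable_const 1).add hi).const_mul _) ?_
        filter_upwards [hC (n + 1) (by omega)] with ω hω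
        refine hω.trans ?_
        simp only [iterErr, Nat.add_sub_cancel]
        gcongr
        exact le_abs_self C
    _ = |C| * (1 + ∫ ω, ‖iterErr f η α x₀ xstar ξ n ω‖ ^ 4 ∂P) := by
        rw [integral_const_mul, integral_add (integrable_const 1) hi]
        simp

/-- The new error is a vector known at time n, the noiseless step, plus h times the noise. The
former contracts, and the weight κ = μ in `norm_add_pow_four_le` uses up only part of that
contraction. -/
theorem fourth_moment_step (hη : 0 < η) (hξ : IsIIDSample ξ Pi P)
    (hF : RegularObjective (objective f Pi) xstar) (hf : RegularLoss f Pi xstar)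
    (hε : NoiseMoments f Pi xstar η α x₀ ξ P) {μ L : ℝ} (hμ0 : 0 < μ)
    (hμ : ∀ x, μ * ‖x - xstar‖ ^ 2 ≤ inner ℝ (∇ (objective f Pi) x) (x - xstar))
    (hL : ∀ x, ‖∇ (objective f Pi) x‖ ≤ L * ‖x - xstar‖) (n : ℕ) {h : ℝ}
    (hh : h = stepSize η α (n + 1)) :
    ∫ ω, ‖iterErr f η α x₀ xstar ξ (n + 1) ω‖ ^ 4 ∂P
      ≤ (1 + μ * h) * (1 - 2 * μ * h + L ^ 2 * h ^ 2) ^ 2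
          * ∫ ω, ‖iterErr f η α x₀ xstar ξ n ω‖ ^ 4 ∂P
        + (16 / μ * h ^ 3 + 3 * h ^ 4)
          * ∫ ω, ‖gradNoise f Pi η α x₀ ξ (n + 1) ω‖ ^ 4 ∂P := by
  have hpos : 0 < h := hh ▸ stepSize_pos hη n
  set u : Ω → Vec d := fun ω => iterErr f η α x₀ xstar ξ n ω
    - h • ∇ (objective f Pi) (sgd f η α x₀ (fun i => ξ i ω) n) with hu
  set e := gradNoise f Pi η α x₀ ξ (n + 1) with he
  have hum : Measurable[past ξ n] u := (measurable_iterErr hf n).sub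
    (((continuous_gradient hF.contDiff).measurable.comp (hf.measurable_sgd n)).const_smul h)
  have hδ := memLp_iterErr hξ hF hf hε n
  have he4 := memLp_gradNoise hξ hF hf hε n
  have hu2 : ∀ ω, ‖u ω‖ ^ 2
      ≤ (1 - 2 * μ * h + L ^ 2 * h ^ 2) * ‖iterErr f η α x₀ xstar ξ n ω‖ ^ 2 :=
    fun ω => RegularObjective.norm_step_sq_le hμ hL hpos.le _
  have hu4' : ∀ ω, ‖u ω‖ ^ 4
      ≤ (1 - 2 * μ * h + L ^ 2 * h ^ 2) ^ 2 * ‖iterErr f η α x₀ xstar ξ n ω‖ ^ 4 := by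
    intro ω
    have h1 := pow_le_pow_left₀ (by positivity) (hu2 ω) 2
    calc ‖u ω‖ ^ 4 = (‖u ω‖ ^ 2) ^ 2 := by ring
      _ ≤ _ := h1
      _ = _ := by ring
  have hu4 : MemLp u 4 P := by
    refine hδ.of_le_mul (c := 1 + h * L) (hum.mono (hξ.past_le n) le_rfl).aestronglyMeasurable
      (ae_of_all _ fun ω => ?_)
    calc ‖u ω‖ ≤ ‖iterErr f η α x₀ xstar ξ n ω‖
          + ‖h • ∇ (objective f Pi) (sgd f η α x₀ (fun i => ξ i ω) n)‖ := norm_sub_le _ _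
      _ ≤ ‖iterErr f η α x₀ xstar ξ n ω‖ + h * (L * ‖iterErr f η α x₀ xstar ξ n ω‖) := by
          rw [norm_smul, Real.norm_of_nonneg hpos.le]
          gcongr
          exact hL _
      _ = _ := by ring
  have hui := integrable_norm_pow_four hu4
  have hei := integrable_norm_pow_four he4
  have hci := integrable_inner_of_memLp hu4 he4
  have h0 : ∫ ω, ‖u ω‖ ^ 2 * inner ℝ (u ω) (e ω) ∂P = 0 :=
    integral_inner_gradNoise_eq_zero hξ hF hf hε n hum hu4
  have hrep : ∀ ω, iterErr f η α x₀ xstar ξ (n + 1) ω = u ω + h • e ω := by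
    intro ω
    rw [iterErr_succ (Pi := Pi), hu, he, hh]
  calc ∫ ω, ‖iterErr f η α x₀ xstar ξ (n + 1) ω‖ ^ 4 ∂P
      ≤ ∫ ω, ((1 + μ * h) * ‖u ω‖ ^ 4 + 4 * h * (‖u ω‖ ^ 2 * inner ℝ (u ω) (e ω))
        + (16 / μ * h ^ 3 + 3 * h ^ 4) * ‖e ω‖ ^ 4) ∂P := by
        refine integral_mono_of_nonneg (ae_of_all _ fun ω => by positivity)
          (((hui.const_mul _).add (hci.const_mul _)).add (hei.const_mul _))
          (ae_of_all _ fun ω => ?_)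
        simp only [hrep]
        exact norm_add_pow_four_le _ _ hpos hμ0
    _ = (1 + μ * h) * ∫ ω, ‖u ω‖ ^ 4 ∂P
        + (16 / μ * h ^ 3 + 3 * h ^ 4) * ∫ ω, ‖e ω‖ ^ 4 ∂P := by
        rw [integral_add_add (hui.const_mul _) (hci.const_mul _) (hei.const_mul _),
          integral_const_mul, integral_const_mul, integral_const_mul, h0]
        ring
    _ ≤ (1 + μ * h) * ((1 - 2 * μ * h + L ^ 2 * h ^ 2) ^ 2
          * ∫ ω, ‖iterErr f η α x₀ xstar ξ n ω‖ ^ 4 ∂P)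
        + (16 / μ * h ^ 3 + 3 * h ^ 4) * ∫ ω, ‖e ω‖ ^ 4 ∂P := by
        have h1 : ∫ ω, ‖u ω‖ ^ 4 ∂P ≤ (1 - 2 * μ * h + L ^ 2 * h ^ 2) ^ 2
            * ∫ ω, ‖iterErr f η α x₀ xstar ξ n ω‖ ^ 4 ∂P := by
          rw [← integral_const_mul]
          exact integral_mono hui ((integrable_norm_pow_four hδ).const_mul _) hu4'
        gcongr
    _ = _ := by ring

theorem exists_fourth_moment_le (hη : 0 < η) (hα : 0 < α) (hα' : α < 1)
    (hξ : IsIIDSample ξ Pi P) (hF : RegularObjective (objective f Pi) xstar)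
    (hf : RegularLoss f Pi xstar) (hε : NoiseMoments f Pi xstar η α x₀ ξ P) :
    ∃ K : ℝ, 0 ≤ K ∧ ∀ n, ∫ ω, ‖iterErr f η α x₀ xstar ξ n ω‖ ^ 4 ∂P ≤ K * rate α n ^ 2 := by
  obtain ⟨μ, hμ0, hμ⟩ := hF.exists_monotone
  obtain ⟨L, hL0, hL⟩ := hF.exists_growth
  obtain ⟨C, hC0, hC⟩ := exists_gradNoise_fourth hξ hF hf hε
  have hstep : Tendsto (fun n => stepSize η α (n + 1)) atTop (𝓝[>] 0) := by
    refine tendsto_nhdsWithin_iff.2 ⟨?_, .of_forall fun n => stepSize_pos hη n⟩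
    simp only [stepSize_succ]
    simpa using (tendsto_rate hα).const_mul η
  have hstep1 : ∀ᶠ n in atTop, stepSize η α (n + 1) < 1 :=
    (tendsto_nhdsWithin_iff.1 hstep).1.eventually (gt_mem_nhds one_pos)
  -- The noise moment is at most C(1 + y). The part Cy disappears into the contraction, and the
  -- constant part gives B, with the h⁴ term reduced to h³ by h < 1.
  refine exists_le_mul_sq_of_recursion (c := μ * η) (B := (16 / μ + 3) * C * η ^ 3)
    (mul_pos hμ0 hη) (by positivity) (rate_pos α)
    (eventually_rate_succ hα hα' (by positivity)) ?_ ?_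
  · have := (tendsto_rate hα).const_mul (μ * η)
    rw [mul_zero] at this
    exact this.eventually (ge_mem_nhds one_pos)
  · filter_upwards [hstep.eventually (eventually_contraction (L := L) (C := C) hμ0), hstep1]
      with n hn hn1
    have h1 := fourth_moment_step hη hξ hF hf hε hμ0 hμ hL n rfl
    have h2 := hC n
    have hpos := stepSize_pos (α := α) hη n
    have hs := stepSize_succ (η := η) (α := α) n
    set h := stepSize η α (n + 1)
    set y := ∫ ω, ‖iterErr f η α x₀ xstar ξ n ω‖ ^ 4 ∂P with hy
    have hy0 : 0 ≤ y := integral_nonneg fun ω => by positivity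
    calc _ ≤ _ := h1
      _ ≤ (1 + μ * h) * (1 - 2 * μ * h + L ^ 2 * h ^ 2) ^ 2 * y
          + (16 / μ * h ^ 3 + 3 * h ^ 4) * (C * (1 + y)) := by gcongr
      _ = ((1 + μ * h) * (1 - 2 * μ * h + L ^ 2 * h ^ 2) ^ 2
          + (16 / μ * h ^ 3 + 3 * h ^ 4) * C) * y + (16 / μ + 3 * h) * C * h ^ 3 := by ring
      _ ≤ (1 - μ * h) * y + (16 / μ + 3 * 1) * C * h ^ 3 := by gcongr
      _ = (1 - μ * η * rate α n) * y + (16 / μ + 3) * C * η ^ 3 * rate α n ^ 3 := by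
          rw [hs]
          ring

/-- Root mean square rates of the error of the iterates and of its square. -/
theorem exists_rms_iterErr (hη : 0 < η) (hα : 0 < α) (hα' : α < 1)
    (hξ : IsIIDSample ξ Pi P) (hF : RegularObjective (objective f Pi) xstar)
    (hf : RegularLoss f Pi xstar) (hε : NoiseMoments f Pi xstar η α x₀ ξ P) :
    ∃ K : ℝ, 1 ≤ K ∧ ∀ n, RMSLE P (iterErr f η α x₀ xstar ξ n) (K * rate (α / 2) n) ∧
      RMSLE P (fun ω => ‖iterErr f η α x₀ xstar ξ n ω‖ ^ 2) (K * rate α n) := by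
  obtain ⟨K, hK0, hK⟩ := exists_fourth_moment_le hη hα hα' hξ hF hf hε
  have hK1 : K ≤ (K + 1) ^ 2 := by nlinarith
  have hrate : ∀ n, rate (α / 2) n ^ 2 = rate α n := by
    intro n
    rw [sq, rate, rate, ← Real.rpow_add (by positivity)]
    congr 1
    ring
  have h2 : ∀ n, RMSLE P (fun ω => ‖iterErr f η α x₀ xstar ξ n ω‖ ^ 2) ((K + 1) * rate α n) := by
    intro n
    refine ⟨memLp_sq_norm (memLp_iterErr hξ hF hf hε n),
      mul_nonneg (by linarith) (rate_pos _ _).le, ?_⟩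
    calc ∫ ω, ‖‖iterErr f η α x₀ xstar ξ n ω‖ ^ 2‖ ^ 2 ∂P
        = ∫ ω, ‖iterErr f η α x₀ xstar ξ n ω‖ ^ 4 ∂P := by
          congr 1
          ext ω
          rw [Real.norm_of_nonneg (by positivity)]
          ring
      _ ≤ K * rate α n ^ 2 := hK n
      _ ≤ (K + 1) ^ 2 * rate α n ^ 2 := by gcongr
      _ = _ := by ring
  refine ⟨K + 1, by linarith, fun n => ⟨⟨?_, ?_, ?_⟩, h2 n⟩⟩
  · exact (memLp_iterErr hξ hF hf hε n).mono_exponent (by norm_num)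
  · exact mul_nonneg (by linarith) (rate_pos _ _).le
  · have h3 := (h2 n).integral_norm_le
    simp only [norm_pow, norm_norm] at h3
    refine h3.trans ?_
    rw [mul_pow, hrate]
    have := (rate_pos α n).le
    gcongr
    nlinarith

end Moments

/-! ### Starts and lengths of the batches. -/

section Batches

variable {C α : ℝ} {i j n : ℕ}

theorem bddAbove_batch (a : ℕ → ℕ) (i : ℕ) : BddAbove {j | ∃ m, 1 ≤ m ∧ a m = j ∧ j ≤ i} :=
  ⟨i, fun _ ⟨_, _, _, h⟩ => h⟩

theorem le_batchStart {a : ℕ → ℕ} {m i : ℕ} (hm : 1 ≤ m) (h : a m ≤ i) : a m ≤ batchStart a i :=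
  le_csSup (bddAbove_batch a i) ⟨m, hm, rfl, h⟩

theorem batchSeq_one : batchSeq C α 1 = 1 := rfl

theorem batchStart_mem (hi : 1 ≤ i) : ∃ m, 1 ≤ m ∧ batchSeq C α m = batchStart (batchSeq C α) i ∧
    batchStart (batchSeq C α) i ≤ i :=
  Nat.sSup_mem (s := {j | ∃ m, 1 ≤ m ∧ batchSeq C α m = j ∧ j ≤ i})
    ⟨1, 1, le_rfl, batchSeq_one, hi⟩ (bddAbove_batch _ i)

theorem batchStart_le (hi : 1 ≤ i) : batchStart (batchSeq C α) i ≤ i :=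
  (batchStart_mem hi).choose_spec.2.2

theorem one_le_batchStart (hi : 1 ≤ i) : 1 ≤ batchStart (batchSeq C α) i :=
  le_batchStart (a := batchSeq C α) (m := 1) le_rfl hi

/-- Distinct batches do not overlap. This needs no monotonicity of the sequence a_m, whose second
term may even be 0 for small C, because the start is the largest admissible value. -/
theorem lt_batchStart (hi : 1 ≤ i) (hij : i < j)
    (hne : batchStart (batchSeq C α) i ≠ batchStart (batchSeq C α) j) :
    i < batchStart (batchSeq C α) j := by
  by_contra hc
  obtain ⟨m, hm, hmt, _⟩ := batchStart_mem (C := C) (α := α) hi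
  obtain ⟨m', hm', hmt', _⟩ := batchStart_mem (C := C) (α := α) (hi.trans hij.le)
  refine hne (le_antisymm ?_ ?_)
  · rw [← hmt]
    refine le_batchStart hm ?_
    rw [hmt]
    exact (batchStart_le hi).trans hij.le
  · rw [← hmt'] at hc ⊢
    exact le_batchStart hm' (not_lt.1 hc)

theorem batchLength_cast (hi : 1 ≤ i) : (batchLength (batchSeq C α) i : ℝ)
    = (i : ℝ) - batchStart (batchSeq C α) i + 1 := by
  rw [batchLength, Nat.cast_add, Nat.cast_sub (batchStart_le hi), Nat.cast_one]

theorem batchLength_le (hi : 1 ≤ i) : batchLength (batchSeq C α) i ≤ i := by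
  have := one_le_batchStart (C := C) (α := α) hi
  rw [batchLength]
  omega

theorem one_le_batchLength (a : ℕ → ℕ) (i : ℕ) : 1 ≤ batchLength a i := by
  rw [batchLength]
  omega

/-- For counting: the pair of start and length determines the index. -/
theorem eq_of_batchStart_eq (hi : 1 ≤ i) (hj : 1 ≤ j)
    (ht : batchStart (batchSeq C α) i = batchStart (batchSeq C α) j)
    (hl : batchLength (batchSeq C α) i = batchLength (batchSeq C α) j) : i = j := by
  have h1 := batchStart_le (C := C) (α := α) hi
  have h2 := batchStart_le (C := C) (α := α) hj
  rw [batchLength, batchLength] at hl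
  omega

/-- Put β = 2/(1-α), γ = 1/β, and let y = (i/C)^γ be the real index at which C y^β = i. Then t_i ≥
a_{⌊y⌋} ≥ C(y-1)^β - 1 ≥ i - βi/y - 1 by Bernoulli's inequality, and i/y is of order i^{1-γ} =
i^{(1+α)/2}. -/
theorem exists_batchLength_le (hα : 0 < α) (hα' : α < 1) (hC : 0 < C) : ∃ c : ℝ, 1 ≤ c ∧
    ∀ i : ℕ, 1 ≤ i → (batchLength (batchSeq C α) i : ℝ) ≤ c * (i : ℝ) ^ ((1 + α) / 2) := by
  set γ := (1 - α) / 2 with hγ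
  set β := 2 / (1 - α) with hβ
  have hγ0 : 0 < γ := by rw [hγ]; linarith
  have hα1 : 0 < 1 - α := by linarith
  have hβ2 : 2 ≤ β := by rw [hβ, le_div_iff₀ hα1]; linarith
  have hγβ : γ * β = 1 := by
    rw [hγ, hβ]
    field_simp
  refine ⟨β * C ^ γ + 2, ?_, fun i hi => ?_⟩
  · have : 0 ≤ β * C ^ γ := by positivity
    linarith
  have hi' : (1 : ℝ) ≤ i := by exact_mod_cast hi
  have hi0 : (0 : ℝ) < i := by linarith
  set y : ℝ := ((i : ℝ) / C) ^ γ with hy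
  have hy0 : 0 < y := by positivity
  have hyβ : C * y ^ β = i := by
    rw [hy, ← Real.rpow_mul (by positivity), hγβ, Real.rpow_one]
    field_simp
  have hiy : (i : ℝ) / y = C ^ γ * (i : ℝ) ^ ((1 + α) / 2) := by
    rw [hy, Real.div_rpow hi0.le hC.le, show (1 + α) / 2 = 1 - γ by rw [hγ]; ring,
      Real.rpow_sub hi0, Real.rpow_one]
    field_simp
  have key : (batchLength (batchSeq C α) i : ℝ) ≤ β * ((i : ℝ) / y) + 2 := by
    -- The floor formula for a_m starts at m = 2. For y < 2 the trivial bound l_i ≤ i is enough, as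
    -- i ≤ 2i/y and β ≥ 2.
    rcases lt_or_ge y 2 with h2 | h2
    · have h3 : (batchLength (batchSeq C α) i : ℝ) ≤ i := by exact_mod_cast batchLength_le hi
      have h4 : (i : ℝ) ≤ 2 * ((i : ℝ) / y) := by
        rw [mul_div_assoc', le_div_iff₀ hy0]
        nlinarith
      have h5 : 2 * ((i : ℝ) / y) ≤ β * ((i : ℝ) / y) := by gcongr
      linarith
    · have hm2 : 2 ≤ ⌊y⌋₊ := Nat.le_floor (by exact_mod_cast h2)
      have ham : batchSeq C α ⌊y⌋₊ = ⌊C * ((⌊y⌋₊ : ℕ) : ℝ) ^ β⌋₊ := by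
        rw [batchSeq, if_neg (by omega)]
      have hmy : ((⌊y⌋₊ : ℕ) : ℝ) ≤ y := Nat.floor_le hy0.le
      have hmy' : y - 1 ≤ ((⌊y⌋₊ : ℕ) : ℝ) := by linarith [Nat.lt_floor_add_one y]
      have hle : batchSeq C α ⌊y⌋₊ ≤ i := by
        rw [ham]
        refine Nat.floor_le_of_le ?_
        rw [← hyβ]
        gcongr
      have hlow : (i : ℝ) - β * ((i : ℝ) / y) - 1 ≤ batchSeq C α ⌊y⌋₊ := by
        have h6 : 1 + β * (-(1 / y)) ≤ (1 + -(1 / y)) ^ β := by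
          refine one_add_mul_self_le_rpow_one_add ?_ (by linarith)
          rw [neg_le_neg_iff, div_le_one hy0]
          linarith
        have h7 : y - 1 = y * (1 + -(1 / y)) := by
          field_simp
          ring
        have h8 : (0 : ℝ) ≤ 1 + -(1 / y) := by
          have : 1 / y ≤ 1 := by
            rw [div_le_one hy0]
            linarith
          linarith
        have h9 : C * (y - 1) ^ β ≤ C * ((⌊y⌋₊ : ℕ) : ℝ) ^ β := by
          have : 0 ≤ y - 1 := by linarith
          gcongr
        have h10 : C * (y - 1) ^ β = i * (1 + -(1 / y)) ^ β := by
          rw [h7, Real.mul_rpow hy0.le h8, ← mul_assoc, hyβ]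
        have h11 : (i : ℝ) * (1 + β * (-(1 / y))) ≤ i * (1 + -(1 / y)) ^ β := by gcongr
        have h12 := Nat.lt_floor_add_one (C * ((⌊y⌋₊ : ℕ) : ℝ) ^ β)
        rw [ham]
        have h13 : (i : ℝ) * (1 + β * (-(1 / y))) = i - β * ((i : ℝ) / y) := by ring
        linarith
      have h14 : (batchSeq C α ⌊y⌋₊ : ℝ) ≤ batchStart (batchSeq C α) i := by
        exact_mod_cast le_batchStart (by omega) hle
      rw [batchLength_cast hi]
      linarith
  have h1 : (1 : ℝ) ≤ (i : ℝ) ^ ((1 + α) / 2) := Real.one_le_rpow hi' (by linarith)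
  rw [hiy] at key
  nlinarith

/-- The length of a batch is o(i), so t_i is eventually at least about i/2; the remaining finitely
many i are absorbed into the constant. -/
theorem exists_le_batchStart (hα : 0 < α) (hα' : α < 1) (hC : 0 < C) : ∃ c : ℝ, 1 ≤ c ∧
    ∀ i : ℕ, 1 ≤ i → (i : ℝ) ≤ c * batchStart (batchSeq C α) i := by
  obtain ⟨c, hc, hl⟩ := exists_batchLength_le hα hα' hC
  have hlim : Tendsto (fun i : ℕ => (i : ℝ) ^ (-((1 - α) / 2))) atTop (𝓝 0) :=
    (tendsto_rpow_neg_atTop (by linarith)).comp tendsto_natCast_atTop_atTop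
  obtain ⟨i₀, h₀⟩ := eventually_atTop.1
    (hlim.eventually (ge_mem_nhds (by positivity : (0 : ℝ) < 1 / (2 * c))))
  refine ⟨max 2 i₀, by simp, fun i hi => ?_⟩
  have ht : (1 : ℝ) ≤ batchStart (batchSeq C α) i := by exact_mod_cast one_le_batchStart hi
  have hi0 : (0 : ℝ) < i := by exact_mod_cast hi
  rcases le_total i₀ i with h | h
  · have h1 := hl i hi
    have h2 := h₀ i h
    have h3 : (i : ℝ) ^ ((1 + α) / 2) = i * (i : ℝ) ^ (-((1 - α) / 2)) := by
      rw [← Real.rpow_one_add' hi0.le (by linarith)]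
      congr 1
      ring
    have h4 : c * (i : ℝ) ^ ((1 + α) / 2) ≤ i / 2 := by
      rw [h3]
      calc c * (i * (i : ℝ) ^ (-((1 - α) / 2))) ≤ c * (i * (1 / (2 * c))) := by gcongr
        _ = i / 2 := by field_simp
    rw [batchLength_cast hi] at h1
    calc (i : ℝ) ≤ 2 * batchStart (batchSeq C α) i := by linarith
      _ ≤ max 2 (i₀ : ℝ) * batchStart (batchSeq C α) i := by
        gcongr
        exact le_max_left _ _
  · calc (i : ℝ) ≤ i₀ * 1 := by
          rw [mul_one]
          exact_mod_cast h
      _ ≤ max 2 (i₀ : ℝ) * batchStart (batchSeq C α) i := by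
        gcongr
        exact le_max_right _ _

/-- Every start is some a_m ≤ n, which for m ≥ 2 forces C m^{2/(1-α)} < n + 1 and thus bounds the
number of admissible m. -/
theorem card_batchStart_le (hα' : α < 1) (hC : 0 < C) (n : ℕ) :
    (((Finset.Icc 1 n).image (batchStart (batchSeq C α))).card : ℝ)
      ≤ 1 + (((n : ℝ) + 1) / C) ^ ((1 - α) / 2) := by
  set γ := (1 - α) / 2 with hγ
  set β := 2 / (1 - α) with hβ
  have hγ0 : 0 < γ := by rw [hγ]; linarith
  have hα1 : 0 < 1 - α := by linarith
  have hβγ : β * γ = 1 := by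
    rw [hγ, hβ]
    field_simp
  set M : ℝ := 1 + (((n : ℝ) + 1) / C) ^ γ with hM
  have hM1 : 1 ≤ M := by
    have : 0 ≤ (((n : ℝ) + 1) / C) ^ γ := by positivity
    linarith
  have hsub : (Finset.Icc 1 n).image (batchStart (batchSeq C α))
      ⊆ (Finset.Icc 1 ⌊M⌋₊).image (batchSeq C α) := by
    intro t ht
    obtain ⟨i, hi, rfl⟩ := Finset.mem_image.1 ht
    obtain ⟨hi1, hin⟩ := Finset.mem_Icc.1 hi
    obtain ⟨m, hm, hmt, hle⟩ := batchStart_mem (C := C) (α := α) hi1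
    refine Finset.mem_image.2 ⟨m, Finset.mem_Icc.2 ⟨hm, Nat.le_floor ?_⟩, hmt⟩
    rcases Nat.lt_or_ge 1 m with h1 | h1
    · rw [← hmt, batchSeq, if_neg (by omega)] at hle
      have h2 : C * (m : ℝ) ^ β < n + 1 := by
        calc C * (m : ℝ) ^ β < ⌊C * (m : ℝ) ^ β⌋₊ + 1 := Nat.lt_floor_add_one _
          _ ≤ n + 1 := by
            gcongr
            exact_mod_cast hle.trans hin
      have h3 : (m : ℝ) ^ β ≤ ((n : ℝ) + 1) / C := by
        rw [le_div_iff₀ hC]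
        linarith
      have h4 : (m : ℝ) ≤ (((n : ℝ) + 1) / C) ^ γ := by
        calc (m : ℝ) = ((m : ℝ) ^ β) ^ γ := by
              rw [← Real.rpow_mul (by positivity), hβγ, Real.rpow_one]
          _ ≤ _ := by gcongr
      linarith
    · have : (m : ℝ) ≤ 1 := by exact_mod_cast h1
      linarith
  calc (((Finset.Icc 1 n).image (batchStart (batchSeq C α))).card : ℝ)
      ≤ ((Finset.Icc 1 ⌊M⌋₊).image (batchSeq C α)).card := by
        exact_mod_cast Finset.card_le_card hsub
    _ ≤ (⌊M⌋₊ : ℝ) := by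
        have := Finset.card_image_le (s := Finset.Icc 1 ⌊M⌋₊) (f := batchSeq C α)
        rw [Nat.card_Icc, Nat.add_sub_cancel] at this
        exact_mod_cast this
    _ ≤ M := Nat.floor_le (by linarith)

/-- The total length of the batches grows at least like `n ^ ((3 + α) / 2)`. -/
theorem exists_le_sum_batchLength (hα' : α < 1) (hC : 0 < C) : ∃ c : ℝ, 0 < c ∧
    ∀ n : ℕ, 1 ≤ n → c * (n : ℝ) ^ ((3 + α) / 2)
      ≤ ∑ i ∈ Finset.Icc 1 n, (batchLength (batchSeq C α) i : ℝ) := by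
  set γ := (1 - α) / 2 with hγ
  have hγ0 : 0 < γ := by rw [hγ]; linarith
  set D : ℝ := 1 + (2 / C) ^ γ with hD
  have hD0 : 0 < D := by positivity
  refine ⟨1 / (4 * D), by positivity, fun n hn => ?_⟩
  have hn1 : (1 : ℝ) ≤ n := by exact_mod_cast hn
  have hn0 : (0 : ℝ) < n := by linarith
  set M : ℝ := D * (n : ℝ) ^ γ with hM
  have hM0 : 0 < M := by positivity
  have hcard : (((Finset.Icc 1 n).image (batchStart (batchSeq C α))).card : ℝ) ≤ M := by
    refine (card_batchStart_le hα' hC n).trans ?_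
    have h1 : (((n : ℝ) + 1) / C) ^ γ ≤ (2 / C) ^ γ * (n : ℝ) ^ γ := by
      rw [← Real.mul_rpow (by positivity) hn0.le]
      gcongr
      rw [div_mul_eq_mul_div]
      gcongr
      linarith
    have h2 : (1 : ℝ) ≤ (n : ℝ) ^ γ := Real.one_le_rpow hn1 hγ0.le
    rw [hM, hD]
    linarith
  -- The threshold is chosen so that at most Mx = n/2 indices have length at most x: there are at
  -- most M starts, and start and length determine the index. The other n/2 indices have length
  -- above x, and nx/2 is the asserted lower bound.
  set x : ℝ := n / (2 * M) with hx
  have hx0 : 0 < x := by positivity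
  set S := {i ∈ Finset.Icc 1 n | batchLength (batchSeq C α) i ≤ ⌊x⌋₊} with hS
  have hScard : (S.card : ℝ) ≤ n / 2 := by
    have h1 : S.card ≤ (((Finset.Icc 1 n).image (batchStart (batchSeq C α)))
        ×ˢ Finset.Icc 1 ⌊x⌋₊).card := by
      refine Finset.card_le_card_of_injOn
        (fun i => (batchStart (batchSeq C α) i, batchLength (batchSeq C α) i)) ?_ ?_
      · intro i hi
        have hi' := Finset.mem_filter.1 (Finset.mem_coe.1 hi)
        exact Finset.mem_coe.2 (Finset.mem_product.2 ⟨Finset.mem_image_of_mem _ hi'.1,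
          Finset.mem_Icc.2 ⟨one_le_batchLength _ _, hi'.2⟩⟩)
      · intro i hi j hj hij
        have hi' := Finset.mem_filter.1 (Finset.mem_coe.1 hi)
        have hj' := Finset.mem_filter.1 (Finset.mem_coe.1 hj)
        exact eq_of_batchStart_eq (Finset.mem_Icc.1 hi'.1).1 (Finset.mem_Icc.1 hj'.1).1
          (Prod.ext_iff.1 hij).1 (Prod.ext_iff.1 hij).2
    rw [Finset.card_product, Nat.card_Icc, Nat.add_sub_cancel] at h1
    calc (S.card : ℝ)
        ≤ ((Finset.Icc 1 n).image (batchStart (batchSeq C α))).card * (⌊x⌋₊ : ℝ) := by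
          exact_mod_cast h1
      _ ≤ M * x := by
          gcongr
          exact Nat.floor_le hx0.le
      _ = n / 2 := by
          rw [hx]
          field_simp
  have hsplit : (S.card : ℝ) + ((Finset.Icc 1 n).filter
      (fun i => ¬ batchLength (batchSeq C α) i ≤ ⌊x⌋₊)).card = n := by
    have := Finset.card_filter_add_card_filter_not (s := Finset.Icc 1 n)
      (fun i => batchLength (batchSeq C α) i ≤ ⌊x⌋₊)
    rw [Nat.card_Icc, Nat.add_sub_cancel] at this
    exact_mod_cast this
  calc 1 / (4 * D) * (n : ℝ) ^ ((3 + α) / 2) = n / 2 * x := by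
        have h1 : (n : ℝ) ^ ((3 + α) / 2) * (n : ℝ) ^ γ = n * n := by
          rw [← Real.rpow_add hn0, show (3 + α) / 2 + γ = (2 : ℕ) by rw [hγ]; push_cast; ring,
            Real.rpow_natCast]
          ring
        rw [hx, hM]
        field_simp
        linarith
    _ ≤ ((Finset.Icc 1 n).filter
          (fun i => ¬ batchLength (batchSeq C α) i ≤ ⌊x⌋₊)).card * x := by
        gcongr
        linarith
    _ = ∑ i ∈ (Finset.Icc 1 n).filter
          (fun i => ¬ batchLength (batchSeq C α) i ≤ ⌊x⌋₊), x := by simp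
    _ ≤ ∑ i ∈ (Finset.Icc 1 n).filter
          (fun i => ¬ batchLength (batchSeq C α) i ≤ ⌊x⌋₊),
          (batchLength (batchSeq C α) i : ℝ) := by
        refine Finset.sum_le_sum fun i hi => ?_
        have := (Finset.mem_filter.1 hi).2
        exact (Nat.lt_of_floor_lt (not_le.1 this)).le
    _ ≤ ∑ i ∈ Finset.Icc 1 n, (batchLength (batchSeq C α) i : ℝ) :=
        Finset.sum_le_sum_of_subset_of_nonneg (Finset.filter_subset _ _)
          fun _ _ _ => by positivity

/-- Indices of one batch have distinct lengths, so a batch has at most N of them; each row of the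
double sum has at most N terms of size N². -/
theorem sum_batch_mul_le {N : ℝ} (hN : ∀ i ∈ Finset.Icc 1 n,
      (batchLength (batchSeq C α) i : ℝ) ≤ N) :
    ∑ i ∈ Finset.Icc 1 n, ∑ j ∈ Finset.Icc 1 n with
        batchStart (batchSeq C α) j = batchStart (batchSeq C α) i,
      (batchLength (batchSeq C α) i : ℝ) * (batchLength (batchSeq C α) j : ℝ) ≤ n * N ^ 3 := by
  have hrow : ∀ i ∈ Finset.Icc 1 n, ∑ j ∈ Finset.Icc 1 n with
        batchStart (batchSeq C α) j = batchStart (batchSeq C α) i,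
      (batchLength (batchSeq C α) i : ℝ) * (batchLength (batchSeq C α) j : ℝ) ≤ N ^ 3 := by
    intro i hi
    have hN0 : 0 ≤ N := le_trans (by positivity) (hN i hi)
    have hcard : (({j ∈ Finset.Icc 1 n |
        batchStart (batchSeq C α) j = batchStart (batchSeq C α) i}).card : ℝ) ≤ N := by
      have h1 : ({j ∈ Finset.Icc 1 n |
          batchStart (batchSeq C α) j = batchStart (batchSeq C α) i}).card
          ≤ (Finset.Icc 1 ⌊N⌋₊).card := by
        refine Finset.card_le_card_of_injOn (batchLength (batchSeq C α)) ?_ ?_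
        · intro j hj
          have hj' := Finset.mem_filter.1 (Finset.mem_coe.1 hj)
          exact Finset.mem_coe.2 (Finset.mem_Icc.2 ⟨one_le_batchLength _ _,
            Nat.le_floor (hN j hj'.1)⟩)
        · intro j hj k hk hjk
          have hj' := Finset.mem_filter.1 (Finset.mem_coe.1 hj)
          have hk' := Finset.mem_filter.1 (Finset.mem_coe.1 hk)
          exact eq_of_batchStart_eq (Finset.mem_Icc.1 hj'.1).1 (Finset.mem_Icc.1 hk'.1).1
            (hj'.2.trans hk'.2.symm) hjk
      rw [Nat.card_Icc, Nat.add_sub_cancel] at h1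
      calc _ ≤ (⌊N⌋₊ : ℝ) := by exact_mod_cast h1
        _ ≤ N := Nat.floor_le hN0
    calc _ ≤ ∑ j ∈ Finset.Icc 1 n with
          batchStart (batchSeq C α) j = batchStart (batchSeq C α) i, N * N := by
          refine Finset.sum_le_sum fun j hj => ?_
          have := hN j (Finset.mem_filter.1 hj).1
          have := hN i hi
          gcongr
      _ = ({j ∈ Finset.Icc 1 n |
          batchStart (batchSeq C α) j = batchStart (batchSeq C α) i}).card * (N * N) := by simp
      _ ≤ N * (N * N) := by gcongr
      _ = N ^ 3 := by ring
  calc _ ≤ ∑ i ∈ Finset.Icc 1 n, N ^ 3 := Finset.sum_le_sum hrow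
    _ = n * N ^ 3 := by simp

end Batches

/-! ### Elementary properties of the decay rate. -/

section Rates

theorem rate_sq_half (α : ℝ) (n : ℕ) : rate (α / 2) n ^ 2 = rate α n := by
  rw [sq, rate, rate, ← Real.rpow_add (by positivity)]
  congr 1
  ring

theorem rate_neg (α : ℝ) (n : ℕ) : rate (-α) n = (rate α n)⁻¹ := by
  rw [rate, rate, ← Real.rpow_neg (by positivity)]

theorem rate_le_one {α : ℝ} (hα : 0 ≤ α) (n : ℕ) : rate α n ≤ 1 :=
  Real.rpow_le_one_of_one_le_of_nonpos (by linarith [n.cast_nonneg (α := ℝ)]) (by linarith)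

theorem rate_anti {α : ℝ} (hα : 0 ≤ α) {m n : ℕ} (h : m ≤ n) : rate α n ≤ rate α m := by
  have : (m : ℝ) ≤ n := by exact_mod_cast h
  exact Real.rpow_le_rpow_of_nonpos (by positivity) (by linarith) (by linarith)

theorem rate_neg_mono {α : ℝ} (hα : 0 ≤ α) {m n : ℕ} (h : m ≤ n) : rate (-α) m ≤ rate (-α) n := by
  have : (m : ℝ) ≤ n := by exact_mod_cast h
  exact Real.rpow_le_rpow (by positivity) (by linarith) (by linarith)

end Rates

/-- Summation by parts. -/
theorem sum_smul_sub_succ {E : Type*} [AddCommGroup E] [Module ℝ E] (W : ℕ → ℝ) (x : ℕ → E)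
    {s i : ℕ} (h : s ≤ i) :
    ∑ k ∈ Finset.Ico s i, W k • (x k - x (k + 1))
      = W s • x s - W i • x i + ∑ k ∈ Finset.Ico s i, (W (k + 1) - W k) • x (k + 1) := by
  induction i, h using Nat.le_induction with
  | base => simp
  | succ i h ih =>
    rw [Finset.sum_Ico_succ_top h, Finset.sum_Ico_succ_top h, ih, smul_sub, sub_smul]
    abel

theorem continuous_rankOne_self (E : Type*) [NormedAddCommGroup E] [InnerProductSpace ℝ E] :
    Continuous fun u : E => InnerProductSpace.rankOne ℝ u u := by
  have h := (InnerProductSpace.rankOne (E := E) (F := E) ℝ).continuous₂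
  exact h.comp (continuous_id.prodMk continuous_id)

/-! ### Linearization of the recursion and the noise as martingale differences. -/

section Linearization

variable {d : ℕ} {Ω Ξ : Type*} [m0 : MeasurableSpace Ω] [MeasurableSpace Ξ]
  {P : Measure Ω} [IsProbabilityMeasure P] {Pi : Measure Ξ} [IsProbabilityMeasure Pi]
  {f : Vec d → Ξ → ℝ} {ξ : ℕ → Ω → Ξ} {x₀ xstar : Vec d} {η α : ℝ}

/-- The sum of the gradient noise over a window. -/
def noiseSum (f : Vec d → Ξ → ℝ) (Pi : Measure Ξ) (η α : ℝ) (x₀ : Vec d) (ξ : ℕ → Ω → Ξ)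
    (s i : ℕ) (ω : Ω) : Vec d := ∑ k ∈ Finset.Ico s i, gradNoise f Pi η α x₀ ξ (k + 1) ω

/-- The Taylor remainder of the gradient of the objective at the `n`-th iterate. -/
def taylorRem (f : Vec d → Ξ → ℝ) (Pi : Measure Ξ) (η α : ℝ) (x₀ xstar : Vec d)
    (ξ : ℕ → Ω → Ξ) (n : ℕ) (ω : Ω) : Vec d :=
  ∇ (objective f Pi) (sgd f η α x₀ (fun i => ξ i ω) n)
    - hessian (objective f Pi) xstar (iterErr f η α x₀ xstar ξ n ω)

/-- The SGD recursion solved for the linear part of the gradient; the factor η⁻¹ (n+1)^α is the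
reciprocal of the step size. -/
theorem hessian_iterErr (hη : 0 < η) (n : ℕ) (ω : Ω) :
    hessian (objective f Pi) xstar (iterErr f η α x₀ xstar ξ n ω)
      = gradNoise f Pi η α x₀ ξ (n + 1) ω - taylorRem f Pi η α x₀ xstar ξ n ω
        + (η⁻¹ * rate (-α) n) • (iterErr f η α x₀ xstar ξ n ω
          - iterErr f η α x₀ xstar ξ (n + 1) ω) := by
  have h1 : η⁻¹ * rate (-α) n = (stepSize η α (n + 1))⁻¹ := by
    rw [stepSize_succ, rate_neg, mul_inv]
  have h2 := (stepSize_pos (α := α) hη n).ne'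
  rw [iterErr_succ (Pi := Pi), h1, taylorRem, smul_sub, smul_add, smul_sub, smul_smul, smul_smul,
    inv_mul_cancel₀ h2, one_smul, one_smul]
  abel

/-- The noise of index k + 1 is paired with the error of index k, so the sum of errors is first
shifted by one index; this produces the last boundary term. Summation by parts then handles the
increments of the iterates. -/
theorem sum_iterErr_succ_eq (hη : 0 < η) (hF : RegularObjective (objective f Pi) xstar) {s i : ℕ}
    (h : s ≤ i) (ω : Ω) :
    ∑ k ∈ Finset.Ico s i, iterErr f η α x₀ xstar ξ (k + 1) ω
        - (hessian (objective f Pi) xstar).inverse (noiseSum f Pi η α x₀ ξ s i ω)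
      = (hessian (objective f Pi) xstar).inverse
          ((η⁻¹ * rate (-α) s) • iterErr f η α x₀ xstar ξ s ω
            - (η⁻¹ * rate (-α) i) • iterErr f η α x₀ xstar ξ i ω
            + ∑ k ∈ Finset.Ico s i, (η⁻¹ * rate (-α) (k + 1) - η⁻¹ * rate (-α) k) •
                iterErr f η α x₀ xstar ξ (k + 1) ω
            - ∑ k ∈ Finset.Ico s i, taylorRem f Pi η α x₀ xstar ξ k ω)
        + (iterErr f η α x₀ xstar ξ i ω - iterErr f η α x₀ xstar ξ s ω) := by
  have h1 : ∑ k ∈ Finset.Ico s i, iterErr f η α x₀ xstar ξ (k + 1) ω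
      = ∑ k ∈ Finset.Ico s i, iterErr f η α x₀ xstar ξ k ω
        + (iterErr f η α x₀ xstar ξ i ω - iterErr f η α x₀ xstar ξ s ω) := by
    rw [← Finset.sum_Ico_sub (fun k => iterErr f η α x₀ xstar ξ k ω) h, ← Finset.sum_add_distrib]
    exact Finset.sum_congr rfl fun k _ => by abel
  have h2 : ∑ k ∈ Finset.Ico s i, iterErr f η α x₀ xstar ξ k ω
      = (hessian (objective f Pi) xstar).inverse (∑ k ∈ Finset.Ico s i,
        hessian (objective f Pi) xstar (iterErr f η α x₀ xstar ξ k ω)) := by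
    rw [← map_sum, hF.hessian_inverse]
  rw [h1, h2, ← sum_smul_sub_succ (fun k => η⁻¹ * rate (-α) k)
    (fun k => iterErr f η α x₀ xstar ξ k ω) h, add_sub_right_comm, ← map_sub, noiseSum]
  congr 2
  simp only [hessian_iterErr hη, Finset.sum_add_distrib, Finset.sum_sub_distrib]
  abel

/-- The sum of the iterate errors over a window is the sum of the noise, transformed by the inverse
Hessian, up to an error of smaller order. -/
theorem exists_rms_linearization (hη : 0 < η) (hα : 0 < α) (hα' : α < 1)
    (hξ : IsIIDSample ξ Pi P) (hF : RegularObjective (objective f Pi) xstar)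
    (hf : RegularLoss f Pi xstar) (hε : NoiseMoments f Pi xstar η α x₀ ξ P) :
    ∃ K : ℝ, 1 ≤ K ∧ ∀ s i, s ≤ i →
      RMSLE P (fun ω => ∑ k ∈ Finset.Ico s i, iterErr f η α x₀ xstar ξ (k + 1) ω
        - (hessian (objective f Pi) xstar).inverse (noiseSum f Pi η α x₀ ξ s i ω))
        (K * (rate (-(α / 2)) i + ∑ k ∈ Finset.Ico s i, rate α k)) := by
  obtain ⟨K, hK1, hK⟩ := exists_rms_iterErr hη hα hα' hξ hF hf hε
  obtain ⟨R, hR0, hR⟩ := hF.exists_remainder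
  set T := (hessian (objective f Pi) xstar).inverse with hT
  have hK0 : 0 < K := by linarith
  have hη' : 0 < η⁻¹ := inv_pos.2 hη
  have hg0 : ∀ k, 0 < rate (-(α / 2)) k := rate_pos _
  have hgg : ∀ k, rate (-α) k = rate (-(α / 2)) k ^ 2 := fun k => by
    rw [show -(α / 2) = -α / 2 by ring, rate_sq_half]
  have hgi : ∀ k, rate (α / 2) k = (rate (-(α / 2)) k)⁻¹ := fun k => by
    rw [rate_neg, inv_inv]
  have hrem : ∀ k, RMSLE P (taylorRem f Pi η α x₀ xstar ξ k) (R * (K * rate α k)) := by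
    intro k
    have hm1 : Measurable fun ω => sgd f η α x₀ (fun i => ξ i ω) k :=
      (hf.measurable_sgd k).mono (hξ.past_le _) le_rfl
    have hm2 : Measurable (iterErr f η α x₀ xstar ξ k) := hm1.sub_const _
    have hm3 : Measurable (taylorRem f Pi η α x₀ xstar ξ k) :=
      ((continuous_gradient hF.contDiff).measurable.comp hm1).sub
        ((hessian (objective f Pi) xstar).continuous.measurable.comp hm2)
    refine (hK k).2.of_norm_le hR0 hm3.aestronglyMeasurable (ae_of_all _ fun ω => ?_)
    rw [norm_pow, norm_norm]
    exact hR _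
  have hend : ∀ k, RMSLE P (fun ω => (η⁻¹ * rate (-α) k) • iterErr f η α x₀ xstar ξ k ω)
      (η⁻¹ * K * rate (-(α / 2)) k) := by
    intro k
    refine ((hK k).1.const_smul _).mono (le_of_eq ?_)
    rw [abs_of_pos (mul_pos hη' (rate_pos _ _)), hgg, hgi]
    have := (hg0 k).ne'
    field_simp
  refine ⟨‖T‖ * (4 * η⁻¹ * K + R * K) + 2 * K, ?_, fun s i h => ?_⟩
  · have : 0 ≤ ‖T‖ * (4 * η⁻¹ * K + R * K) := by positivity
    linarith
  -- With g_k = (k+1)^{α/2}, the weights are η⁻¹ g_k² and δ_{k+1} has L² size K/g_{k+1}. As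
  -- (g_{k+1}² - g_k²)/g_{k+1} ≤ 2(g_{k+1} - g_k), the sum telescopes.
  have hmid : RMSLE P (fun ω => ∑ k ∈ Finset.Ico s i,
      (η⁻¹ * rate (-α) (k + 1) - η⁻¹ * rate (-α) k) • iterErr f η α x₀ xstar ξ (k + 1) ω)
      (2 * η⁻¹ * K * rate (-(α / 2)) i) := by
    refine (RMSLE.sum (Finset.Ico s i) (s := fun k => 2 * η⁻¹ * K *
      (rate (-(α / 2)) (k + 1) - rate (-(α / 2)) k)) fun k _ => ?_).mono ?_
    · refine ((hK (k + 1)).1.const_smul _).mono ?_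
      have h1 : rate (-(α / 2)) k ≤ rate (-(α / 2)) (k + 1) :=
        rate_neg_mono (by linarith) k.le_succ
      have h2 := hg0 k
      have h3 := hg0 (k + 1)
      rw [← mul_sub, hgg, hgg, hgi, abs_of_nonneg
        (mul_nonneg hη'.le (sub_nonneg.2 (pow_le_pow_left₀ h2.le h1 2)))]
      have h4 : (rate (-(α / 2)) (k + 1) ^ 2 - rate (-(α / 2)) k ^ 2)
          * (rate (-(α / 2)) (k + 1))⁻¹ ≤ 2 * (rate (-(α / 2)) (k + 1) - rate (-(α / 2)) k) := by
        rw [← div_eq_mul_inv, div_le_iff₀ h3]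
        nlinarith
      calc _ = η⁻¹ * K * ((rate (-(α / 2)) (k + 1) ^ 2 - rate (-(α / 2)) k ^ 2)
            * (rate (-(α / 2)) (k + 1))⁻¹) := by ring
        _ ≤ η⁻¹ * K * (2 * (rate (-(α / 2)) (k + 1) - rate (-(α / 2)) k)) := by gcongr
        _ = _ := by ring
    · rw [← Finset.mul_sum, Finset.sum_Ico_sub _ h]
      have := hg0 s
      gcongr
      linarith
  have hδ1 : ∀ k, RMSLE P (iterErr f η α x₀ xstar ξ k) K := fun k =>
    (hK k).1.mono (by
      have := rate_le_one (by linarith : 0 ≤ α / 2) k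
      nlinarith)
  have hg1 : 1 ≤ rate (-(α / 2)) i := by
    rw [rate_neg]
    exact (one_le_inv₀ (rate_pos _ _)).2 (rate_le_one (by linarith) i)
  have hgs : rate (-(α / 2)) s ≤ rate (-(α / 2)) i := rate_neg_mono (by linarith) h
  have hsum0 : 0 ≤ ∑ k ∈ Finset.Ico s i, rate α k :=
    Finset.sum_nonneg fun k _ => (rate_pos _ _).le
  have htot := (((((hend s).sub (hend i)).add hmid).sub
    (RMSLE.sum (Finset.Ico s i) fun k _ => hrem k)).clm T).add ((hδ1 i).sub (hδ1 s))
  simp only [hT, sum_iterErr_succ_eq hη hF h]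
  refine htot.mono ?_
  rw [← Finset.mul_sum, ← Finset.mul_sum]
  calc ‖T‖ * (η⁻¹ * K * rate (-(α / 2)) s + η⁻¹ * K * rate (-(α / 2)) i
        + 2 * η⁻¹ * K * rate (-(α / 2)) i + R * (K * ∑ k ∈ Finset.Ico s i, rate α k)) + (K + K)
      ≤ ‖T‖ * (η⁻¹ * K * rate (-(α / 2)) i + η⁻¹ * K * rate (-(α / 2)) i
        + 2 * η⁻¹ * K * rate (-(α / 2)) i + R * (K * ∑ k ∈ Finset.Ico s i, rate α k))
        + (K * rate (-(α / 2)) i + K * rate (-(α / 2)) i) := by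
        gcongr <;> nlinarith
    _ = (‖T‖ * (4 * η⁻¹ * K) + 2 * K) * rate (-(α / 2)) i
        + ‖T‖ * (R * K) * ∑ k ∈ Finset.Ico s i, rate α k := by ring
    _ ≤ (‖T‖ * (4 * η⁻¹ * K + R * K) + 2 * K) * rate (-(α / 2)) i
        + (‖T‖ * (4 * η⁻¹ * K + R * K) + 2 * K) * ∑ k ∈ Finset.Ico s i, rate α k := by
        gcongr
        · have : 0 ≤ R * K := by positivity
          linarith
        · have : 0 ≤ ‖T‖ * (4 * η⁻¹ * K) := by positivity
          nlinarith
    _ = _ := by ring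

/-- The projections of the gradient noise are martingale differences. -/
theorem exists_martDiff (hη : 0 < η) (hα : 0 < α) (hα' : α < 1)
    (hξ : IsIIDSample ξ Pi P) (hF : RegularObjective (objective f Pi) xstar)
    (hf : RegularLoss f Pi xstar) (hε : NoiseMoments f Pi xstar η α x₀ ξ P) :
    ∃ M : ℝ, 1 ≤ M ∧ ∀ (B : ℝ) (a : Vec d), ‖a‖ ≤ B →
      MartDiff P hξ.filtration (B ^ 4 * M)
        (fun k ω => inner ℝ a (gradNoise f Pi η α x₀ ξ (k + 1) ω)) := by
  obtain ⟨C, hC0, hC⟩ := exists_gradNoise_fourth hξ hF hf hε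
  obtain ⟨K, hK0, hK⟩ := exists_fourth_moment_le hη hα hα' hξ hF hf hε
  -- The fourth moments of the errors are at most K, hence those of the noise at most C(1 + K). The
  -- added 1 gives M ≥ 1, which the window bounds assume.
  refine ⟨C * (1 + K) + 1, ?_, fun B a ha => ⟨fun k => ?_, fun k => ?_, fun k => ?_, fun k => ?_⟩⟩
  · have : 0 ≤ C * (1 + K) := by positivity
    linarith
  · exact stronglyMeasurable_const.inner (hf.measurable_gradNoise hF.contDiff k).stronglyMeasurable
  · exact memLp_inner_gradNoise hξ hF hf hε k a
  · exact condExp_inner_gradNoise hξ hF hf hε k a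
  · have he := memLp_gradNoise hξ hF hf hε k
    calc ∫ ω, (inner ℝ a (gradNoise f Pi η α x₀ ξ (k + 1) ω) : ℝ) ^ 4 ∂P
        ≤ ∫ ω, B ^ 4 * ‖gradNoise f Pi η α x₀ ξ (k + 1) ω‖ ^ 4 ∂P := by
          refine integral_mono_of_nonneg (ae_of_all _ fun ω => by positivity)
            ((integrable_norm_pow_four he).const_mul _) (ae_of_all _ fun ω => ?_)
          simp only
          rw [← mul_pow, ← Even.pow_abs (show Even 4 by decide)]
          refine pow_le_pow_left₀ (abs_nonneg _) ((abs_real_inner_le_norm _ _).trans ?_) 4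
          gcongr
      _ = B ^ 4 * ∫ ω, ‖gradNoise f Pi η α x₀ ξ (k + 1) ω‖ ^ 4 ∂P := integral_const_mul _ _
      _ ≤ B ^ 4 * (C * (1 + K) + 1) := by
          gcongr
          refine (hC k).trans ?_
          have h1 : ∫ ω, ‖iterErr f η α x₀ xstar ξ k ω‖ ^ 4 ∂P ≤ K := by
            refine (hK k).trans ?_
            have h2 := rate_le_one hα.le k
            have h3 := rate_pos α k
            have : rate α k ^ 2 ≤ 1 := by nlinarith
            nlinarith
          have : C * (1 + ∫ ω, ‖iterErr f η α x₀ xstar ξ k ω‖ ^ 4 ∂P) ≤ C * (1 + K) := by gcongr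
          linarith

theorem winSum_inner (a : Vec d) (s i : ℕ) :
    winSum (fun k (ω : Ω) => inner ℝ a (gradNoise f Pi η α x₀ ξ (k + 1) ω)) s i
      = fun ω => inner ℝ a (noiseSum f Pi η α x₀ ξ s i ω) := by
  ext ω
  rw [winSum, noiseSum, inner_sum]

theorem inner_outer_apply (a b u : Vec d) :
    inner ℝ a (outer u b) = (inner ℝ a u : ℝ) * inner ℝ b u := by
  rw [outer, InnerProductSpace.rankOne_apply, inner_smul_right, real_inner_comm, mul_comm]

theorem norm_outer (u : Vec d) : ‖outer u‖ = ‖u‖ ^ 2 := by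
  rw [outer, InnerProductSpace.norm_rankOne, sq]

theorem continuous_outer : Continuous (outer : Vec d → Vec d →L[ℝ] Vec d) :=
  continuous_rankOne_self (Vec d)

theorem integrable_outer {X : Ω → Vec d} (hX : MemLp X 2 P) :
    Integrable (fun ω => outer (X ω)) P := by
  refine (hX.integrable_norm_pow (p := 2) (by norm_num)).mono'
    (continuous_outer.comp_aestronglyMeasurable hX.1) (ae_of_all _ fun ω => ?_)
  rw [norm_outer]

/-- The conditional covariances of the noise approach the covariance at the minimizer. -/
theorem exists_rms_condCov_sub (hη : 0 < η) (hα : 0 < α) (hα' : α < 1)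
    (hξ : IsIIDSample ξ Pi P) (hF : RegularObjective (objective f Pi) xstar)
    (hf : RegularLoss f Pi xstar) (hε : NoiseMoments f Pi xstar η α x₀ ξ P) (a b : Vec d) :
    ∃ K : ℝ, 0 ≤ K ∧ ∀ k, RMSLE P (fun ω => MartDiff.condCov P hξ.filtration
        (fun k ω => inner ℝ a (gradNoise f Pi η α x₀ ξ (k + 1) ω))
        (fun k ω => inner ℝ b (gradNoise f Pi η α x₀ ξ (k + 1) ω)) k ω
      - inner ℝ a (gradCov f Pi xstar b)) (K * rate (α / 2) k) := by
  obtain ⟨K, hK1, hK⟩ := exists_rms_iterErr hη hα hα' hξ hF hf hε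
  obtain ⟨C, hC⟩ := hε.covariance
  refine ⟨‖a‖ * ‖b‖ * |C| * (K + K), by positivity, fun k => ?_⟩
  have he : MemLp (gradNoise f Pi η α x₀ ξ (k + 1)) 2 P :=
    (memLp_gradNoise hξ hF hf hε k).mono_exponent (by norm_num)
  -- A matrix entry is a continuous linear functional and commutes with conditional expectation, so
  -- the operator-valued covariance assumption passes to the scalar projections.
  let T : (Vec d →L[ℝ] Vec d) →L[ℝ] ℝ := (innerSL ℝ a).comp (ContinuousLinearMap.apply ℝ (Vec d) b)
  have hT : ∀ M : Vec d →L[ℝ] Vec d, T M = inner ℝ a (M b) := fun M => rfl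
  have h1 := ContinuousLinearMap.comp_condExp_comm (m := past ξ k) (integrable_outer he) T
  have hX : RMSLE P (fun ω => ‖iterErr f η α x₀ xstar ξ k ω‖
      + ‖iterErr f η α x₀ xstar ξ k ω‖ ^ 2) ((K + K) * rate (α / 2) k) := by
    have h2 : RMSLE P (fun ω => ‖iterErr f η α x₀ xstar ξ k ω‖) (K * rate (α / 2) k) := by
      simpa using (hK k).1.of_norm_le (Y := fun ω => ‖iterErr f η α x₀ xstar ξ k ω‖) (c := 1)
        zero_le_one (hK k).1.memLp.1.norm (ae_of_all _ fun ω => by simp)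
    refine (h2.add (hK k).2).mono ?_
    rw [add_mul]
    gcongr
    rw [← rate_sq_half]
    have h3 := rate_le_one (by linarith : 0 ≤ α / 2) k
    have h4 := rate_pos (α / 2) k
    nlinarith
  have hm : AEStronglyMeasurable (fun ω => MartDiff.condCov P hξ.filtration
        (fun k ω => inner ℝ a (gradNoise f Pi η α x₀ ξ (k + 1) ω))
        (fun k ω => inner ℝ b (gradNoise f Pi η α x₀ ξ (k + 1) ω)) k ω
      - inner ℝ a (gradCov f Pi xstar b)) P :=
    integrable_condExp.1.sub aestronglyMeasurable_const
  refine (hX.of_norm_le (by positivity : 0 ≤ ‖a‖ * ‖b‖ * |C|) hm ?_).mono (le_of_eq (by ring))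
  filter_upwards [h1, hC (k + 1) (by omega)] with ω h1 h2
  have h3 : MartDiff.condCov P hξ.filtration
        (fun k ω => inner ℝ a (gradNoise f Pi η α x₀ ξ (k + 1) ω))
        (fun k ω => inner ℝ b (gradNoise f Pi η α x₀ ξ (k + 1) ω)) k ω
      = inner ℝ a ((P[fun ω' => outer (gradNoise f Pi η α x₀ ξ (k + 1) ω') | past ξ k]) ω b) := by
    rw [← hT]
    refine Eq.trans ?_ h1.symm
    rw [MartDiff.condCov]
    congr 2
    ext ω'
    exact (inner_outer_apply _ _ _).symm
  rw [h3, ← inner_sub_right, ← sub_apply]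
  have h4 : 0 ≤ ‖iterErr f η α x₀ xstar ξ k ω‖ + ‖iterErr f η α x₀ xstar ξ k ω‖ ^ 2 := by
    positivity
  rw [Real.norm_of_nonneg h4]
  calc ‖(inner ℝ a (((P[fun ω' => outer (gradNoise f Pi η α x₀ ξ (k + 1) ω') | past ξ k]) ω
        - gradCov f Pi xstar) b) : ℝ)‖
      ≤ ‖a‖ * (‖(P[fun ω' => outer (gradNoise f Pi η α x₀ ξ (k + 1) ω') | past ξ k]) ω
        - gradCov f Pi xstar‖ * ‖b‖) :=
        (norm_inner_le_norm _ _).trans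
          (mul_le_mul_of_nonneg_left (ContinuousLinearMap.le_opNorm _ _) (norm_nonneg _))
    _ ≤ ‖a‖ * ((C * (‖iterErr f η α x₀ xstar ξ k ω‖ + ‖iterErr f η α x₀ xstar ξ k ω‖ ^ 2))
        * ‖b‖) := by
        gcongr
        exact h2
    _ ≤ ‖a‖ * ((|C| * (‖iterErr f η α x₀ xstar ξ k ω‖ + ‖iterErr f η α x₀ xstar ξ k ω‖ ^ 2))
        * ‖b‖) := by
        gcongr
        exact le_abs_self C
    _ = _ := by ring

end Linearization

/-! ### Calculus of L¹ bounds. -/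

section MeanAbs

variable {Ω : Type*} [MeasurableSpace Ω] {P : Measure Ω}

/-- `X` is integrable with mean absolute value at most `s`. -/
structure MeanLE (P : Measure Ω) (X : Ω → ℝ) (s : ℝ) : Prop where
  integrable : Integrable X P
  integral_le : ∫ ω, |X ω| ∂P ≤ s

namespace MeanLE

variable {X Y : Ω → ℝ} {s t : ℝ}

theorem mono (h : MeanLE P X s) (hst : s ≤ t) : MeanLE P X t :=
  ⟨h.integrable, h.integral_le.trans hst⟩

theorem zero : MeanLE P (fun _ : Ω => (0 : ℝ)) 0 := ⟨integrable_zero _ _ _, by simp⟩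

theorem add (hX : MeanLE P X s) (hY : MeanLE P Y t) : MeanLE P (fun ω => X ω + Y ω) (s + t) := by
  refine ⟨hX.integrable.add hY.integrable, ?_⟩
  calc ∫ ω, |X ω + Y ω| ∂P ≤ ∫ ω, (|X ω| + |Y ω|) ∂P :=
        integral_mono (hX.integrable.add hY.integrable).abs
          (hX.integrable.abs.add hY.integrable.abs) fun ω => abs_add_le _ _
    _ = ∫ ω, |X ω| ∂P + ∫ ω, |Y ω| ∂P := integral_add hX.integrable.abs hY.integrable.abs
    _ ≤ s + t := add_le_add hX.integral_le hY.integral_le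

theorem sum {ι : Type*} {X : ι → Ω → ℝ} {s : ι → ℝ} (T : Finset ι)
    (h : ∀ i ∈ T, MeanLE P (X i) (s i)) :
    MeanLE P (fun ω => ∑ i ∈ T, X i ω) (∑ i ∈ T, s i) := by
  classical
  induction T using Finset.induction_on with
  | empty => simpa using zero
  | insert a T ha ih =>
    simp only [Finset.sum_insert ha]
    exact (h a (Finset.mem_insert_self _ _)).add
      (ih fun i hi => h i (Finset.mem_insert_of_mem hi))

end MeanLE

theorem RMSLE.meanLE [IsProbabilityMeasure P] {X : Ω → ℝ} {s : ℝ} (h : RMSLE P X s) :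
    MeanLE P X s := ⟨h.memLp.integrable (by norm_num), h.integral_norm_le⟩

theorem RMSLE.mul {X Y : Ω → ℝ} {s t : ℝ} (hX : RMSLE P X s) (hY : RMSLE P Y t) :
    MeanLE P (fun ω => X ω * Y ω) (s * t) := by
  refine ⟨hX.memLp.integrable_mul hY.memLp, ?_⟩
  simpa only [abs_mul, Real.norm_eq_abs] using hX.integral_norm_mul_le hY

end MeanAbs

/-! ### Sums of rates and the centred batch sums. -/

section Sums

variable {C α : ℝ} {n : ℕ}

/-- For α > 1/2 the accumulated Taylor remainders stay within √n, the order of the noise sum. The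
bound telescopes by comparison with 2√k. -/
theorem sum_rate_le {α : ℝ} (hα : 1 / 2 < α) (n : ℕ) :
    ∑ k ∈ Finset.Ico 0 n, rate α k ≤ 2 * √n := by
  have h1 : ∀ k ∈ Finset.Ico 0 n, rate α k ≤ 2 * √((k + 1 : ℕ) : ℝ) - 2 * √(k : ℝ) := by
    intro k _
    have hk : (0 : ℝ) < (k : ℝ) + 1 := by positivity
    have h2 : rate α k ≤ (√((k : ℝ) + 1))⁻¹ := by
      rw [Real.sqrt_eq_rpow, ← Real.rpow_neg hk.le]
      exact Real.rpow_le_rpow_of_exponent_le (by linarith [k.cast_nonneg (α := ℝ)]) (by linarith)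
    refine h2.trans ?_
    push_cast
    have h3 : 0 < √((k : ℝ) + 1) := Real.sqrt_pos.2 hk
    rw [inv_eq_one_div, div_le_iff₀ h3]
    have h4 := Real.sq_sqrt hk.le
    have h5 := Real.sq_sqrt (k.cast_nonneg (α := ℝ))
    nlinarith [sq_nonneg (√((k : ℝ) + 1) - √(k : ℝ))]
  calc _ ≤ ∑ k ∈ Finset.Ico 0 n, (2 * √((k + 1 : ℕ) : ℝ) - 2 * √(k : ℝ)) := Finset.sum_le_sum h1
    _ = 2 * √n := by
      rw [Finset.sum_Ico_sub (fun k : ℕ => 2 * √(k : ℝ)) n.zero_le]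
      simp

theorem sub_batchStart_pred {i : ℕ} (hi : 1 ≤ i) :
    (i : ℝ) - (batchStart (batchSeq C α) i - 1 : ℕ) = batchLength (batchSeq C α) i := by
  rw [batchLength_cast hi, Nat.cast_sub (one_le_batchStart hi), Nat.cast_one]
  ring

theorem batchStart_pred_le {i : ℕ} (hi : 1 ≤ i) : batchStart (batchSeq C α) i - 1 ≤ i :=
  (Nat.sub_le _ _).trans (batchStart_le hi)

/-- Within a batch all indices are comparable to i, so the sum is of the order of the length l_i
times i^{-θ}. -/
theorem exists_sum_rate_batch_le (hα : 0 < α) (hα' : α < 1) (hC : 0 < C) {θ : ℝ} (hθ : 0 ≤ θ) :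
    ∃ K : ℝ, 0 ≤ K ∧ ∀ i : ℕ, 1 ≤ i →
      ∑ k ∈ Finset.Ico (batchStart (batchSeq C α) i - 1) i, rate θ k
        ≤ K * (i : ℝ) ^ ((1 + α) / 2 - θ) := by
  obtain ⟨c, hc, hl⟩ := exists_batchLength_le hα hα' hC
  obtain ⟨c', hc', ht⟩ := exists_le_batchStart hα hα' hC
  refine ⟨c * c' ^ θ, by positivity, fun i hi => ?_⟩
  have hi0 : (0 : ℝ) < i := by exact_mod_cast hi
  set s := batchStart (batchSeq C α) i - 1 with hs
  have hst : (s : ℝ) + 1 = batchStart (batchSeq C α) i := by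
    rw [hs, Nat.cast_sub (one_le_batchStart hi), Nat.cast_one]
    ring
  have hrate : rate θ s ≤ c' ^ θ * (i : ℝ) ^ (-θ) := by
    have h1 : (i : ℝ) / c' ≤ (s : ℝ) + 1 := by
      rw [hst, div_le_iff₀ (by linarith), mul_comm]
      exact ht i hi
    calc rate θ s ≤ ((i : ℝ) / c') ^ (-θ) :=
          Real.rpow_le_rpow_of_nonpos (by positivity) h1 (by linarith)
      _ = c' ^ θ * (i : ℝ) ^ (-θ) := by
          rw [Real.div_rpow hi0.le (by linarith), Real.rpow_neg (by linarith : 0 ≤ c'), div_inv_eq_mul,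
            mul_comm]
  calc ∑ k ∈ Finset.Ico s i, rate θ k ≤ ∑ k ∈ Finset.Ico s i, rate θ s :=
        Finset.sum_le_sum fun k hk => rate_anti hθ (Finset.mem_Ico.1 hk).1
    _ = batchLength (batchSeq C α) i * rate θ s := by
        rw [Finset.sum_const, Nat.card_Ico, nsmul_eq_mul, Nat.cast_sub (batchStart_pred_le hi),
          hs, sub_batchStart_pred hi]
    _ ≤ (c * (i : ℝ) ^ ((1 + α) / 2)) * (c' ^ θ * (i : ℝ) ^ (-θ)) := by
        have := (rate_pos θ s).le
        gcongr
        exact hl i hi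
    _ = c * c' ^ θ * (i : ℝ) ^ ((1 + α) / 2 - θ) := by
        rw [sub_eq_add_neg, Real.rpow_add hi0]
        ring

/-- Centring makes the batch sum invariant under translation of all iterates, so x* may be
subtracted. The batch from t_i to i appears as the half-open window from t_i - 1 to i, shifted by
one. -/
theorem centredBatchSum_eq {d : ℕ} (x : ℕ → Vec d) (c : Vec d) {i : ℕ} (hi : 1 ≤ i) (hn : 1 ≤ n) :
    centredBatchSum (batchSeq C α) x n i
      = ∑ k ∈ Finset.Ico (batchStart (batchSeq C α) i - 1) i, (x (k + 1) - c)
        - (batchLength (batchSeq C α) i : ℝ) •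
          ((n : ℝ)⁻¹ • ∑ k ∈ Finset.Ico 0 n, (x (k + 1) - c)) := by
  have h1 := one_le_batchStart (C := C) (α := α) hi
  have hshift : ∀ s m, ∑ k ∈ Finset.Ico s m, x (k + 1) = ∑ k ∈ Finset.Icc (s + 1) m, x k := by
    intro s m
    rw [Finset.sum_Ico_add' x s m 1]
    rfl
  have hn0 : (n : ℝ) ≠ 0 := by
    have : n ≠ 0 := by omega
    exact_mod_cast this
  rw [Finset.sum_sub_distrib, Finset.sum_sub_distrib, hshift, hshift, Finset.sum_const,
    Finset.sum_const, Nat.card_Ico, Nat.card_Ico, ← Nat.cast_smul_eq_nsmul ℝ,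
    ← Nat.cast_smul_eq_nsmul ℝ, Nat.cast_sub (batchStart_pred_le hi), sub_batchStart_pred hi,
    Nat.sub_add_cancel h1, zero_add, Nat.sub_zero, smul_sub, smul_smul (n : ℝ)⁻¹,
    inv_mul_cancel₀ hn0, one_smul, smul_sub, centredBatchSum, average]
  abel

end Sums

/-! ### Reduction of the centred batch sums to noise sums. -/

section Residual

variable {d : ℕ} {Ω Ξ : Type*} [m0 : MeasurableSpace Ω] [MeasurableSpace Ξ]
  {P : Measure Ω} [IsProbabilityMeasure P] {Pi : Measure Ξ} [IsProbabilityMeasure Pi]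
  {f : Vec d → Ξ → ℝ} {ξ : ℕ → Ω → Ξ} {x₀ xstar : Vec d} {η α C : ℝ}

theorem exists_rms_noiseSum (hη : 0 < η) (hα : 0 < α) (hα' : α < 1)
    (hξ : IsIIDSample ξ Pi P) (hF : RegularObjective (objective f Pi) xstar)
    (hf : RegularLoss f Pi xstar) (hε : NoiseMoments f Pi xstar η α x₀ ξ P) :
    ∃ K : ℝ, 0 ≤ K ∧ ∀ s i, s ≤ i →
      RMSLE P (noiseSum f Pi η α x₀ ξ s i) (K * √((i : ℝ) - s)) := by
  obtain ⟨M, hM, hmart⟩ := exists_martDiff hη hα hα' hξ hF hf hε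
  set b := EuclideanSpace.basisFun (Fin d) ℝ
  refine ⟨d * (2 * M), by positivity, fun s i h => ?_⟩
  have h1 : ∀ p ∈ (Finset.univ : Finset (Fin d)),
      RMSLE P (fun ω => (inner ℝ (b p) (noiseSum f Pi η α x₀ ξ s i ω) : ℝ) • b p)
      (2 * M * √((i : ℝ) - s)) := by
    intro p _
    have hp := hmart 1 (b p) (by rw [b.norm_eq_one])
    rw [one_pow, one_mul] at hp
    have h2 := hp.rms_winSum hM h
    rw [winSum_inner] at h2
    have h3 := h2.of_norm_le (c := 1)
      (Y := fun ω => (inner ℝ (b p) (noiseSum f Pi η α x₀ ξ s i ω) : ℝ) • b p)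
      zero_le_one (h2.memLp.1.smul_const (b p))
      (ae_of_all _ fun ω => by rw [norm_smul, b.norm_eq_one, mul_one, one_mul])
    rwa [one_mul] at h3
  have h4 := RMSLE.sum Finset.univ h1
  simp only [b.sum_repr'] at h4
  refine h4.mono (le_of_eq ?_)
  rw [Finset.sum_const, Finset.card_univ, Fintype.card_fin, nsmul_eq_mul]
  ring

theorem rate_neg_le {θ : ℝ} (hθ : 0 ≤ θ) (hθ1 : θ ≤ 1) {i n : ℕ} (hi : i ≤ n) (hn : 1 ≤ n) :
    rate (-θ) i ≤ 2 * (n : ℝ) ^ θ := by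
  have hn1 : (1 : ℝ) ≤ n := by exact_mod_cast hn
  have hin : (i : ℝ) ≤ n := by exact_mod_cast hi
  calc rate (-θ) i = ((i : ℝ) + 1) ^ θ := by rw [rate, neg_neg]
    _ ≤ (2 * (n : ℝ)) ^ θ := by
        gcongr
        linarith
    _ = 2 ^ θ * (n : ℝ) ^ θ := Real.mul_rpow (by norm_num) (by linarith)
    _ ≤ 2 * (n : ℝ) ^ θ := by
        gcongr
        calc (2 : ℝ) ^ θ ≤ 2 ^ (1 : ℝ) := Real.rpow_le_rpow_of_exponent_le (by norm_num) hθ1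
          _ = 2 := Real.rpow_one 2

/-- The averaged iterate converges at the parametric rate. -/
theorem exists_rms_average (hη : 0 < η) (hα : 1 / 2 < α) (hα' : α < 1)
    (hξ : IsIIDSample ξ Pi P) (hF : RegularObjective (objective f Pi) xstar)
    (hf : RegularLoss f Pi xstar) (hε : NoiseMoments f Pi xstar η α x₀ ξ P) :
    ∃ K : ℝ, 0 ≤ K ∧ ∀ n : ℕ, 1 ≤ n →
      RMSLE P (fun ω => (n : ℝ)⁻¹ • ∑ k ∈ Finset.Ico 0 n, iterErr f η α x₀ xstar ξ (k + 1) ω)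
        (K * (n : ℝ) ^ (-(1 / 2) : ℝ)) := by
  have hα0 : 0 < α := by linarith
  obtain ⟨K₁, hK₁, h₁⟩ := exists_rms_linearization hη hα0 hα' hξ hF hf hε
  obtain ⟨K₂, hK₂, h₂⟩ := exists_rms_noiseSum hη hα0 hα' hξ hF hf hε
  set T := (hessian (objective f Pi) xstar).inverse
  refine ⟨4 * K₁ + ‖T‖ * K₂, by positivity, fun n hn => ?_⟩
  have hn1 : (1 : ℝ) ≤ n := by exact_mod_cast hn
  have hn0 : (0 : ℝ) < n := by linarith
  have h3 := (((h₁ 0 n n.zero_le).add ((h₂ 0 n n.zero_le).clm T)).const_smul ((n : ℝ)⁻¹))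
  simp only [T, sub_add_cancel] at h3
  refine h3.mono ?_
  have hsq : (n : ℝ) ^ (-(1 / 2) : ℝ) = (n : ℝ)⁻¹ * √n := by
    rw [Real.sqrt_eq_rpow, ← Real.rpow_neg_one, ← Real.rpow_add hn0]
    norm_num
  have h4 : rate (-(α / 2)) n ≤ 2 * √n := by
    refine (rate_neg_le (by linarith) (by linarith) le_rfl hn).trans ?_
    rw [Real.sqrt_eq_rpow]
    gcongr
  have h5 := sum_rate_le hα n
  rw [hsq, abs_of_pos (inv_pos.2 hn0), Nat.cast_zero, sub_zero]
  calc (n : ℝ)⁻¹ * (K₁ * (rate (-(α / 2)) n + ∑ k ∈ Finset.Ico 0 n, rate α k)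
        + ‖T‖ * (K₂ * √n))
      ≤ (n : ℝ)⁻¹ * (K₁ * (2 * √n + 2 * √n) + ‖T‖ * (K₂ * √n)) := by gcongr
    _ = _ := by ring

/-- The centred batch sums are transformed sums of the noise, up to an error of order
`n ^ (α / 2)`. -/
theorem exists_rms_residual (hη : 0 < η) (hα : 1 / 2 < α) (hα' : α < 1) (hC : 0 < C)
    (hξ : IsIIDSample ξ Pi P) (hF : RegularObjective (objective f Pi) xstar)
    (hf : RegularLoss f Pi xstar) (hε : NoiseMoments f Pi xstar η α x₀ ξ P) :
    ∃ K : ℝ, 0 ≤ K ∧ ∀ n i : ℕ, 1 ≤ i → i ≤ n →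
      RMSLE P (fun ω => centredBatchSum (batchSeq C α) (sgd f η α x₀ (fun i => ξ i ω)) n i
        - (hessian (objective f Pi) xstar).inverse
          (noiseSum f Pi η α x₀ ξ (batchStart (batchSeq C α) i - 1) i ω))
        (K * (n : ℝ) ^ (α / 2)) := by
  have hα0 : 0 < α := by linarith
  obtain ⟨K₁, hK₁, h₁⟩ := exists_rms_linearization hη hα0 hα' hξ hF hf hε
  obtain ⟨K₂, hK₂, h₂⟩ := exists_rms_average hη hα hα' hξ hF hf hε
  obtain ⟨K₃, hK₃, h₃⟩ := exists_sum_rate_batch_le hα0 hα' hC hα0.le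
  obtain ⟨c, hc, hl⟩ := exists_batchLength_le hα0 hα' hC
  refine ⟨K₁ * (2 + K₃) + c * K₂, by positivity, fun n i hi hin => ?_⟩
  have hn : 1 ≤ n := hi.trans hin
  have hn1 : (1 : ℝ) ≤ n := by exact_mod_cast hn
  have hn0 : (0 : ℝ) < n := by linarith
  have hi1 : (1 : ℝ) ≤ i := by exact_mod_cast hi
  have hin' : (i : ℝ) ≤ n := by exact_mod_cast hin
  have h4 := (h₁ _ i (batchStart_pred_le (C := C) (α := α) hi)).sub
    ((h₂ n hn).const_smul (batchLength (batchSeq C α) i : ℝ))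
  have heq : ∀ ω, centredBatchSum (batchSeq C α) (sgd f η α x₀ (fun i => ξ i ω)) n i
        - (hessian (objective f Pi) xstar).inverse
          (noiseSum f Pi η α x₀ ξ (batchStart (batchSeq C α) i - 1) i ω)
      = ∑ k ∈ Finset.Ico (batchStart (batchSeq C α) i - 1) i, iterErr f η α x₀ xstar ξ (k + 1) ω
        - (hessian (objective f Pi) xstar).inverse
          (noiseSum f Pi η α x₀ ξ (batchStart (batchSeq C α) i - 1) i ω)
        - (batchLength (batchSeq C α) i : ℝ) •
          ((n : ℝ)⁻¹ • ∑ k ∈ Finset.Ico 0 n, iterErr f η α x₀ xstar ξ (k + 1) ω) := by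
    intro ω
    rw [centredBatchSum_eq _ xstar hi hn]
    simp only [iterErr]
    abel
  simp only [heq]
  refine h4.mono ?_
  -- The exponent (1-α)/2 is at most α/2 because α > 1/2.
  have h5 : (i : ℝ) ^ ((1 + α) / 2 - α) ≤ (n : ℝ) ^ (α / 2) :=
    calc (i : ℝ) ^ ((1 + α) / 2 - α) ≤ (i : ℝ) ^ (α / 2) :=
          Real.rpow_le_rpow_of_exponent_le hi1 (by linarith)
      _ ≤ (n : ℝ) ^ (α / 2) := by gcongr
  have h6 : (batchLength (batchSeq C α) i : ℝ) ≤ c * (n : ℝ) ^ ((1 + α) / 2) := by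
    refine (hl i hi).trans ?_
    gcongr
  -- Centring at the sample mean costs the batch length times the L² error n^{-1/2} of the mean,
  -- which is again of order n^{α/2}.
  have h7 : (n : ℝ) ^ ((1 + α) / 2) * (n : ℝ) ^ (-(1 / 2) : ℝ) = (n : ℝ) ^ (α / 2) := by
    rw [← Real.rpow_add hn0]
    congr 1
    ring
  rw [abs_of_nonneg (Nat.cast_nonneg _)]
  calc K₁ * (rate (-(α / 2)) i
          + ∑ k ∈ Finset.Ico (batchStart (batchSeq C α) i - 1) i, rate α k)
        + batchLength (batchSeq C α) i * (K₂ * (n : ℝ) ^ (-(1 / 2) : ℝ))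
      ≤ K₁ * (2 * (n : ℝ) ^ (α / 2) + K₃ * (n : ℝ) ^ (α / 2))
        + c * (n : ℝ) ^ ((1 + α) / 2) * (K₂ * (n : ℝ) ^ (-(1 / 2) : ℝ)) := by
        gcongr
        · exact rate_neg_le (by linarith) (by linarith) hin hn
        · exact (h₃ i hi).trans (by gcongr)
    _ = (K₁ * (2 + K₃)) * (n : ℝ) ^ (α / 2)
        + c * K₂ * ((n : ℝ) ^ ((1 + α) / 2) * (n : ℝ) ^ (-(1 / 2) : ℝ)) := by ring
    _ = _ := by
        rw [h7]
        ring

end Residual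

/-! ### Entrywise estimate of the numerator and passage to the operator norm. -/

section Estimate

variable {d : ℕ} {Ω Ξ : Type*} [m0 : MeasurableSpace Ω] [MeasurableSpace Ξ]
  {P : Measure Ω} [IsProbabilityMeasure P] {Pi : Measure Ξ} [IsProbabilityMeasure Pi]
  {f : Vec d → Ξ → ℝ} {ξ : ℕ → Ω → Ξ} {x₀ xstar : Vec d} {η α C : ℝ}

/-- The sum of the within-batch martingale parts has root mean square of order
`n ^ ((5 + 3 α) / 4)`. -/
theorem rms_sum_winMart {ℱ : Filtration ℕ m0} {M c : ℝ} {p q : ℕ → Ω → ℝ}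
    (hp : MartDiff P ℱ M p) (hq : MartDiff P ℱ M q) (hM : 1 ≤ M) (hα : 0 < α) (hc : 1 ≤ c)
    (hl : ∀ i : ℕ, 1 ≤ i → (batchLength (batchSeq C α) i : ℝ) ≤ c * (i : ℝ) ^ ((1 + α) / 2))
    {n : ℕ} (hn : 1 ≤ n) :
    RMSLE P (fun ω => ∑ i ∈ Finset.Icc 1 n,
      MartDiff.winMart P ℱ p q (batchStart (batchSeq C α) i - 1) i ω)
      (5 * M * c ^ 2 * (n : ℝ) ^ ((5 + 3 * α) / 4)) := by
  have hn0 : (0 : ℝ) < n := by exact_mod_cast hn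
  have h1 : ∀ i ∈ Finset.Icc 1 n, 1 ≤ i := fun i hi => (Finset.mem_Icc.1 hi).1
  refine ⟨memLp_finsetSum _ fun i hi =>
    (MartDiff.rms_winMart hp hq hM (batchStart_pred_le (h1 i hi))).memLp, by positivity, ?_⟩
  have h2 := MartDiff.integral_sq_sum_winMart_le hp hq hM
    (s := fun i => batchStart (batchSeq C α) i - 1) (T := Finset.Icc 1 n)
    (fun i hi => batchStart_pred_le (h1 i hi)) (by
      intro i hi j hj hij hne
      have := lt_batchStart (C := C) (α := α) (h1 i hi) hij (fun h => hne (by rw [h]))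
      omega)
  have h3 : ∑ i ∈ Finset.Icc 1 n, ∑ j ∈ Finset.Icc 1 n with
        batchStart (batchSeq C α) j - 1 = batchStart (batchSeq C α) i - 1,
      ((i : ℝ) - (batchStart (batchSeq C α) i - 1 : ℕ))
        * ((j : ℝ) - (batchStart (batchSeq C α) j - 1 : ℕ))
      = ∑ i ∈ Finset.Icc 1 n, ∑ j ∈ Finset.Icc 1 n with
        batchStart (batchSeq C α) j = batchStart (batchSeq C α) i,
      (batchLength (batchSeq C α) i : ℝ) * (batchLength (batchSeq C α) j : ℝ) := by
    refine Finset.sum_congr rfl fun i hi => Finset.sum_congr ?_ fun j hj => ?_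
    · refine Finset.filter_congr fun j hj => ?_
      have := one_le_batchStart (C := C) (α := α) (h1 i hi)
      have := one_le_batchStart (C := C) (α := α) (h1 j hj)
      omega
    · rw [sub_batchStart_pred (h1 i hi), sub_batchStart_pred (h1 j (Finset.mem_filter.1 hj).1)]
  have h4 := sum_batch_mul_le (C := C) (α := α) (n := n) (N := c * (n : ℝ) ^ ((1 + α) / 2))
    fun i hi => (hl i (h1 i hi)).trans (by
      have : (i : ℝ) ≤ n := by exact_mod_cast (Finset.mem_Icc.1 hi).2
      gcongr)
  -- There are n rows, each bounded by the cube of the maximal batch length n^{(1+α)/2}; the root of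
  -- the product is the claimed rate.
  have h5 : (n : ℝ) * ((n : ℝ) ^ ((1 + α) / 2)) ^ 3 = ((n : ℝ) ^ ((5 + 3 * α) / 4)) ^ 2 := by
    rw [← Real.rpow_natCast, ← Real.rpow_natCast, ← Real.rpow_mul hn0.le, ← Real.rpow_mul hn0.le,
      ← Real.rpow_one_add' hn0.le (by push_cast; linarith)]
    congr 1
    push_cast
    ring
  simp only [Real.norm_eq_abs, sq_abs]
  refine h2.trans ?_
  rw [h3]
  calc (5 * M) ^ 2 * _ ≤ (5 * M) ^ 2 * ((n : ℝ) * (c * (n : ℝ) ^ ((1 + α) / 2)) ^ 3) := by gcongr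
    _ = (5 * M) ^ 2 * c ^ 3 * ((n : ℝ) * ((n : ℝ) ^ ((1 + α) / 2)) ^ 3) := by ring
    _ ≤ (5 * M) ^ 2 * c ^ 4 * ((n : ℝ) * ((n : ℝ) ^ ((1 + α) / 2)) ^ 3) := by
        gcongr
        norm_num
    _ = _ := by
        rw [h5]
        ring

/-- Each summand splits into the compensated product of two noise sums, the deviation of the
conditional covariances from S, and products containing a residual. Cancellation over i is used only
for the first piece; the triangle inequality suffices for the others. -/
theorem exists_mean_entry_le (hη : 0 < η) (hα : 1 / 2 < α) (hα' : α < 1) (hC : 0 < C)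
    (hξ : IsIIDSample ξ Pi P) (hF : RegularObjective (objective f Pi) xstar)
    (hf : RegularLoss f Pi xstar) (hε : NoiseMoments f Pi xstar η α x₀ ξ P) (u v : Vec d) :
    ∃ K : ℝ, ∀ n : ℕ, 1 ≤ n → MeanLE P (fun ω => ∑ i ∈ Finset.Icc 1 n,
      ((inner ℝ u (centredBatchSum (batchSeq C α) (sgd f η α x₀ (fun i => ξ i ω)) n i) : ℝ)
        * inner ℝ v (centredBatchSum (batchSeq C α) (sgd f η α x₀ (fun i => ξ i ω)) n i)
        - batchLength (batchSeq C α) i * inner ℝ u (sandwich f Pi xstar v)))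
      (K * (n : ℝ) ^ ((5 + 3 * α) / 4)) := by
  have hα0 : 0 < α := by linarith
  obtain ⟨M₀, hM₀, hmart⟩ := exists_martDiff hη hα0 hα' hξ hF hf hε
  obtain ⟨K₁, hK₁, hR⟩ := exists_rms_residual hη hα hα' hC hξ hF hf hε
  obtain ⟨c, hc, hl⟩ := exists_batchLength_le hα0 hα' hC
  obtain ⟨K₂, hK₂, hrate⟩ := exists_sum_rate_batch_le hα0 hα' hC (by linarith : 0 ≤ α / 2)
  set T := (hessian (objective f Pi) xstar).inverse with hT
  set a := T u with ha
  set b := T v with hb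
  obtain ⟨K₃, hK₃, hcov⟩ := exists_rms_condCov_sub hη hα0 hα' hξ hF hf hε a b
  -- A common bound gives both projections the same moment constant, and B ≥ 1 keeps that constant
  -- at least 1.
  set B := max 1 (max ‖a‖ ‖b‖) with hB
  have hB1 : 1 ≤ B := le_max_left _ _
  have hp := hmart B a ((le_max_left _ _).trans (le_max_right _ _))
  have hq := hmart B b ((le_max_right _ _).trans (le_max_right _ _))
  set M := B ^ 4 * M₀ with hMdef
  have hM : 1 ≤ M := one_le_mul_of_one_le_of_one_le (one_le_pow₀ hB1) hM₀
  set p : ℕ → Ω → ℝ := fun k ω => inner ℝ a (gradNoise f Pi η α x₀ ξ (k + 1) ω) with hpdef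
  set q : ℕ → Ω → ℝ := fun k ω => inner ℝ b (gradNoise f Pi η α x₀ ξ (k + 1) ω) with hqdef
  refine ⟨5 * M * c ^ 2 + K₃ * K₂ + (2 * M * √c * (‖v‖ * K₁) + ‖u‖ * K₁ * (2 * M * √c)
    + ‖u‖ * K₁ * (‖v‖ * K₁)), fun n hn => ?_⟩
  have hn1 : (1 : ℝ) ≤ n := by exact_mod_cast hn
  have hn0 : (0 : ℝ) < n := by linarith
  -- The differences p_k and q_k involve the noise of index k + 1, so the batch from t_i to i
  -- corresponds to the window starting at t_i - 1.
  set t : ℕ → ℕ := fun i => batchStart (batchSeq C α) i - 1 with ht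
  set R : ℕ → Ω → Vec d := fun i ω =>
    centredBatchSum (batchSeq C α) (sgd f η α x₀ (fun i => ξ i ω)) n i
      - T (noiseSum f Pi η α x₀ ξ (t i) i ω) with hRdef
  have hdecomp : ∀ i ∈ Finset.Icc 1 n, ∀ ω,
      (inner ℝ u (centredBatchSum (batchSeq C α) (sgd f η α x₀ (fun i => ξ i ω)) n i) : ℝ)
        * inner ℝ v (centredBatchSum (batchSeq C α) (sgd f η α x₀ (fun i => ξ i ω)) n i)
        - batchLength (batchSeq C α) i * inner ℝ u (sandwich f Pi xstar v)
      = MartDiff.winMart P hξ.filtration p q (t i) i ω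
        + ∑ k ∈ Finset.Ico (t i) i, (MartDiff.condCov P hξ.filtration p q k ω
          - inner ℝ a (gradCov f Pi xstar b))
        + (winSum p (t i) i ω * inner ℝ v (R i ω) + inner ℝ u (R i ω) * winSum q (t i) i ω
          + inner ℝ u (R i ω) * inner ℝ v (R i ω)) := by
    intro i hi ω
    have hi1 := (Finset.mem_Icc.1 hi).1
    have e1 : centredBatchSum (batchSeq C α) (sgd f η α x₀ (fun i => ξ i ω)) n i
        = T (noiseSum f Pi η α x₀ ξ (t i) i ω) + R i ω := by
      exact (add_sub_cancel _ _).symm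
    have e2 : inner ℝ u (sandwich f Pi xstar v) = inner ℝ a (gradCov f Pi xstar b) := by
      rw [ha, hT, ← hF.inner_hessian_inverse]
      rfl
    have e3 : ∀ w x : Vec d, (inner ℝ w (T x) : ℝ) = inner ℝ (T w) x := hF.inner_hessian_inverse
    rw [e1, e2, inner_add_right, inner_add_right, e3, e3, ← ha, ← hb, MartDiff.winMart,
      winSum_inner, winSum_inner, Finset.sum_sub_distrib, Finset.sum_const, Nat.card_Ico,
      nsmul_eq_mul, Nat.cast_sub (batchStart_pred_le hi1), ← sub_batchStart_pred hi1]
    ring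
  have hfun : (fun ω => ∑ i ∈ Finset.Icc 1 n,
      ((inner ℝ u (centredBatchSum (batchSeq C α) (sgd f η α x₀ (fun i => ξ i ω)) n i) : ℝ)
        * inner ℝ v (centredBatchSum (batchSeq C α) (sgd f η α x₀ (fun i => ξ i ω)) n i)
        - batchLength (batchSeq C α) i * inner ℝ u (sandwich f Pi xstar v)))
      = fun ω => ∑ i ∈ Finset.Icc 1 n, MartDiff.winMart P hξ.filtration p q (t i) i ω
        + ∑ i ∈ Finset.Icc 1 n, ∑ k ∈ Finset.Ico (t i) i,
          (MartDiff.condCov P hξ.filtration p q k ω - inner ℝ a (gradCov f Pi xstar b))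
        + ∑ i ∈ Finset.Icc 1 n,
          (winSum p (t i) i ω * inner ℝ v (R i ω) + inner ℝ u (R i ω) * winSum q (t i) i ω
            + inner ℝ u (R i ω) * inner ℝ v (R i ω)) := by
    ext ω
    rw [← Finset.sum_add_distrib, ← Finset.sum_add_distrib]
    exact Finset.sum_congr rfl fun i hi => hdecomp i hi ω
  have hρ : ∀ θ : ℝ, 1 + θ ≤ (5 + 3 * α) / 4 →
      (n : ℝ) * (n : ℝ) ^ θ ≤ (n : ℝ) ^ ((5 + 3 * α) / 4) := by
    intro θ hθ
    calc (n : ℝ) * (n : ℝ) ^ θ = (n : ℝ) ^ (1 + θ) := by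
          rw [Real.rpow_add hn0, Real.rpow_one]
      _ ≤ _ := Real.rpow_le_rpow_of_exponent_le hn1 hθ
  have hmain := (rms_sum_winMart hp hq hM hα0 hc hl hn).meanLE
  have hbias : MeanLE P (fun ω => ∑ i ∈ Finset.Icc 1 n, ∑ k ∈ Finset.Ico (t i) i,
      (MartDiff.condCov P hξ.filtration p q k ω - inner ℝ a (gradCov f Pi xstar b)))
      (K₃ * K₂ * (n : ℝ) ^ ((5 + 3 * α) / 4)) := by
    refine (RMSLE.sum (Finset.Icc 1 n) (s := fun _ => K₃ * (K₂ * (n : ℝ) ^ (1 / 2 : ℝ)))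
      fun i hi => ?_).meanLE.mono ?_
    · obtain ⟨hi1, hin⟩ := Finset.mem_Icc.1 hi
      have hin' : (i : ℝ) ≤ n := by exact_mod_cast hin
      refine (RMSLE.sum (Finset.Ico (t i) i) fun k _ => hcov k).mono ?_
      rw [← Finset.mul_sum]
      refine mul_le_mul_of_nonneg_left ((hrate i hi1).trans ?_) hK₃
      rw [show (1 + α) / 2 - α / 2 = 1 / 2 by ring]
      gcongr
    · rw [Finset.sum_const, Nat.card_Icc, Nat.add_sub_cancel, nsmul_eq_mul]
      calc (n : ℝ) * (K₃ * (K₂ * (n : ℝ) ^ (1 / 2 : ℝ)))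
          = K₃ * K₂ * ((n : ℝ) * (n : ℝ) ^ (1 / 2 : ℝ)) := by ring
        _ ≤ _ := by
          gcongr
          exact hρ _ (by linarith)
  have hcross : MeanLE P (fun ω => ∑ i ∈ Finset.Icc 1 n,
      (winSum p (t i) i ω * inner ℝ v (R i ω) + inner ℝ u (R i ω) * winSum q (t i) i ω
        + inner ℝ u (R i ω) * inner ℝ v (R i ω)))
      ((2 * M * √c * (‖v‖ * K₁) + ‖u‖ * K₁ * (2 * M * √c) + ‖u‖ * K₁ * (‖v‖ * K₁))
        * (n : ℝ) ^ ((5 + 3 * α) / 4)) := by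
    have hterm : ∀ i ∈ Finset.Icc 1 n, MeanLE P (fun ω =>
        winSum p (t i) i ω * inner ℝ v (R i ω) + inner ℝ u (R i ω) * winSum q (t i) i ω
          + inner ℝ u (R i ω) * inner ℝ v (R i ω))
        (2 * M * (√c * (n : ℝ) ^ ((1 + α) / 4)) * (‖v‖ * (K₁ * (n : ℝ) ^ (α / 2)))
          + ‖u‖ * (K₁ * (n : ℝ) ^ (α / 2)) * (2 * M * (√c * (n : ℝ) ^ ((1 + α) / 4)))
          + ‖u‖ * (K₁ * (n : ℝ) ^ (α / 2)) * (‖v‖ * (K₁ * (n : ℝ) ^ (α / 2)))) := by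
      intro i hi
      obtain ⟨hi1, hin⟩ := Finset.mem_Icc.1 hi
      have hin' : (i : ℝ) ≤ n := by exact_mod_cast hin
      have hsqrt : √((i : ℝ) - (t i : ℕ)) ≤ √c * (n : ℝ) ^ ((1 + α) / 4) := by
        rw [ht, sub_batchStart_pred hi1]
        have h1 : (n : ℝ) ^ ((1 + α) / 4) = √((n : ℝ) ^ ((1 + α) / 2)) := by
          rw [Real.sqrt_eq_rpow, ← Real.rpow_mul hn0.le]
          congr 1
          ring
        rw [h1, ← Real.sqrt_mul (by linarith)]
        refine Real.sqrt_le_sqrt ((hl i hi1).trans ?_)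
        gcongr
      have hP := (hp.rms_winSum hM (batchStart_pred_le (C := C) (α := α) hi1)).mono
        (mul_le_mul_of_nonneg_left hsqrt (by linarith : (0 : ℝ) ≤ 2 * M))
      have hQ := (hq.rms_winSum hM (batchStart_pred_le (C := C) (α := α) hi1)).mono
        (mul_le_mul_of_nonneg_left hsqrt (by linarith : (0 : ℝ) ≤ 2 * M))
      have hu := (hR n i hi1 hin).inner_left u
      have hv := (hR n i hi1 hin).inner_left v
      exact ((hP.mul hv).add (hu.mul hQ)).add (hu.mul hv)
    refine (MeanLE.sum (Finset.Icc 1 n) hterm).mono ?_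
    rw [Finset.sum_const, Nat.card_Icc, Nat.add_sub_cancel, nsmul_eq_mul]
    -- The noise-residual products attain the exponent (5+3α)/4 exactly; the squared residuals give
    -- 1 + α, which is smaller because α < 1.
    have e1 := hρ ((1 + α) / 4 + α / 2) (by linarith)
    have e2 := hρ (α / 2 + α / 2) (by linarith)
    rw [Real.rpow_add hn0] at e1 e2
    calc _ = (2 * M * √c * (‖v‖ * K₁) + ‖u‖ * K₁ * (2 * M * √c))
            * ((n : ℝ) * ((n : ℝ) ^ ((1 + α) / 4) * (n : ℝ) ^ (α / 2)))
          + ‖u‖ * K₁ * (‖v‖ * K₁) * ((n : ℝ) * ((n : ℝ) ^ (α / 2) * (n : ℝ) ^ (α / 2))) := by ring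
      _ ≤ (2 * M * √c * (‖v‖ * K₁) + ‖u‖ * K₁ * (2 * M * √c)) * (n : ℝ) ^ ((5 + 3 * α) / 4)
          + ‖u‖ * K₁ * (‖v‖ * K₁) * (n : ℝ) ^ ((5 + 3 * α) / 4) := by gcongr
      _ = _ := by ring
  rw [hfun]
  exact ((hmain.add hbias).add hcross).mono (le_of_eq (by ring))

theorem norm_le_sum_entries {E ι : Type*} [NormedAddCommGroup E] [InnerProductSpace ℝ E]
    [Fintype ι] (b : OrthonormalBasis ι ℝ E) (M : E →L[ℝ] E) :
    ‖M‖ ≤ ∑ p, ∑ q, |inner ℝ (b p) (M (b q))| := by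
  refine M.opNorm_le_bound (Finset.sum_nonneg fun p _ => Finset.sum_nonneg fun q _ => abs_nonneg _)
    fun x => ?_
  have hcol : ∀ q, ‖M (b q)‖ ≤ ∑ p, |inner ℝ (b p) (M (b q))| := by
    intro q
    calc ‖M (b q)‖ = ‖∑ p, (inner ℝ (b p) (M (b q)) : ℝ) • b p‖ := by rw [b.sum_repr']
      _ ≤ ∑ p, ‖(inner ℝ (b p) (M (b q)) : ℝ) • b p‖ := norm_sum_le _ _
      _ = _ := by simp [norm_smul]
  calc ‖M x‖ = ‖∑ q, (inner ℝ (b q) x : ℝ) • M (b q)‖ := by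
        conv_lhs => rw [← b.sum_repr' x, map_sum]
        simp only [map_smul]
    _ ≤ ∑ q, ‖(inner ℝ (b q) x : ℝ) • M (b q)‖ := norm_sum_le _ _
    _ ≤ ∑ q, ‖x‖ * ∑ p, |inner ℝ (b p) (M (b q))| := by
        refine Finset.sum_le_sum fun q _ => ?_
        rw [norm_smul]
        refine mul_le_mul ?_ (hcol q) (norm_nonneg _) (norm_nonneg _)
        simpa using norm_inner_le_norm (𝕜 := ℝ) (b q) x
    _ = _ := by rw [← Finset.mul_sum, Finset.sum_comm, mul_comm]

theorem memLp_centredBatchSum (hξ : IsIIDSample ξ Pi P)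
    (hF : RegularObjective (objective f Pi) xstar) (hf : RegularLoss f Pi xstar)
    (hε : NoiseMoments f Pi xstar η α x₀ ξ P) (a : ℕ → ℕ) (n i : ℕ) :
    MemLp (fun ω => centredBatchSum a (sgd f η α x₀ (fun i => ξ i ω)) n i) 2 P := by
  have hx : ∀ k, MemLp (fun ω => sgd f η α x₀ (fun i => ξ i ω) k) 2 P := by
    intro k
    have h1 := ((memLp_iterErr hξ hF hf hε k).add (memLp_const xstar)).mono_exponent
      (p := 2) (by norm_num)
    refine (memLp_congr_ae (ae_of_all _ fun ω => ?_)).1 h1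
    exact sub_add_cancel _ _
  have havg : MemLp (fun ω => average (sgd f η α x₀ (fun i => ξ i ω)) n) 2 P :=
    (memLp_finsetSum (Finset.Icc 1 n) fun k _ => hx k).const_smul (n : ℝ)⁻¹
  exact (memLp_finsetSum (Finset.Icc (batchStart a i) i) fun k _ => hx k).sub
    (havg.const_smul (batchLength a i : ℝ))

theorem integrable_smul_sum_rankOne {E : Type*} [NormedAddCommGroup E] [InnerProductSpace ℝ E]
    {X : ℕ → Ω → E} (hX : ∀ i, MemLp (X i) 2 P) (T : Finset ℕ) (c : ℝ) :
    Integrable (fun ω => c • ∑ i ∈ T, InnerProductSpace.rankOne ℝ (X i ω) (X i ω)) P := by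
  refine Integrable.smul c (integrable_finsetSum _ fun i _ => ?_)
  refine ((hX i).integrable_norm_pow (p := 2) (by norm_num)).mono'
    ((continuous_rankOne_self E).comp_aestronglyMeasurable (hX i).1) (ae_of_all _ fun ω => ?_)
  rw [InnerProductSpace.norm_rankOne, sq]

theorem integrable_covEstimator (hξ : IsIIDSample ξ Pi P)
    (hF : RegularObjective (objective f Pi) xstar) (hf : RegularLoss f Pi xstar)
    (hε : NoiseMoments f Pi xstar η α x₀ ξ P) (a : ℕ → ℕ) (n : ℕ) :
    Integrable (fun ω => covEstimator a (sgd f η α x₀ (fun i => ξ i ω)) n) P :=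
  integrable_smul_sum_rankOne (memLp_centredBatchSum hξ hF hf hε a n) (Finset.Icc 1 n)
    (∑ i ∈ Finset.Icc 1 n, (batchLength a i : ℝ))⁻¹

/-- The limit matrix is distributed over the sum with the weights l_i, so each outer product is
centred separately before the norm is bounded by entries. As n ≥ 1, the total length is positive. -/
theorem norm_covEstimator_sub_le (a : ℕ → ℕ) (x : ℕ → Vec d) {n : ℕ} (hn : 1 ≤ n)
    (S : Vec d →L[ℝ] Vec d) {ι : Type*} [Fintype ι] (b : OrthonormalBasis ι ℝ (Vec d)) :
    ‖covEstimator a x n - S‖ ≤ (∑ i ∈ Finset.Icc 1 n, (batchLength a i : ℝ))⁻¹ *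
      ∑ p, ∑ q, |∑ i ∈ Finset.Icc 1 n, ((inner ℝ (b p) (centredBatchSum a x n i) : ℝ)
        * inner ℝ (b q) (centredBatchSum a x n i)
        - batchLength a i * inner ℝ (b p) (S (b q)))| := by
  set L := ∑ i ∈ Finset.Icc 1 n, (batchLength a i : ℝ) with hL
  have hL0 : 0 < L := Finset.sum_pos (fun i _ => by
    have := one_le_batchLength a i
    exact_mod_cast this) ⟨1, Finset.mem_Icc.2 ⟨le_rfl, hn⟩⟩
  have h1 : covEstimator a x n - S
      = L⁻¹ • ((∑ i ∈ Finset.Icc 1 n, outer (centredBatchSum a x n i)) - L • S) := by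
    rw [smul_sub, smul_smul, inv_mul_cancel₀ hL0.ne', one_smul, covEstimator]
  rw [h1, norm_smul, Real.norm_of_nonneg (inv_nonneg.2 hL0.le)]
  refine mul_le_mul_of_nonneg_left ((norm_le_sum_entries b _).trans (le_of_eq ?_))
    (inv_nonneg.2 hL0.le)
  refine Finset.sum_congr rfl fun p _ => Finset.sum_congr rfl fun q _ => ?_
  congr 1
  rw [sub_apply, sum_apply, smul_apply, inner_sub_right,
    inner_sum, inner_smul_right, Finset.sum_sub_distrib, ← Finset.sum_mul]
  simp only [inner_outer_apply]
  rfl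

end Estimate

end OnlineSGD

end

/-! ### The convergence rate of the estimator. -/

open OnlineSGD in
theorem corollary1 {d : ℕ} {Ω Ξ : Type*} [MeasurableSpace Ω] [MeasurableSpace Ξ]
    (P : Measure Ω) [IsProbabilityMeasure P] (Pi : Measure Ξ) [IsProbabilityMeasure Pi]
    (f : Vec d → Ξ → ℝ) (ξ : ℕ → Ω → Ξ) (x₀ xstar : Vec d) (η α C : ℝ)
    (hη : 0 < η) (hα : 1 / 2 < α) (hα' : α < 1) (hC : 0 < C)
    (hξ : IsIIDSample ξ Pi P)
    (hF : RegularObjective (objective f Pi) xstar)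
    (hf : RegularLoss f Pi xstar)
    (hε : NoiseMoments f Pi xstar η α x₀ ξ P) :
    (∀ n : ℕ, Integrable (fun ω =>
      ‖covEstimator (batchSeq C α) (sgd f η α x₀ (fun i => ξ i ω)) n - sandwich f Pi xstar‖) P) ∧
    ∃ K : ℝ, ∀ᶠ n : ℕ in atTop,
      ∫ ω, ‖covEstimator (batchSeq C α) (sgd f η α x₀ (fun i => ξ i ω)) n
          - sandwich f Pi xstar‖ ∂P
        ≤ K * (n : ℝ) ^ (-(1 - α) / 4) := by
  have hint : ∀ n : ℕ, Integrable (fun ω =>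
      ‖covEstimator (batchSeq C α) (sgd f η α x₀ (fun i => ξ i ω)) n
        - sandwich f Pi xstar‖) P := fun n =>
    ((integrable_covEstimator hξ hF hf hε _ n).sub (integrable_const _)).norm
  refine ⟨hint, ?_⟩
  set b := EuclideanSpace.basisFun (Fin d) ℝ
  choose K hK using fun p q => exists_mean_entry_le hη hα hα' hC hξ hF hf hε (b p) (b q)
  obtain ⟨c, hc, hL⟩ := exists_le_sum_batchLength hα' hC
  refine ⟨c⁻¹ * ∑ p, ∑ q, K p q, ?_⟩
  filter_upwards [eventually_ge_atTop 1] with n hn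
  have hn0 : (0 : ℝ) < n := by exact_mod_cast hn
  set L := ∑ i ∈ Finset.Icc 1 n, (batchLength (batchSeq C α) i : ℝ) with hLdef
  have hcn : 0 < c * (n : ℝ) ^ ((3 + α) / 2) := by positivity
  have hLn : c * (n : ℝ) ^ ((3 + α) / 2) ≤ L := hL n hn
  have hL0 : 0 < L := hcn.trans_le hLn
  set X : Fin d → Fin d → Ω → ℝ := fun p q ω => ∑ i ∈ Finset.Icc 1 n,
      ((inner ℝ (b p) (centredBatchSum (batchSeq C α) (sgd f η α x₀ (fun i => ξ i ω)) n i) : ℝ)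
        * inner ℝ (b q) (centredBatchSum (batchSeq C α) (sgd f η α x₀ (fun i => ξ i ω)) n i)
        - batchLength (batchSeq C α) i * inner ℝ (b p) (sandwich f Pi xstar (b q)))
  have hX : ∀ p q, MeanLE P (X p q) (K p q * (n : ℝ) ^ ((5 + 3 * α) / 4)) :=
    fun p q => hK p q n hn
  have habs : ∀ p, Integrable (fun ω => ∑ q, |X p q ω|) P := fun p =>
    integrable_finsetSum _ fun q _ => (hX p q).integrable.abs
  calc ∫ ω, ‖covEstimator (batchSeq C α) (sgd f η α x₀ (fun i => ξ i ω)) n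
          - sandwich f Pi xstar‖ ∂P
      ≤ ∫ ω, L⁻¹ * ∑ p, ∑ q, |X p q ω| ∂P :=
        integral_mono (hint n) ((integrable_finsetSum _ fun p _ => habs p).const_mul _)
          fun ω => norm_covEstimator_sub_le _ _ hn _ b
    _ = L⁻¹ * ∑ p, ∑ q, ∫ ω, |X p q ω| ∂P := by
        rw [integral_const_mul, integral_finsetSum _ fun p _ => habs p]
        simp only [integral_finsetSum _ fun q _ => (hX _ q).integrable.abs]
    _ ≤ (c * (n : ℝ) ^ ((3 + α) / 2))⁻¹ * ∑ p, ∑ q, K p q * (n : ℝ) ^ ((5 + 3 * α) / 4) := by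
        refine mul_le_mul (inv_anti₀ hcn hLn) ?_ ?_ (inv_nonneg.2 hcn.le)
        · exact Finset.sum_le_sum fun p _ => Finset.sum_le_sum fun q _ => (hX p q).integral_le
        · exact Finset.sum_nonneg fun p _ => Finset.sum_nonneg fun q _ =>
            integral_nonneg fun ω => abs_nonneg _
    _ = c⁻¹ * (∑ p, ∑ q, K p q)
          * ((n : ℝ) ^ ((5 + 3 * α) / 4) * ((n : ℝ) ^ ((3 + α) / 2))⁻¹) := by
        simp only [← Finset.sum_mul]
        rw [mul_inv]
        ring
    -- The exponents combine as (5+3α)/4 - (3+α)/2 = -(1-α)/4.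
    _ = c⁻¹ * (∑ p, ∑ q, K p q) * (n : ℝ) ^ (-(1 - α) / 4) := by
        rw [← Real.rpow_neg hn0.le, ← Real.rpow_add hn0]
        congr 2
        ring
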